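/- **Setting.** Let $\Omega\subset\mathbb R^2$ be a bounded connected open set with Lipschitz boundary, let $\lambda,\mu>0$, $\mathbb C e=\lambda(\operatorname{tr}e)I+2\mu e$ for symmetric $2\times2$ matrices $e$, and let $\psi\in H^{1/2}(\partial\Omega;\mathbb R^2)$. Let $\Gamma_0\subset\overline\Omega$ be compact and connected with $0\in\Gamma_0$, $\mathcal H^1(\Gamma_0)<\infty$ and $$\lim_{\varrho\to0}\frac{\mathcal H^1(\Gamma_0\cap B_\varrho)}{2\varrho}=\frac12 ,$$ where $B_\varrho$ is the open disc of radius $\varrho$ centred at $0$. For an open set $U$ write $e(u)=\frac12(\nabla u+\nabla u^T)$ (in the sense of distributions) and $LD(U)=\{u\in L^2_{\rm loc}(U;\mathbb R^2): e(u)\in L^2(U)\}$. Let $u_0\in LD(\Omega\setminus\Gamma_0)$ be a minimizer of $$\frac12\int_{\Omega\setminus\Gamma_0}\mathbb C e(v):e(v)\,dx$$ among all $v\in LD(\Omega\setminus\Gamma_0)$ with $v=\psi$ on $\partial\Omega\setminus\Gamma_0$ in the sense of traces, and let $\sigma_0=\mathbb C e(u_0)$. For a disc $B$ centred at $0$, $H^1_{0,\Gamma_0}(B)$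 denotes the closure in $H^1(B)$ of $\mathcal C^\infty_c(\overline B\setminus\Gamma_0)$. **Proposition.** There is $r_0>0$, depending only on $\Omega$ and $\Gamma_0$, with the following property. Let $0<R_0<R_0'$ be such that $\overline{B_{R_0'}}\subset\Omega$ and $\partial B_{R_0'}\cap\Gamma_0\ne\emptyset$, and assume that $R_0'\le r_0$ or that $\Gamma_0\cap\overline{B_{R_0}}$ is contained in a connected subset of $\Gamma_0\cap\overline{B_{R_0'}}$ (for instance, that $\Gamma_0\cap\overline{B_{R_0}}$ is connected). Put $B=B_{R_0}$. Then there is a function $v_0\in H^1_{0,\Gamma_0}(B;\mathbb R^2)\cap\mathcal C^\infty(\overline B\setminus\Gamma_0;\mathbb R^2)$ such that $$\nabla v_0=\sigma_0^\perp:=\begin{pmatrix}-(\sigma_0)_{12}&(\sigma_0)_{11}\\-(\sigma_0)_{22}&(\sigma_0)_{12}\end{pmatrix}\qquad\text{in }B\setminus\Gamma_0,$$ where $(\nabla v_0)_{ij}=\partial_j (v_0)_i$ and the equality is one of $L^2$ fields (that is, almost everywhere). -/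

import Mathlib

open MeasureTheory Filter Topology Set Metric
open scoped ContDiff ENNReal NNReal

/-- The Euclidean plane `ℝ²`. -/
abbrev Plane : Type := EuclideanSpace ℝ (Fin 2)

/-- Real `2 × 2` matrices. -/
abbrev Mat2 : Type := Matrix (Fin 2) (Fin 2) ℝ

/-! ### Sobolev spaces and Lebesgue deformations -/

/-- The classical partial derivative `∂_j f`. -/
noncomputable def partialDeriv (j : Fin 2) (f : Plane → ℝ) (x : Plane) : ℝ :=
  fderiv ℝ f x (EuclideanSpace.single j (1 : ℝ))

/-- `φ ∈ C_c^∞(U)`. -/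
structure IsTestFunction (U : Set Plane) (φ : Plane → ℝ) : Prop where
  smooth : ContDiff ℝ ∞ φ
  compact_support : HasCompactSupport φ
  support_subset : tsupport φ ⊆ U

/-- `f ∈ L²(U)`, for real valued `f`. -/
def MemL2 (U : Set Plane) (f : Plane → ℝ) : Prop :=
  MemLp f 2 (volume.restrict U)

/-- `u ∈ L²_loc(U; ℝ²)`. -/
def MemL2Loc (U : Set Plane) (u : Plane → Plane) : Prop :=
  ∀ K : Set Plane, IsCompact K → K ⊆ U → MemLp u 2 (volume.restrict K)

/-- `w ∈ H¹(U)` with weak gradient `g`. -/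
structure HasH1Gradient (U : Set Plane) (w : Plane → ℝ) (g : Fin 2 → Plane → ℝ) : Prop where
  memL2 : MemL2 U w
  grad_memL2 : ∀ j, MemL2 U (g j)
  weak_partial : ∀ j, ∀ φ : Plane → ℝ, IsTestFunction U φ →
    ∫ x in U, w x * partialDeriv j φ x = -∫ x in U, g j x * φ x

/-- `w ∈ H¹_{0,Γ}(U)`, for `U` bounded and `Γ` closed: `w` is the limit in `H¹(U)` of (restrictions
to `U` of) smooth compactly supported functions whose support does not meet `Γ ∩ closure U`. -/
def MemH1Zero (U Γ : Set Plane) (w : Plane → ℝ) : Prop :=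
  ∃ g : Fin 2 → Plane → ℝ, HasH1Gradient U w g ∧
    ∃ φ : ℕ → Plane → ℝ,
      (∀ n, IsTestFunction (Γ ∩ closure U)ᶜ (φ n)) ∧
      Tendsto (fun n => eLpNorm (fun x => w x - φ n x) 2 (volume.restrict U)) atTop (𝓝 0) ∧
      ∀ j, Tendsto (fun n => eLpNorm (fun x => g j x - partialDeriv j (φ n) x) 2
        (volume.restrict U)) atTop (𝓝 0)

/-- `u ∈ LD(U)` with distributional symmetrized gradient `e(u) = e ∈ L²(U)`. -/
structure HasLDStrain (U : Set Plane) (u : Plane → Plane) (e : Plane → Mat2) : Prop where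
  memL2Loc : MemL2Loc U u
  strain_memL2 : ∀ i j, MemL2 U (fun x => e x i j)
  weak_strain : ∀ i j, ∀ φ : Plane → ℝ, IsTestFunction U φ →
    ∫ x in U, (u x i * partialDeriv j φ x + u x j * partialDeriv i φ x) / 2
      = -∫ x in U, e x i j * φ x

/-! ### The reference configuration, the crack and the boundary values -/

/-- `Ω` has Lipschitz boundary: near each boundary point, and in suitable orthonormal coordinates,
it is the part of the plane strictly above the graph of a Lipschitz function. -/
def HasLipschitzBoundary (Ω : Set Plane) : Prop :=
  ∀ x ∈ frontier Ω, ∃ r : ℝ, 0 < r ∧ ∃ (T : Plane ≃ₗᵢ[ℝ] Plane) (K : ℝ≥0) (g : ℝ → ℝ),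
    LipschitzWith K g ∧ Ω ∩ ball x r = {y ∈ ball x r | g (T y 0) < T y 1}

/-- Bounded connected open sets with Lipschitz boundary. -/
structure IsReferenceConfiguration (Ω : Set Plane) : Prop where
  isOpen : IsOpen Ω
  isConnected : IsConnected Ω
  isBounded : Bornology.IsBounded Ω
  lipschitz : HasLipschitzBoundary Ω

/-- The class of admissible cracks: compact connected subsets of `closure Ω` that contain the
origin and have finite length. -/
structure IsAdmissibleCrack (Ω Γ : Set Plane) : Prop where
  isCompact : IsCompact Γ
  isConnected : IsConnected Γ
  subset_closure : Γ ⊆ closure Ω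
  zero_mem : (0 : Plane) ∈ Γ
  finite_length : μH[1] Γ < ⊤

/-- `Γ` has (one-dimensional) density `1/2` at the origin. -/
def HasDensityHalf (Γ : Set Plane) : Prop :=
  Tendsto (fun ρ : ℝ => (μH[1] (Γ ∩ ball 0 ρ)).toReal / (2 * ρ)) (𝓝[>] 0) (𝓝 (1 / 2))

/-- `ψ ∈ H^{1/2}(∂Ω; ℝ²)`: square integrable with finite Gagliardo seminorm. -/
def MemHHalfBoundary (Ω : Set Plane) (ψ : Plane → Plane) : Prop :=
  MemLp ψ 2 ((μH[1]).restrict (frontier Ω)) ∧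
    ∫⁻ x in frontier Ω, (∫⁻ y in frontier Ω, ‖ψ x - ψ y‖ₑ ^ 2 / edist x y ^ 2 ∂μH[1]) ∂μH[1] < ⊤

/-- `u = ψ` on `∂Ω ∖ Γ` in the sense of traces: at `H¹`-almost every `x ∈ ∂Ω ∖ Γ`, the value `ψ x`
is the limit, in the mean, of `u` on `Ω ∩ B_r(x)` as `r → 0`. -/
def TraceEq (Ω Γ : Set Plane) (u ψ : Plane → Plane) : Prop :=
  ∀ᵐ x ∂((μH[1]).restrict (frontier Ω \ Γ)),
    Tendsto (fun r : ℝ => (⨍⁻ y in (ball x r ∩ Ω), ‖u y - ψ x‖ₑ ∂volume)) (𝓝[>] 0) (𝓝 0)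

/-! ### Linearized elasticity -/

/-- Hooke's law `ℂ e = λ (tr e) I + 2 μ e`. -/
noncomputable def hooke (lam mu : ℝ) (e : Mat2) : Mat2 :=
  (lam * e.trace) • (1 : Mat2) + (2 * mu) • e

/-- The elastic energy `½ ∫_U ℂ e : e dx`. -/
noncomputable def elasticEnergy (lam mu : ℝ) (U : Set Plane) (e : Plane → Mat2) : ℝ :=
  (1 / 2) * ∫ x in U, ∑ i, ∑ j, hooke lam mu (e x) i j * e x i j

/-- `u`, with strain `e = e(u)`, minimizes the elastic energy on `Ω ∖ Γ` among all displacements in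
`LD(Ω ∖ Γ)` that are equal to `ψ` on `∂Ω ∖ Γ`. -/
structure IsElasticMinimizer (lam mu : ℝ) (Ω Γ : Set Plane) (ψ u : Plane → Plane)
    (e : Plane → Mat2) : Prop where
  memLD : HasLDStrain (Ω \ Γ) u e
  boundary : TraceEq Ω Γ u ψ
  minimal : ∀ (v : Plane → Plane) (f : Plane → Mat2),
    HasLDStrain (Ω \ Γ) v f → TraceEq Ω Γ v ψ →
      elasticEnergy lam mu (Ω \ Γ) e ≤ elasticEnergy lam mu (Ω \ Γ) f

/-- The rotated stress `σ^⊥`, with rows `(-σ₁₂, σ₁₁)` and `(-σ₂₂, σ₁₂)`. -/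
def rotatedStress (σ : Mat2) : Mat2 :=
  !![-(σ 0 1), σ 0 0; -(σ 1 1), σ 0 1]

/-- `v ∈ H¹_{0,Γ}(B; ℝ²) ∩ C^∞(closure B ∖ Γ; ℝ²)` and `∇v = σ^⊥` in `B ∖ Γ`, where `B` is the open
ball of radius `R` centred at the origin and `(∇v)_{ij} = ∂_j v_i`. -/
structure IsHarmonicConjugate (R : ℝ) (Γ : Set Plane) (σ : Plane → Mat2)
    (v : Plane → Plane) : Prop where
  memH1Zero : ∀ i, MemH1Zero (ball 0 R) Γ (fun x => v x i)
  smooth : ContDiffOn ℝ ∞ v (closedBall 0 R \ Γ)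
  gradient : ∀ᵐ x ∂(volume.restrict (ball (0 : Plane) R \ Γ)), ∀ i j,
    partialDeriv j (fun y => v y i) x = rotatedStress (σ x) i j

/-!
Write `σ` for the stress, `Γ` for the crack and `curlField f = (∂₁f, -∂₀f)`. Row by row, the claim
is that each row `s` of `σ` is `curlField v` on a disc, with `v` an `H¹` limit of test functions
that vanish near `Γ`.

*Reduction to a connected piece.* If `R₀' ≤ r₀`, the density `1/2` at the origin leaves no room for
a second piece of `Γ ∩ closedBall 0 (2 R₀)` reaching into `closedBall 0 R₀`: each of the two pieces
would project onto a long interval of radii (`exists_preconnected_of_density`). So in both cases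
there is a closed connected `C ⊆ Γ`, compactly inside `Ω`, that contains `Γ ∩ closedBall 0 R₀`.

*Approximation* (`IsElasticMinimizer.exists_curlField_approx`). By duality in `L²` it suffices that
a field `G` orthogonal to `curlField f` for all test functions `f` off `C` is orthogonal to `s`.
Away from `C` such a `G` is an `L²` limit of gradients of functions supported in a fixed disc
(`exists_gradField_approx`). This is again duality: a divergence free field that vanishes near `C`
is, after mollification, `curlField f` with `f` constant near the connected set `C`, hence
orthogonal to `G`. By the Poincaré–Wirtinger inequality the potentials converge in the unbounded
component `O` of the complement of `C` (`exists_potential`). The limit, cut off to `O`, is an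
admissible variation, because it may jump across `Γ`; this gives the orthogonality of `s` and `G` on
`O` (`IsElasticMinimizer.row_orthogonal`). In the bounded components the minimizer has no strain,
for there its displacement could be replaced by zero (`IsElasticMinimizer.strain_eq_zero`).

*Convergence of the potentials* (`IsElasticMinimizer.exists_conjugate_row`). The approximating `f`
vanish on `C`, which meets each circle of radius less than `R₀`. Hence the gradient controls `f` in
`L²` on the disc (`eLpNorm_ball_le_of_zero_on_circles`), and the limit exists in `H¹`.

*Smoothness* (`exists_smooth_representative`). The compatibility condition of the strain and the
equilibrium equation make the trace `τ` of `σ` weakly harmonic, and also `v₀ - x₁ τ / 2` and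
`v₁ + x₀ τ / 2`. Weyl's lemma (`exists_contDiffOn_of_weakly_harmonic`) gives smooth representatives.
-/

/-! ### Partial derivatives and test functions -/

lemma fderiv_apply_eq_sum_partialDeriv (f : Plane → ℝ) (x v : Plane) :
    fderiv ℝ f x v = v 0 * partialDeriv 0 f x + v 1 * partialDeriv 1 f x := by
  have hv : v = v 0 • EuclideanSpace.single (0 : Fin 2) (1 : ℝ)
      + v 1 • EuclideanSpace.single (1 : Fin 2) (1 : ℝ) := by
    ext i; fin_cases i <;> simp
  conv_lhs => rw [hv]
  simp [partialDeriv]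

lemma ContDiff.partialDeriv {f : Plane → ℝ} (hf : ContDiff ℝ ∞ f) (j : Fin 2) :
    ContDiff ℝ ∞ (partialDeriv j f) := by
  unfold _root_.partialDeriv
  exact (hf.fderiv_right (m := ∞) (by simp)).clm_apply contDiff_const

lemma ContDiffOn.partialDeriv {f : Plane → ℝ} {U : Set Plane} (hU : IsOpen U)
    (hf : ContDiffOn ℝ ∞ f U) (j : Fin 2) : ContDiffOn ℝ ∞ (partialDeriv j f) U := by
  unfold _root_.partialDeriv
  exact (hf.fderiv_of_isOpen hU (m := ∞) (by simp)).clm_apply contDiffOn_const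

lemma tsupport_partialDeriv_subset (f : Plane → ℝ) (j : Fin 2) :
    tsupport (partialDeriv j f) ⊆ tsupport f :=
  tsupport_fderiv_apply_subset ℝ _

lemma partialDeriv_comm {f : Plane → ℝ} (hf : ContDiff ℝ ∞ f) (i j : Fin 2) :
    partialDeriv i (partialDeriv j f) = partialDeriv j (partialDeriv i f) := by
  have key : ∀ (i j : Fin 2) (x : Plane), partialDeriv i (partialDeriv j f) x
      = fderiv ℝ (fderiv ℝ f) x (EuclideanSpace.single i 1) (EuclideanSpace.single j 1) := by
    intro i j x
    have hd : DifferentiableAt ℝ (fderiv ℝ f) x :=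
      ((hf.fderiv_right (m := ∞) (by simp)).differentiable (by simp)) x
    have h : HasFDerivAt (partialDeriv j f) _ x :=
      hd.hasFDerivAt.clm_apply (hasFDerivAt_const (EuclideanSpace.single j (1 : ℝ)) x)
    rw [partialDeriv, h.fderiv]
    simp
  ext x
  rw [key, key]
  have h2 : IsSymmSndFDerivAt ℝ f x :=
    hf.contDiffAt.isSymmSndFDerivAt (by
      rw [minSmoothness_of_isRCLikeNormedField]; exact WithTop.coe_le_coe.2 le_top)
  exact h2.eq _ _

lemma partialDeriv_add {f g : Plane → ℝ} {x : Plane} (hf : DifferentiableAt ℝ f x)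
    (hg : DifferentiableAt ℝ g x) (j : Fin 2) :
    partialDeriv j (fun y => f y + g y) x = partialDeriv j f x + partialDeriv j g x := by
  simp [partialDeriv, fderiv_fun_add hf hg]

lemma partialDeriv_sub {f g : Plane → ℝ} {x : Plane} (hf : DifferentiableAt ℝ f x)
    (hg : DifferentiableAt ℝ g x) (j : Fin 2) :
    partialDeriv j (fun y => f y - g y) x = partialDeriv j f x - partialDeriv j g x := by
  simp [partialDeriv, fderiv_fun_sub hf hg]

lemma partialDeriv_const_mul {f : Plane → ℝ} {x : Plane} (hf : DifferentiableAt ℝ f x)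
    (c : ℝ) (j : Fin 2) :
    partialDeriv j (fun y => c * f y) x = c * partialDeriv j f x := by
  simp [partialDeriv, fderiv_const_mul hf c]

lemma partialDeriv_mul {f g : Plane → ℝ} {x : Plane} (hf : DifferentiableAt ℝ f x)
    (hg : DifferentiableAt ℝ g x) (j : Fin 2) :
    partialDeriv j (fun y => f y * g y) x
      = f x * partialDeriv j g x + partialDeriv j f x * g x := by
  simp [partialDeriv, fderiv_fun_mul hf hg]; ring

lemma partialDeriv_coord (i j : Fin 2) (x : Plane) :
    partialDeriv j (fun y : Plane => y i) x = if i = j then 1 else 0 := by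
  have : HasFDerivAt (fun y : Plane => y i) (EuclideanSpace.proj i : Plane →L[ℝ] ℝ) x :=
    (EuclideanSpace.proj i : Plane →L[ℝ] ℝ).hasFDerivAt
  rw [partialDeriv, this.fderiv]
  simp

lemma partialDeriv_congr {f g : Plane → ℝ} {x : Plane} (h : f =ᶠ[𝓝 x] g) (j : Fin 2) :
    partialDeriv j f x = partialDeriv j g x := by
  rw [partialDeriv, h.fderiv_eq]; rfl

lemma contDiff_coord (i : Fin 2) : ContDiff ℝ ∞ (fun y : Plane => y i) :=
  (EuclideanSpace.proj i : Plane →L[ℝ] ℝ).contDiff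

namespace IsTestFunction

variable {U V : Set Plane} {φ ψ : Plane → ℝ}

lemma mono (h : IsTestFunction U φ) (hUV : U ⊆ V) : IsTestFunction V φ :=
  ⟨h.smooth, h.compact_support, h.support_subset.trans hUV⟩

lemma differentiable (h : IsTestFunction U φ) : Differentiable ℝ φ :=
  h.smooth.differentiable (by simp)

lemma continuous (h : IsTestFunction U φ) : Continuous φ := h.smooth.continuous

lemma partialDeriv (h : IsTestFunction U φ) (j : Fin 2) :
    IsTestFunction U (partialDeriv j φ) :=
  ⟨h.smooth.partialDeriv j, h.compact_support.mono'
    (subset_closure.trans (tsupport_partialDeriv_subset φ j)),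
    (tsupport_partialDeriv_subset φ j).trans h.support_subset⟩

lemma zero : IsTestFunction U (fun _ => 0) :=
  ⟨contDiff_const, HasCompactSupport.zero, by simp [tsupport]⟩

lemma add (h : IsTestFunction U φ) (h' : IsTestFunction U ψ) :
    IsTestFunction U (fun x => φ x + ψ x) :=
  ⟨h.smooth.add h'.smooth, h.compact_support.add h'.compact_support,
    (tsupport_add φ ψ).trans (union_subset h.support_subset h'.support_subset)⟩

/-- The product of a test function on `U` with a function that is smooth on `U`. -/
lemma mul_left (hU : IsOpen U) (h : IsTestFunction U φ) {f : Plane → ℝ}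
    (hf : ContDiffOn ℝ ∞ f U) : IsTestFunction U (fun x => f x * φ x) := by
  have hs : tsupport (fun x => f x * φ x) ⊆ tsupport φ := tsupport_mul_subset_right
  refine ⟨?_, h.compact_support.mono' (subset_closure.trans hs), hs.trans h.support_subset⟩
  refine contDiff_iff_contDiffAt.2 fun x => ?_
  by_cases hx : x ∈ tsupport φ
  · exact (hf.contDiffAt (hU.mem_nhds (h.support_subset hx))).mul h.smooth.contDiffAt
  · have : (fun x => f x * φ x) =ᶠ[𝓝 x] fun _ => 0 := by
      filter_upwards [(isClosed_tsupport φ).isOpen_compl.mem_nhds hx] with y hy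
      simp [image_eq_zero_of_notMem_tsupport hy]
    exact contDiffAt_const.congr_of_eventuallyEq this

lemma const_mul (h : IsTestFunction U φ) (c : ℝ) : IsTestFunction U (fun x => c * φ x) :=
  ⟨contDiff_const.mul h.smooth, h.compact_support.mul_left,
    (tsupport_mul_subset_right (f := fun _ => c)).trans h.support_subset⟩

lemma sub (h : IsTestFunction U φ) (h' : IsTestFunction U ψ) :
    IsTestFunction U (fun x => φ x - ψ x) := by
  simpa [sub_eq_add_neg] using h.add (h'.const_mul (-1))

lemma eq_zero (h : IsTestFunction U φ) {x : Plane} (hx : x ∉ U) : φ x = 0 :=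
  image_eq_zero_of_notMem_tsupport fun h' => hx (h.support_subset h')

lemma memLp (h : IsTestFunction U φ) (p : ℝ≥0∞) (μ : Measure Plane)
    [IsLocallyFiniteMeasure μ] : MemLp φ p μ :=
  h.continuous.memLp_of_hasCompactSupport h.compact_support

lemma integrable (h : IsTestFunction U φ) : Integrable φ :=
  h.continuous.integrable_of_hasCompactSupport h.compact_support

lemma setIntegral_mul_eq (h : IsTestFunction U φ) (f : Plane → ℝ) :
    ∫ x in U, f x * φ x = ∫ x, f x * φ x :=
  setIntegral_eq_integral_of_forall_compl_eq_zero fun x hx => by simp [h.eq_zero hx]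

/-- Test functions may be cut off along an open set whose boundary avoids their support. -/
lemma indicator {O : Set Plane} (h : IsTestFunction U φ) (hO : IsOpen O) (hV : IsOpen V)
    (hd : Disjoint O V) (hU : U ⊆ O ∪ V) :
    IsTestFunction (U ∩ O) (O.indicator φ) ∧
      ∀ j, _root_.partialDeriv j (O.indicator φ) = O.indicator (_root_.partialDeriv j φ) := by
  have hloc : ∀ x, (x ∈ O ∧ O.indicator φ =ᶠ[𝓝 x] φ) ∨
      (x ∉ O ∧ O.indicator φ =ᶠ[𝓝 x] fun _ => 0) := by
    intro x
    by_cases hxO : x ∈ O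
    · exact Or.inl ⟨hxO, by filter_upwards [hO.mem_nhds hxO] with y hy using by simp [hy]⟩
    refine Or.inr ⟨hxO, ?_⟩
    by_cases hxφ : x ∈ tsupport φ
    · have hxV : x ∈ V := (hU (h.support_subset hxφ)).resolve_left hxO
      filter_upwards [hV.mem_nhds hxV] with y hy
      exact indicator_of_notMem (fun hyO => disjoint_left.1 hd hyO hy) _
    · filter_upwards [(isClosed_tsupport φ).isOpen_compl.mem_nhds hxφ] with y hy
      simp [image_eq_zero_of_notMem_tsupport hy]
  have hsupp : tsupport (O.indicator φ) ⊆ tsupport φ :=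
    closure_mono (by rw [support_indicator]; exact inter_subset_right)
  refine ⟨⟨contDiff_iff_contDiffAt.2 fun x => ?_,
    h.compact_support.mono' (subset_closure.trans hsupp), fun x hx => ⟨h.support_subset
      (hsupp hx), ?_⟩⟩, fun j => funext fun x => ?_⟩
  · rcases hloc x with ⟨-, hx⟩ | ⟨-, hx⟩
    · exact h.smooth.contDiffAt.congr_of_eventuallyEq hx
    · exact contDiffAt_const.congr_of_eventuallyEq hx
  · rcases hloc x with ⟨hxO, -⟩ | ⟨-, hx0⟩
    · exact hxO
    · exact absurd hx (notMem_tsupport_iff_eventuallyEq.2 hx0)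
  · rcases hloc x with ⟨hxO, hx⟩ | ⟨hxO, hx⟩
    · rw [partialDeriv_congr hx, indicator_of_mem hxO]
    · rw [partialDeriv_congr hx, indicator_of_notMem hxO]
      simp [_root_.partialDeriv]

end IsTestFunction

/-- Integration by parts for a function that is smooth near the support of a test function. -/
lemma integral_mul_partialDeriv {U : Set Plane} (hU : IsOpen U) {f φ : Plane → ℝ}
    (hf : ContDiffOn ℝ ∞ f U) (hφ : IsTestFunction U φ) (j : Fin 2) :
    ∫ x, f x * partialDeriv j φ x = -∫ x, partialDeriv j f x * φ x := by
  refine integral_mul_fderiv_eq_neg_fderiv_mul_of_integrable (μ := volume) ?_ ?_ ?_ ?_ ?_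
  · exact (hφ.mul_left hU (hf.partialDeriv hU j)).integrable
  · exact ((hφ.partialDeriv j).mul_left hU hf).integrable
  · exact (hφ.mul_left hU hf).integrable
  · intro x hx
    exact (hf.contDiffAt (hU.mem_nhds (hφ.support_subset hx))).differentiableAt (by simp)
  · exact fun x _ => hφ.differentiable x

/-- A smooth cutoff between a compact set and an open neighbourhood. -/
lemma exists_cutoff {K U : Set Plane} (hK : IsCompact K) (hU : IsOpen U) (hKU : K ⊆ U) :
    ∃ χ : Plane → ℝ, IsTestFunction U χ ∧ ∃ W, IsOpen W ∧ K ⊆ W ∧ ∀ x ∈ W, χ x = 1 := by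
  obtain ⟨L, hL, hKL, hLU⟩ := exists_compact_between hK hU hKU
  obtain ⟨L', hL', hLL', hL'U⟩ := exists_compact_between hL hU hLU
  obtain ⟨f, hf0, hf1, -⟩ := exists_contMDiffMap_zero_one_of_isClosed (n := (⊤ : ℕ∞))
    (modelWithCornersSelf ℝ Plane) (s := (interior L')ᶜ) (t := L)
    isOpen_interior.isClosed_compl hL.isClosed
    (disjoint_left.2 fun x hx hx' => hx (hLL' hx'))
  have hs : Function.support f ⊆ L' := by
    intro x hx
    by_contra h
    exact hx (hf0 fun h' => h (interior_subset h'))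
  have ht : tsupport f ⊆ L' := closure_minimal hs hL'.isClosed
  exact ⟨f, ⟨f.contMDiff.contDiff, hL'.of_isClosed_subset (isClosed_tsupport _) ht,
    ht.trans hL'U⟩, interior L, isOpen_interior, hKL, fun x hx => hf1 (interior_subset hx)⟩

/-! ### Convolution with smooth kernels -/

/-- The convolution `(k ⋆ w)(x) = ∫ k(x - t) w(t) dt` of two scalar functions in the plane. -/
noncomputable def kernelConv (k w : Plane → ℝ) (x : Plane) : ℝ := ∫ t, k (x - t) * w t

lemma kernelConv_eq_convolution (k w : Plane → ℝ) :
    kernelConv k w = convolution k w (ContinuousLinearMap.mul ℝ ℝ) volume := by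
  ext x
  rw [convolution_mul_swap]; rfl

lemma contDiff_kernelConv {U : Set Plane} {k w : Plane → ℝ} (hk : IsTestFunction U k)
    (hw : LocallyIntegrable w) : ContDiff ℝ ∞ (kernelConv k w) := by
  rw [kernelConv_eq_convolution]
  exact hk.compact_support.contDiff_convolution_left _ hk.smooth hw

lemma partialDeriv_kernelConv {U : Set Plane} {k w : Plane → ℝ} (hk : IsTestFunction U k)
    (hw : LocallyIntegrable w) (j : Fin 2) :
    partialDeriv j (kernelConv k w) = kernelConv (partialDeriv j k) w := by
  ext x
  have hk1 : ContDiff ℝ 1 k := hk.smooth.of_le (by exact_mod_cast le_top)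
  have h := hk.compact_support.hasFDerivAt_convolution_left (ContinuousLinearMap.mul ℝ ℝ)
    (μ := volume) hk1 hw x
  rw [partialDeriv, kernelConv_eq_convolution, h.fderiv, convolution_eq_swap]
  have hint : Integrable (fun t => ((ContinuousLinearMap.mul ℝ ℝ).precompL Plane)
      (fderiv ℝ k (x - t)) (w t)) := by
    have := (hk.compact_support.fderiv (𝕜 := ℝ)).convolutionExists_left
      ((ContinuousLinearMap.mul ℝ ℝ).precompL Plane) (μ := volume)
      (hk1.continuous_fderiv (by simp)) hw x
    exact this.integrable_swap
  rw [ContinuousLinearMap.integral_apply hint]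
  rfl

/-- Reflecting and translating a test function supported in a small ball. -/
lemma IsTestFunction.comp_sub_left {δ : ℝ} {k : Plane → ℝ} (hk : IsTestFunction (ball 0 δ) k)
    (x : Plane) : IsTestFunction (ball x δ) (fun y => k (x - y)) ∧
      ∀ j y, _root_.partialDeriv j (fun y => k (x - y)) y = -_root_.partialDeriv j k (x - y) := by
  have hts : tsupport (fun y => k (x - y)) ⊆ (fun y => x - y) ⁻¹' tsupport k :=
    tsupport_comp_subset_preimage k (by fun_prop)
  refine ⟨⟨hk.smooth.comp (contDiff_const.sub contDiff_id),
    hk.compact_support.comp_homeomorph (Homeomorph.subLeft x), fun y hy => ?_⟩, fun j y => ?_⟩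
  · have := hk.support_subset (hts hy)
    simpa [dist_eq_norm, norm_sub_rev] using this
  · have h1 : HasFDerivAt (fun y : Plane => x - y) (-ContinuousLinearMap.id ℝ Plane) y := by
      simpa using (hasFDerivAt_id y).const_sub x
    have h2 := (hk.differentiable (x - y)).hasFDerivAt.comp y h1
    have h3 : fderiv ℝ (fun y => k (x - y)) y = _ := h2.fderiv
    simp only [_root_.partialDeriv, h3]
    simp

/-! ### Approximation in `L²` by orthogonality -/

/-- If every `L²` field orthogonal to `𝒱` is orthogonal to `s`, then `s` is an `L²` limit of
elements of `𝒱`. -/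
lemma exists_mem_eLpNorm_sub_lt {μ : Measure Plane} (𝒱 : Submodule ℝ (Plane → Plane))
    (h𝒱 : ∀ X ∈ 𝒱, MemLp X 2 μ) {s : Plane → Plane} (hs : MemLp s 2 μ)
    (h : ∀ G : Plane → Plane, MemLp G 2 μ →
      (∀ X ∈ 𝒱, ∫ x, inner ℝ (X x) (G x) ∂μ = 0) → ∫ x, inner ℝ (s x) (G x) ∂μ = 0)
    {ε : ℝ≥0∞} (hε : 0 < ε) : ∃ X ∈ 𝒱, eLpNorm (fun x => s x - X x) 2 μ < ε := by
  let K : Submodule ℝ (Lp Plane 2 μ) :=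
    { carrier := {F | ∃ X ∈ 𝒱, F =ᵐ[μ] X}
      zero_mem' := ⟨0, 𝒱.zero_mem, Lp.coeFn_zero _ _ _⟩
      add_mem' := by
        rintro F F' ⟨X, hX, hFX⟩ ⟨X', hX', hFX'⟩
        exact ⟨X + X', 𝒱.add_mem hX hX', (Lp.coeFn_add F F').trans (hFX.add hFX')⟩
      smul_mem' := by
        rintro c F ⟨X, hX, hFX⟩
        exact ⟨c • X, 𝒱.smul_mem c hX, (Lp.coeFn_smul c F).trans (hFX.const_smul c)⟩ }
  have hmem : hs.toLp s ∈ Kᗮᗮ := by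
    rw [Submodule.mem_orthogonal']
    intro G hG
    rw [L2.inner_def]
    have := h G (Lp.memLp G) fun X hX => by
      have h1 := (Submodule.mem_orthogonal K G).1 hG ((h𝒱 X hX).toLp X)
        ⟨X, hX, (h𝒱 X hX).coeFn_toLp⟩
      rw [L2.inner_def] at h1
      rw [← h1]
      refine integral_congr_ae ?_
      filter_upwards [(h𝒱 X hX).coeFn_toLp] with x hx
      rw [hx]
    rw [← this]
    refine integral_congr_ae ?_
    filter_upwards [hs.coeFn_toLp] with x hx
    rw [hx]
  rw [Submodule.orthogonal_orthogonal_eq_closure] at hmem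
  have hcl : hs.toLp s ∈ closure (K : Set (Lp Plane 2 μ)) := hmem
  obtain ⟨F, ⟨X, hX, hFX⟩, hF⟩ := EMetric.mem_closure_iff.1 hcl ε hε
  refine ⟨X, hX, ?_⟩
  rw [Lp.edist_def] at hF
  convert hF using 1
  refine eLpNorm_congr_ae ?_
  filter_upwards [hs.coeFn_toLp, hFX] with x h1 h2
  simp [h1, h2]

/-- The exterior of a disc is connected. -/
lemma isPreconnected_norm_gt (ρ : ℝ) (hρ : 0 ≤ ρ) : IsPreconnected {x : Plane | ρ < ‖x‖} := by
  have h0 : IsConnected ({0}ᶜ : Set Plane) :=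
    isConnected_compl_singleton_of_one_lt_rank
      (by rw [← Module.finrank_eq_rank, finrank_euclideanSpace_fin]; norm_num) 0
  have hc : ContinuousOn (fun x : Plane => (1 + ρ * ‖x‖⁻¹) • x) {0}ᶜ := by
    refine ContinuousOn.smul (continuousOn_const.add (continuousOn_const.mul
      (continuous_norm.continuousOn.inv₀ fun x hx => norm_ne_zero_iff.2 hx))) continuousOn_id
  have := h0.isPreconnected.image _ hc
  convert this using 1
  ext x
  constructor
  · intro hx
    have hx0 : 0 < ‖x‖ := hρ.trans_lt hx
    have hne : x ≠ 0 := norm_pos_iff.1 hx0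
    have hd : 0 < ‖x‖ - ρ := sub_pos.2 hx
    refine ⟨((‖x‖ - ρ) * ‖x‖⁻¹) • x, ?_, ?_⟩
    · simp [hne, hd.ne']
    · have hn : ‖((‖x‖ - ρ) * ‖x‖⁻¹) • x‖ = ‖x‖ - ρ := by
        rw [norm_smul, Real.norm_of_nonneg (by positivity), mul_assoc, inv_mul_cancel₀ hx0.ne',
          mul_one]
      simp only [hn, smul_smul]
      have : (1 + ρ * (‖x‖ - ρ)⁻¹) * ((‖x‖ - ρ) * ‖x‖⁻¹) = 1 := by field_simp; ring
      rw [this, one_smul]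
  · rintro ⟨y, hy, rfl⟩
    have hy0 : 0 < ‖y‖ := norm_pos_iff.2 hy
    change ρ < _
    rw [norm_smul, Real.norm_of_nonneg (by positivity), add_mul, mul_assoc,
      inv_mul_cancel₀ hy0.ne']
    linarith

/-! ### Small pieces of the crack are connected in a slightly larger disc -/

/-- If a relatively clopen part `A` of `Γ ∩ closedBall 0 ρ` is not all of the connected set `Γ`,
then it runs from each of its points to the boundary of the disc. -/
lemma exists_norm_eq_of_clopen {Γ A B : Set Plane} {ρ t : ℝ} (hΓ : IsPreconnected Γ)
    (hA : IsClosed A) (hB : IsClosed B) (hAB : Disjoint A B)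
    (hun : A ∪ B = Γ ∩ closedBall 0 ρ) {a b : Plane} (ha : a ∈ A) (hb : b ∈ Γ) (hbA : b ∉ A)
    (hat : ‖a‖ ≤ t) (htρ : t < ρ) : ∃ y ∈ A, ‖y‖ = t := by
  by_contra! hne
  have hAΓ : A ⊆ Γ := fun y hy => (hun.subset (Or.inl hy)).1
  have hcov : Γ ⊆ (A ∩ closedBall 0 t) ∪ (B ∪ {y | t ≤ ‖y‖}) := by
    intro y hy
    rcases le_or_gt t ‖y‖ with h | h
    · exact Or.inr (Or.inr h)
    · have : y ∈ A ∪ B := hun.superset ⟨hy, by simpa using (h.trans htρ).le⟩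
      rcases this with h' | h'
      · exact Or.inl ⟨h', by simpa using h.le⟩
      · exact Or.inr (Or.inl h')
  have hcl : IsClosed {y : Plane | t ≤ ‖y‖} := isClosed_le continuous_const continuous_norm
  obtain ⟨y, -, ⟨hyA, hyt⟩, hy⟩ := isPreconnected_closed_iff.1 hΓ _ _
    (hA.inter isClosed_closedBall) (hB.union hcl) hcov ⟨a, hAΓ ha, ha, by simpa using hat⟩
    ⟨b, hb, (hcov hb).resolve_left fun h => hbA h.1⟩
  rcases hy with hy | hy
  · exact disjoint_left.1 hAB hyA hy
  · exact hne y hyA (le_antisymm (by simpa using hyt) hy)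

/-- A set that meets each circle of radius in `[a, b)` has length at least `b - a`. -/
lemma ofReal_sub_le_hausdorffMeasure {A : Set Plane} {a b : ℝ}
    (h : ∀ t, a ≤ t → t < b → ∃ y ∈ A, ‖y‖ = t) : ENNReal.ofReal (b - a) ≤ μH[1] A := by
  have h1 : Ico a b ⊆ (fun y : Plane => ‖y‖) '' A := fun t ht => h t ht.1 ht.2
  have h2 := (lipschitzWith_one_norm (E := Plane)).lipschitzOnWith (s := A)
    |>.hausdorffMeasure_image_le (d := 1) zero_le_one
  calc ENNReal.ofReal (b - a) = volume (Ico a b) := by simp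
    _ = μH[1] (Ico a b) := by rw [hausdorffMeasure_real]
    _ ≤ μH[1] ((fun y : Plane => ‖y‖) '' A) := measure_mono h1
    _ ≤ μH[1] A := by simpa using h2

/-- A piece of `Γ ∩ closedBall 0 (2R)` that does not contain the origin but meets
`closedBall 0 R` would have length at least `R`, in addition to the length `2R` of the piece through
the origin. Near a point of density `1/2` there is no room for it. -/
lemma exists_preconnected_of_density {Γ : Set Plane} (hc : IsCompact Γ) (hconn : IsPreconnected Γ)
    (h0 : (0 : Plane) ∈ Γ) (hfin : μH[1] Γ < ⊤) (hdens : HasDensityHalf Γ) :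
    ∃ r : ℝ, 0 < r ∧ ∀ R, 0 < R → R ≤ r → ∃ C : Set Plane, IsPreconnected C ∧
      Γ ∩ closedBall 0 R ⊆ C ∧ C ⊆ Γ ∩ closedBall 0 (2 * R) := by
  have hev := (tendsto_order.1 hdens).2 (6 / 10) (by norm_num)
  obtain ⟨r', hr', hr'2⟩ := mem_nhdsGT_iff_exists_Ioo_subset.1 hev
  have hr'0 : 0 < r' := hr'
  refine ⟨r' / 3, by positivity, fun R hR hRr => ?_⟩
  set K := Γ ∩ closedBall (0 : Plane) (2 * R) with hK
  have hKc : IsCompact K := hc.inter_right isClosed_closedBall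
  have h0K : (0 : Plane) ∈ K := ⟨h0, by simp [hR.le]⟩
  refine ⟨connectedComponentIn K 0, isPreconnected_connectedComponentIn, fun x hx => ?_,
    connectedComponentIn_subset K 0⟩
  by_contra hxC
  have hxR : ‖x‖ ≤ R := by simpa using hx.2
  have hxK : x ∈ K := ⟨hx.1, by simp; linarith⟩
  have : CompactSpace K := isCompact_iff_compactSpace.1 hKc
  have hx' : (⟨x, hxK⟩ : K) ∉ connectedComponent (⟨0, h0K⟩ : K) := by
    rw [connectedComponentIn_eq_image h0K] at hxC
    exact fun h => hxC ⟨_, h, rfl⟩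
  rw [connectedComponent_eq_iInter_isClopen, mem_iInter] at hx'
  push Not at hx'
  obtain ⟨⟨A, hA, h0A⟩, hxA⟩ := hx'
  have hcA : IsCompact (Subtype.val '' A) := hA.1.isCompact.image continuous_subtype_val
  have hcB : IsCompact (Subtype.val '' Aᶜ) := hA.compl.1.isCompact.image continuous_subtype_val
  have hdisj : Disjoint (Subtype.val '' A) (Subtype.val '' Aᶜ) :=
    (disjoint_image_iff Subtype.val_injective).2 disjoint_compl_right
  have hun : Subtype.val '' A ∪ Subtype.val '' Aᶜ = K := by
    rw [← image_union, union_compl_self, image_univ, Subtype.range_coe]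
  have h0' : (0 : Plane) ∈ Subtype.val '' A := ⟨_, h0A, rfl⟩
  have hx'' : x ∈ Subtype.val '' Aᶜ := ⟨_, hxA, rfl⟩
  have m1 := ofReal_sub_le_hausdorffMeasure (a := 0) (b := 2 * R) fun t ht ht2 =>
    exists_norm_eq_of_clopen hconn hcA.isClosed hcB.isClosed hdisj hun h0' hx.1
      (disjoint_right.1 hdisj hx'') (by simpa using ht) ht2
  have m2 := ofReal_sub_le_hausdorffMeasure (a := R) (b := 2 * R) fun t ht ht2 =>
    exists_norm_eq_of_clopen hconn hcB.isClosed hcA.isClosed hdisj.symm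
      (by rw [union_comm, hun]) hx'' h0 (disjoint_left.1 hdisj h0') (hxR.trans ht) ht2
  have hlt := hr'2 (show 12 / 5 * R ∈ Ioo 0 r' from ⟨by positivity, by linarith⟩)
  have hlt' : (μH[1] (Γ ∩ ball 0 (12 / 5 * R))).toReal < 3 * R := by
    have : (μH[1] (Γ ∩ ball 0 (12 / 5 * R))).toReal / (2 * (12 / 5 * R)) < 6 / 10 := hlt
    rw [div_lt_iff₀ (by positivity)] at this
    linarith
  have hsub : K ⊆ Γ ∩ ball 0 (12 / 5 * R) := by
    rintro y ⟨hy, hy2⟩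
    refine ⟨hy, ?_⟩
    rw [mem_closedBall_zero_iff] at hy2
    rw [mem_ball_zero_iff]
    linarith
  have htot : ENNReal.ofReal (3 * R) ≤ μH[1] (Γ ∩ ball 0 (12 / 5 * R)) :=
    calc ENNReal.ofReal (3 * R) = ENNReal.ofReal (2 * R - 0) + ENNReal.ofReal (2 * R - R) := by
          rw [← ENNReal.ofReal_add (by linarith) (by linarith)]; ring_nf
      _ ≤ μH[1] (Subtype.val '' A) + μH[1] (Subtype.val '' Aᶜ) := add_le_add m1 m2
      _ = μH[1] K := by rw [← measure_union hdisj hcB.isClosed.measurableSet, hun]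
      _ ≤ _ := measure_mono hsub
  have hfin' : μH[1] (Γ ∩ ball 0 (12 / 5 * R)) ≠ ⊤ :=
    ((measure_mono inter_subset_left).trans_lt hfin).ne
  exact absurd ((ENNReal.ofReal_le_iff_le_toReal hfin').1 htot) (not_le.2 hlt')

/-- The crack meets each circle between the origin and a point of the crack. -/
lemma exists_mem_norm_eq {Γ : Set Plane} (hconn : IsPreconnected Γ) (h0 : (0 : Plane) ∈ Γ)
    {p : Plane} (hp : p ∈ Γ) {t : ℝ} (ht : 0 ≤ t) (htp : t ≤ ‖p‖) : ∃ y ∈ Γ, ‖y‖ = t := by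
  have := hconn.intermediate_value h0 hp continuous_norm.continuousOn
  exact this ⟨by simpa using ht, htp⟩

/-- A set of finite length has zero area. -/
lemma volume_eq_zero_of_hausdorffMeasure_lt_top {Γ : Set Plane} (h : μH[1] Γ < ⊤) :
    volume Γ = 0 := by
  have h2 : μH[2] Γ = 0 := by
    rcases Measure.hausdorffMeasure_zero_or_top (show (1 : ℝ) < 2 by norm_num) Γ with h' | h'
    · exact h'
    · exact absurd h' h.ne
  have hH : Measure.IsAddHaarMeasure (μH[2] : Measure Plane) := by
    have := isAddHaarMeasure_hausdorffMeasure (E := Plane)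
    simpa using this
  exact Measure.absolutelyContinuous_isAddHaarMeasure volume (μH[2] : Measure Plane) h2

/-! ### The first variation of the elastic energy -/

lemma IsTestFunction.integrable_mul {U : Set Plane} {f ζ : Plane → ℝ} (hζ : IsTestFunction U ζ)
    (hf : MemLp f 2 (volume.restrict (tsupport ζ))) : Integrable (fun x => f x * ζ x) := by
  have h1 : IntegrableOn (fun x => f x * ζ x) (tsupport ζ) :=
    hf.integrable_mul (hζ.memLp 2 _)
  refine (integrableOn_iff_integrable_of_support_subset fun x hx => ?_).1 h1
  exact subset_tsupport ζ (right_ne_zero_of_mul hx)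

lemma MemL2Loc.comp {U : Set Plane} {u : Plane → Plane} (hu : MemL2Loc U u) {K : Set Plane}
    (hK : IsCompact K) (hKU : K ⊆ U) (i : Fin 2) :
    MemLp (fun x => u x i) 2 (volume.restrict K) :=
  (hu K hK hKU).of_le ((EuclideanSpace.proj i : Plane →L[ℝ] ℝ).continuous.comp_aestronglyMeasurable
    (hu K hK hKU).1) (Eventually.of_forall fun x => PiLp.norm_apply_le (u x) i)

lemma MemL2Loc.integrable_mul {U : Set Plane} {u : Plane → Plane} (hu : MemL2Loc U u)
    {ζ : Plane → ℝ} (hζ : IsTestFunction U ζ) (i : Fin 2) :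
    Integrable (fun x => u x i * ζ x) :=
  hζ.integrable_mul (hu.comp hζ.compact_support hζ.support_subset i)

lemma MemL2.integrable_mul {U : Set Plane} {f ζ : Plane → ℝ} (hf : MemL2 U f)
    (hζ : IsTestFunction U ζ) : Integrable (fun x => f x * ζ x) :=
  hζ.integrable_mul (hf.mono_measure (Measure.restrict_mono hζ.support_subset le_rfl))

namespace HasLDStrain

variable {U : Set Plane} {u w : Plane → Plane} {e f : Plane → Mat2}

lemma integrable_left (h : HasLDStrain U u e) (i j : Fin 2) {ζ : Plane → ℝ}
    (hζ : IsTestFunction U ζ) :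
    Integrable (fun x => (u x i * partialDeriv j ζ x + u x j * partialDeriv i ζ x) / 2) :=
  ((h.memL2Loc.integrable_mul (hζ.partialDeriv j) i).add
    (h.memL2Loc.integrable_mul (hζ.partialDeriv i) j)).div_const 2

lemma add_smul (h : HasLDStrain U u e) (h' : HasLDStrain U w f) (t : ℝ) :
    HasLDStrain U (fun x => u x + t • w x) (fun x => e x + t • f x) := by
  refine ⟨fun K hK hKU => (h.memL2Loc K hK hKU).add ((h'.memL2Loc K hK hKU).const_smul t),
    fun i j => (h.strain_memL2 i j).add ((h'.strain_memL2 i j).const_smul t),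
    fun i j ζ hζ => ?_⟩
  have e1 := h.weak_strain i j ζ hζ
  have e2 := h'.weak_strain i j ζ hζ
  have i1 := (h.integrable_left i j hζ).integrableOn (s := U)
  have i2 := (h'.integrable_left i j hζ).integrableOn (s := U)
  have i3 := ((h.strain_memL2 i j).integrable_mul hζ).integrableOn (s := U)
  have i4 := ((h'.strain_memL2 i j).integrable_mul hζ).integrableOn (s := U)
  calc ∫ x in U, ((u x + t • w x) i * partialDeriv j ζ x
        + (u x + t • w x) j * partialDeriv i ζ x) / 2
      = ∫ x in U, ((u x i * partialDeriv j ζ x + u x j * partialDeriv i ζ x) / 2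
        + t * ((w x i * partialDeriv j ζ x + w x j * partialDeriv i ζ x) / 2)) := by
        congr 1; ext x; simp; ring
    _ = -(∫ x in U, e x i j * ζ x) + t * -∫ x in U, f x i j * ζ x := by
        rw [integral_add i1 (i2.const_mul t), integral_const_mul, e1, e2]
    _ = -∫ x in U, (e x i j * ζ x + t * (f x i j * ζ x)) := by
        rw [integral_add i3 (i4.const_mul t), integral_const_mul]; ring
    _ = _ := by congr 2; ext x; simp; ring

/-- A displacement may be replaced by zero on a union of components. -/
lemma indicator (h : HasLDStrain U u e) {O V : Set Plane} (hO : IsOpen O) (hV : IsOpen V)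
    (hd : Disjoint O V) (hU : U ⊆ O ∪ V) : HasLDStrain U (O.indicator u) (O.indicator e) := by
  refine ⟨fun K hK hKU => (h.memL2Loc K hK hKU).indicator hO.measurableSet, fun i j => ?_,
    fun i j ζ hζ => ?_⟩
  · have := (h.strain_memL2 i j).indicator hO.measurableSet
    refine (memLp_congr_ae (Eventually.of_forall fun x => ?_)).1 this
    by_cases hx : x ∈ O <;> simp [hx]
  · obtain ⟨h1, h2⟩ := hζ.indicator hO hV hd hU
    have := h.weak_strain i j _ (h1.mono inter_subset_left)
    convert this using 2
    · ext x
      rw [h2, h2]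
      by_cases hx : x ∈ O <;> simp [hx]
    · congr 1
      ext x
      by_cases hx : x ∈ O <;> simp [hx]

/-- The strain of a displacement is symmetric. -/
lemma ae_symm (h : HasLDStrain U u e) (hU : IsOpen U) (i j : Fin 2) :
    ∀ᵐ x ∂(volume.restrict U), e x i j = e x j i := by
  rw [ae_restrict_iff' hU.measurableSet]
  have hm : MemLp (fun x => e x i j - e x j i) 2 (volume.restrict U) :=
    (h.strain_memL2 i j).sub (h.strain_memL2 j i)
  have hl : LocallyIntegrableOn (fun x => e x i j - e x j i) U := by
    rw [locallyIntegrableOn_iff hU.isLocallyClosed]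
    intro K hKU hK
    have : IsFiniteMeasure (volume.restrict K) := ⟨by simpa using hK.measure_lt_top⟩
    exact (hm.mono_measure (Measure.restrict_mono hKU le_rfl)).integrable one_le_two
  have := hU.ae_eq_zero_of_integral_contDiff_smul_eq_zero hl fun g hg hgc hgU => by
    have hζ : IsTestFunction U g := ⟨hg, hgc, hgU⟩
    have e1 := h.weak_strain i j g hζ
    have e2 := h.weak_strain j i g hζ
    have e3 : ∫ x in U, e x i j * g x = ∫ x in U, e x j i * g x := by
      rw [← neg_inj, ← e1, ← e2]
      congr 1; ext x; ring
    rw [hζ.setIntegral_mul_eq (fun x => e x i j), hζ.setIntegral_mul_eq (fun x => e x j i)] at e3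
    calc ∫ x, g x • (e x i j - e x j i) = ∫ x, (e x i j * g x - e x j i * g x) := by
          congr 1; ext x; simp; ring
      _ = 0 := by
          rw [integral_sub ((h.strain_memL2 i j).integrable_mul hζ)
            ((h.strain_memL2 j i).integrable_mul hζ), e3, sub_self]
  filter_upwards [this] with x hx hxU
  exact sub_eq_zero.1 (hx hxU)

end HasLDStrain

/-- Functions that agree off a compact subset of `Ω` have the same trace on `∂Ω`. -/
lemma TraceEq.congr {Ω Γ : Set Plane} {u w ψ : Plane → Plane} (hΩ : IsOpen Ω) (hΓ : IsClosed Γ)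
    (h : TraceEq Ω Γ u ψ) {K : Set Plane} (hK : IsClosed K) (hKΩ : K ⊆ Ω)
    (huw : ∀ x ∉ K, w x = u x) : TraceEq Ω Γ w ψ := by
  filter_upwards [h, ae_restrict_mem (isClosed_frontier.measurableSet.diff hΓ.measurableSet)]
    with x hx hxF
  have hxK : x ∉ K := fun hxK => by
    have := hxF.1
    rw [hΩ.frontier_eq] at this
    exact this.2 (hKΩ hxK)
  obtain ⟨ε, hε, hεK⟩ := Metric.isOpen_iff.1 hK.isOpen_compl x hxK
  refine hx.congr' ?_
  filter_upwards [Ioo_mem_nhdsGT hε] with r hr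
  refine laverage_congr ?_
  refine (ae_restrict_iff' (measurableSet_ball.inter hΩ.measurableSet)).2
    (Eventually.of_forall fun y hy => ?_)
  simp only [huw y (hεK (ball_subset_ball hr.2.le hy.1))]

/-- The bilinear form `ℂ e : f`. -/
noncomputable def hookeForm (lam mu : ℝ) (e f : Mat2) : ℝ := ∑ i, ∑ j, hooke lam mu e i j * f i j

lemma hookeForm_eq (lam mu : ℝ) (e f : Mat2) : hookeForm lam mu e f
    = lam * (e 0 0 + e 1 1) * (f 0 0 + f 1 1) + 2 * mu * (e 0 0 * f 0 0 + e 0 1 * f 0 1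
      + e 1 0 * f 1 0 + e 1 1 * f 1 1) := by
  simp [hookeForm, hooke, Fin.sum_univ_two, Matrix.trace_fin_two]; ring

lemma integrable_hookeForm {U : Set Plane} (lam mu : ℝ) {e f : Plane → Mat2}
    (he : ∀ i j, MemL2 U (fun x => e x i j)) (hf : ∀ i j, MemL2 U (fun x => f x i j)) :
    Integrable (fun x => hookeForm lam mu (e x) (f x)) (volume.restrict U) := by
  simp_rw [hookeForm_eq]
  have hp : ∀ i j k l, Integrable (fun x => e x i j * f x k l) (volume.restrict U) :=
    fun i j k l => MemLp.integrable_mul (p := 2) (q := 2) (he i j) (hf k l)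
  have h1 := (((hp 0 0 0 0).add (hp 0 0 1 1)).add ((hp 1 1 0 0).add (hp 1 1 1 1))).const_mul lam
  have h2 := ((((hp 0 0 0 0).add (hp 0 1 0 1)).add (hp 1 0 1 0)).add (hp 1 1 1 1)).const_mul
    (2 * mu)
  refine (h1.add h2).congr (Eventually.of_forall fun x => ?_)
  simp only [Pi.add_apply]; ring

/-- The Euler–Lagrange equation, for variations that vanish near `∂Ω`. -/
lemma IsElasticMinimizer.first_variation {lam mu : ℝ} {Ω Γ : Set Plane} {ψ u : Plane → Plane}
    {e : Plane → Mat2} (h : IsElasticMinimizer lam mu Ω Γ ψ u e) (hΩ : IsOpen Ω)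
    (hΓ : IsClosed Γ) {K : Set Plane} (hK : IsClosed K) (hKΩ : K ⊆ Ω) {w : Plane → Plane}
    {f : Plane → Mat2} (hw : HasLDStrain (Ω \ Γ) w f) (hw0 : ∀ x ∉ K, w x = 0) :
    ∫ x in Ω \ Γ, hookeForm lam mu (e x) (f x) = 0 := by
  have key : ∀ t : ℝ, 0 ≤ 2 * t * (∫ x in Ω \ Γ, hookeForm lam mu (e x) (f x))
      + t ^ 2 * ∫ x in Ω \ Γ, hookeForm lam mu (f x) (f x) := by
    intro t
    have hm := h.minimal _ _ (h.memLD.add_smul hw t)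
      (h.boundary.congr hΩ hΓ hK hKΩ fun x hx => by simp [hw0 x hx])
    have i1 := integrable_hookeForm lam mu h.memLD.strain_memL2 h.memLD.strain_memL2
    have i2 := integrable_hookeForm lam mu h.memLD.strain_memL2 hw.strain_memL2
    have i3 := integrable_hookeForm lam mu hw.strain_memL2 hw.strain_memL2
    have i4 : Integrable (fun x => 2 * t * hookeForm lam mu (e x) (f x)
        + t ^ 2 * hookeForm lam mu (f x) (f x)) (volume.restrict (Ω \ Γ)) :=
      (i2.const_mul _).add (i3.const_mul _)
    have hexp : ∫ x in Ω \ Γ, hookeForm lam mu (e x + t • f x) (e x + t • f x)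
        = (∫ x in Ω \ Γ, hookeForm lam mu (e x) (e x))
          + (2 * t * (∫ x in Ω \ Γ, hookeForm lam mu (e x) (f x))
            + t ^ 2 * ∫ x in Ω \ Γ, hookeForm lam mu (f x) (f x)) := by
      rw [← integral_const_mul, ← integral_const_mul,
        ← integral_add (i2.const_mul _) (i3.const_mul _), ← integral_add i1 i4]
      congr 1; ext x
      simp only [hookeForm_eq, Matrix.add_apply, Matrix.smul_apply, smul_eq_mul]
      ring
    have hm' : (1 / 2) * (∫ x in Ω \ Γ, hookeForm lam mu (e x) (e x))
        ≤ (1 / 2) * ∫ x in Ω \ Γ, hookeForm lam mu (e x + t • f x) (e x + t • f x) := hm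
    rw [hexp] at hm'
    linarith
  set A := ∫ x in Ω \ Γ, hookeForm lam mu (e x) (f x)
  set B := ∫ x in Ω \ Γ, hookeForm lam mu (f x) (f x)
  by_contra hA
  have hA2 : 0 < A ^ 2 := by positivity
  -- the step `t = -A / (|B| + 1)` makes the linear term win
  have hb : 0 < |B| + 1 := by positivity
  have h1 := key (-A / (|B| + 1))
  have h2 : 2 * (-A / (|B| + 1)) * A + (-A / (|B| + 1)) ^ 2 * B
      = A ^ 2 * (B - 2 * (|B| + 1)) / (|B| + 1) ^ 2 := by field_simp; ring
  rw [h2] at h1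
  have h3 : B - 2 * (|B| + 1) < 0 := by have := le_abs_self B; have := abs_nonneg B; linarith
  have h4 : A ^ 2 * (B - 2 * (|B| + 1)) / (|B| + 1) ^ 2 < 0 :=
    div_neg_of_neg_of_pos (mul_neg_of_pos_of_neg hA2 h3) (by positivity)
  linarith

/-- The strain of the minimizer vanishes on the components of the complement of the crack that do
not reach `∂Ω`. -/
lemma IsElasticMinimizer.strain_eq_zero {lam mu : ℝ} {Ω Γ : Set Plane} {ψ u : Plane → Plane}
    {e : Plane → Mat2} (h : IsElasticMinimizer lam mu Ω Γ ψ u e) (hlam : 0 < lam) (hmu : 0 < mu)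
    (hΩ : IsOpen Ω) (hΓ : IsClosed Γ) {K : Set Plane} (hK : IsClosed K) (hKΩ : K ⊆ Ω)
    {O V : Set Plane} (hO : IsOpen O) (hV : IsOpen V) (hd : Disjoint O V)
    (hU : Ω \ Γ ⊆ O ∪ V) (hVK : V ⊆ K) :
    ∀ᵐ x ∂(volume.restrict (Ω \ Γ)), x ∈ V → ∀ i j, e x i j = 0 := by
  have hw := h.memLD.indicator hV hO hd.symm (by rwa [union_comm])
  have h0 := h.first_variation hΩ hΓ hK hKΩ hw fun x hx =>
    indicator_of_notMem (fun hxV => hx (hVK hxV)) _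
  have heq : ∀ x, hookeForm lam mu (e x) (V.indicator e x)
      = V.indicator (fun x => hookeForm lam mu (e x) (e x)) x := by
    intro x
    by_cases hx : x ∈ V <;> simp [hx, hookeForm_eq]
  have hnn : 0 ≤ fun x => hookeForm lam mu (e x) (V.indicator e x) := by
    intro x
    simp only [heq, Pi.zero_apply]
    refine indicator_nonneg (fun y _ => ?_) x
    rw [hookeForm_eq]
    have := mul_nonneg hlam.le (mul_self_nonneg (e y 0 0 + e y 1 1))
    have := mul_nonneg hmu.le (add_nonneg (add_nonneg (add_nonneg (mul_self_nonneg (e y 0 0))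
      (mul_self_nonneg (e y 0 1))) (mul_self_nonneg (e y 1 0))) (mul_self_nonneg (e y 1 1)))
    linarith
  have h1 := (integral_eq_zero_iff_of_nonneg hnn
    (integrable_hookeForm lam mu h.memLD.strain_memL2 hw.strain_memL2)).1 h0
  filter_upwards [h1] with x hx hxV
  simp only [indicator_of_mem hxV, Pi.zero_apply, hookeForm_eq] at hx
  have hs : e x 0 0 * e x 0 0 + e x 0 1 * e x 0 1 + e x 1 0 * e x 1 0 + e x 1 1 * e x 1 1 ≤ 0 := by
    have := mul_nonneg hlam.le (mul_self_nonneg (e x 0 0 + e x 1 1))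
    by_contra! hpos
    have := mul_pos hmu hpos
    linarith
  have hz : ∀ i j, e x i j * e x i j ≤ 0 := by
    have := mul_self_nonneg (e x 0 0)
    have := mul_self_nonneg (e x 0 1)
    have := mul_self_nonneg (e x 1 0)
    have := mul_self_nonneg (e x 1 1)
    intro i j
    fin_cases i <;> fin_cases j <;> simp only [Fin.zero_eta, Fin.mk_one] <;> linarith
  exact fun i j => mul_self_eq_zero.1 (le_antisymm (hz i j) (mul_self_nonneg _))

lemma hooke_apply (lam mu : ℝ) (e : Mat2) (i j : Fin 2) :
    hooke lam mu e i j = lam * (e 0 0 + e 1 1) * (if i = j then 1 else 0) + 2 * mu * e i j := by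
  simp [hooke, Matrix.trace_fin_two, Matrix.one_apply]

lemma memL2_hooke {U : Set Plane} (lam mu : ℝ) {e : Plane → Mat2}
    (he : ∀ i j, MemL2 U (fun x => e x i j)) (i j : Fin 2) :
    MemL2 U (fun x => hooke lam mu (e x) i j) := by
  simp_rw [hooke_apply]
  have h1 : MemL2 U (fun x => lam * (e x 0 0 + e x 1 1)) :=
    ((he 0 0).add (he 1 1)).const_mul lam
  have h2 : MemL2 U (fun x => lam * (e x 0 0 + e x 1 1) * (if i = j then 1 else 0)) := by
    simpa [MemL2, mul_comm] using h1.const_mul (if i = j then (1 : ℝ) else 0)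
  exact h2.add ((he i j).const_mul (2 * mu))

/-- The rows of the stress are orthogonal to the gradients of all scalar functions on `Ω ∖ Γ`,
possibly discontinuous across `Γ`, that vanish near `∂Ω`. -/
lemma IsElasticMinimizer.row_orthogonal {lam mu : ℝ} {Ω Γ : Set Plane} {ψ u : Plane → Plane}
    {e : Plane → Mat2} (h : IsElasticMinimizer lam mu Ω Γ ψ u e) (hΩ : IsOpen Ω)
    (hΓ : IsClosed Γ) {K : Set Plane} (hK : IsClosed K) (hKΩ : K ⊆ Ω) {φ : Plane → ℝ}
    {g : Fin 2 → Plane → ℝ}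
    (hφ : ∀ L : Set Plane, IsCompact L → L ⊆ Ω \ Γ → MemLp φ 2 (volume.restrict L))
    (hg : ∀ j, MemL2 (Ω \ Γ) (g j)) (hφg : ∀ j ζ, IsTestFunction (Ω \ Γ) ζ →
      ∫ x, φ x * partialDeriv j ζ x = -∫ x, g j x * ζ x)
    (hφ0 : ∀ x ∉ K, φ x = 0) (k : Fin 2) :
    ∫ x in Ω \ Γ, (hooke lam mu (e x) k 0 * g 0 x + hooke lam mu (e x) k 1 * g 1 x) = 0 := by
  have hU : IsOpen (Ω \ Γ) := hΩ.sdiff hΓ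
  let d : Fin 2 → ℝ := fun i => if i = k then 1 else 0
  have hstrain : HasLDStrain (Ω \ Γ) (fun x => φ x • EuclideanSpace.single k (1 : ℝ))
      (fun x => Matrix.of fun i j => (d i * g j x + d j * g i x) / 2) := by
    refine ⟨fun L hL hLU => ?_, fun i j => ?_, fun i j ζ hζ => ?_⟩
    · refine (hφ L hL hLU).of_le ((hφ L hL hLU).1.smul_const _) (Eventually.of_forall fun x => ?_)
      simp [norm_smul]
    · have := (((hg j).const_mul (d i)).add ((hg i).const_mul (d j))).const_mul (1 / 2)
      refine (memLp_congr_ae (Eventually.of_forall fun x => ?_)).1 this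
      simp; ring
    · have hl : ∀ j, Integrable (fun x => φ x * partialDeriv j ζ x) := fun j =>
        (hζ.partialDeriv j).integrable_mul (hφ _ (hζ.partialDeriv j).compact_support
          (hζ.partialDeriv j).support_subset)
      have hr : ∀ j, Integrable (fun x => g j x * ζ x) := fun j => (hg j).integrable_mul hζ
      calc ∫ x in Ω \ Γ, ((φ x • EuclideanSpace.single k (1 : ℝ) : Plane) i * partialDeriv j ζ x
            + (φ x • EuclideanSpace.single k (1 : ℝ) : Plane) j * partialDeriv i ζ x) / 2
          = ∫ x in Ω \ Γ, (d i / 2 * (φ x * partialDeriv j ζ x)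
            + d j / 2 * (φ x * partialDeriv i ζ x)) := by
            congr 1; ext x; simp [d]; split_ifs <;> ring
        _ = ∫ x, (d i / 2 * (φ x * partialDeriv j ζ x)
            + d j / 2 * (φ x * partialDeriv i ζ x)) :=
            setIntegral_eq_integral_of_forall_compl_eq_zero fun x hx => by
              simp [(hζ.partialDeriv j).eq_zero hx, (hζ.partialDeriv i).eq_zero hx]
        _ = -∫ x, (d i / 2 * (g j x * ζ x) + d j / 2 * (g i x * ζ x)) := by
            rw [integral_add ((hl j).const_mul _) ((hl i).const_mul _),
              integral_add ((hr j).const_mul _) ((hr i).const_mul _)]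
            simp only [integral_const_mul, hφg j ζ hζ, hφg i ζ hζ]
            ring
        _ = _ := by
            rw [← setIntegral_eq_integral_of_forall_compl_eq_zero (s := Ω \ Γ)
              fun x hx => by simp [hζ.eq_zero hx]]
            congr 2; ext x; simp; ring
  have h0 := h.first_variation hΩ hΓ hK hKΩ hstrain fun x hx => by simp [hφ0 x hx]
  rw [← h0]
  refine integral_congr_ae ?_
  filter_upwards [h.memLD.ae_symm hU 0 1] with x hx
  simp only [hookeForm, Fin.sum_univ_two, hooke_apply, d, Matrix.of_apply]
  fin_cases k <;> simp [hx] <;> ring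

/-! ### Poincaré–Wirtinger estimates -/

/-- The gradient of a scalar function, as a vector field. -/
noncomputable def gradField (f : Plane → ℝ) (x : Plane) : Plane :=
  !₂[partialDeriv 0 f x, partialDeriv 1 f x]

@[simp] lemma gradField_zero (f : Plane → ℝ) (x : Plane) :
    gradField f x 0 = partialDeriv 0 f x := rfl

@[simp] lemma gradField_one (f : Plane → ℝ) (x : Plane) :
    gradField f x 1 = partialDeriv 1 f x := rfl

lemma inner_plane (x y : Plane) : inner ℝ x y = x 0 * y 0 + x 1 * y 1 := by
  simp [PiLp.inner_apply, Fin.sum_univ_two, mul_comm]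

lemma continuous_gradField {f : Plane → ℝ} (hf : ContDiff ℝ ∞ f) : Continuous (gradField f) := by
  refine (PiLp.continuous_toLp 2 _).comp (continuous_pi fun i => ?_)
  fin_cases i
  · exact (hf.partialDeriv 0).continuous
  · exact (hf.partialDeriv 1).continuous

lemma norm_fderiv_apply_le (f : Plane → ℝ) (x v : Plane) :
    ‖fderiv ℝ f x v‖ ≤ ‖gradField f x‖ * ‖v‖ := by
  have : fderiv ℝ f x v = inner ℝ (gradField f x) v := by
    rw [fderiv_apply_eq_sum_partialDeriv, inner_plane]; simp; ring
  rw [this]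
  exact norm_inner_le_norm _ _

lemma lintegral_sq_le {α : Type*} [MeasurableSpace α] {μ : Measure α} {g : α → ℝ≥0∞}
    (hg : AEMeasurable g μ) : (∫⁻ a, g a ∂μ) ^ 2 ≤ μ univ * ∫⁻ a, g a ^ 2 ∂μ := by
  have h := ENNReal.lintegral_mul_le_Lp_mul_Lq μ Real.HolderConjugate.two_two
    (aemeasurable_const (b := (1 : ℝ≥0∞))) hg
  simp only [Pi.mul_apply, one_mul, ENNReal.one_rpow, lintegral_const] at h
  calc (∫⁻ a, g a ∂μ) ^ 2
      ≤ (μ univ ^ (1 / 2 : ℝ) * (∫⁻ a, g a ^ (2 : ℝ) ∂μ) ^ (1 / 2 : ℝ)) ^ 2 := by gcongr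
    _ = _ := by
      rw [mul_pow, ← ENNReal.rpow_natCast, ← ENNReal.rpow_natCast, ← ENNReal.rpow_mul,
        ← ENNReal.rpow_mul]
      norm_num

/-- The one-dimensional Poincaré inequality. -/
lemma enorm_sub_sq_le {g : ℝ → ℝ} (hg : ContDiff ℝ 1 g) {A B a b : ℝ} (ha : a ∈ Icc A B)
    (hb : b ∈ Icc A B) :
    ‖g b - g a‖ₑ ^ 2 ≤ ENNReal.ofReal (B - A) * ∫⁻ t in Icc A B, ‖deriv g t‖ₑ ^ 2 := by
  have hc : Continuous (deriv g) := hg.continuous_deriv le_rfl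
  have h1 : ∫ t in a..b, deriv g t = g b - g a :=
    intervalIntegral.integral_deriv_eq_sub (fun x _ => hg.differentiable (by simp) x)
      (hc.intervalIntegrable a b)
  have h2 : ‖g b - g a‖ₑ ≤ ∫⁻ t in Icc A B, ‖deriv g t‖ₑ := by
    rw [← h1]
    have h3 : ‖∫ t in a..b, deriv g t‖ₑ = ‖∫ t in uIoc a b, deriv g t‖ₑ := by
      rw [← ofReal_norm, ← ofReal_norm, intervalIntegral.norm_intervalIntegral_eq]
    rw [h3]
    refine (enorm_integral_le_lintegral_enorm _).trans (lintegral_mono_set ?_)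
    intro t ht
    rw [mem_uIoc] at ht
    rcases ht with ht | ht
    · exact ⟨ha.1.trans ht.1.le, ht.2.trans hb.2⟩
    · exact ⟨hb.1.trans ht.1.le, ht.2.trans ha.2⟩
  calc ‖g b - g a‖ₑ ^ 2 ≤ (∫⁻ t in Icc A B, ‖deriv g t‖ₑ) ^ 2 := by gcongr
    _ ≤ _ := by
      refine (lintegral_sq_le (by fun_prop)).trans_eq ?_
      simp

lemma lintegral_comp_smul_add_le (H : Plane → ℝ≥0∞) (hH : Measurable H) {a : ℝ}
    (ha : 1 / 2 ≤ a) (z : Plane) : ∫⁻ y, H (a • y + z) ≤ 4 * ∫⁻ y, H y := by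
  have ha0 : 0 < a := by linarith
  have h1 : ∫⁻ y, H (a • y + z) = ∫⁻ y, H (y + z) ∂(Measure.map (fun y => a • y) volume) := by
    rw [lintegral_map (by fun_prop) (by fun_prop)]
  rw [h1, Measure.map_addHaar_smul _ ha0.ne', lintegral_smul_measure,
    lintegral_add_right_eq_self (fun y => H y) z]
  refine mul_le_mul_left ?_ _
  refine (ENNReal.ofReal_le_ofReal (q := 4) ?_).trans (by norm_num)
  rw [finrank_euclideanSpace_fin, abs_of_pos (by positivity)]
  rw [inv_le_comm₀ (by positivity) (by norm_num)]
  nlinarith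

/-- The Poincaré–Wirtinger inequality on a disc. -/
lemma lintegral_lintegral_enorm_sub_sq_le {f : Plane → ℝ} (hf : ContDiff ℝ ∞ f) (c : Plane)
    (r : ℝ) :
    ∫⁻ x in ball c r, ∫⁻ y in ball c r, ‖f x - f y‖ₑ ^ 2
      ≤ ENNReal.ofReal (2 * r) ^ 2 * (4 * volume (ball c r))
        * ∫⁻ x in ball c r, ‖gradField f x‖ₑ ^ 2 := by
  set b := ball c r with hb
  set H : Plane → ℝ≥0∞ := b.indicator fun x => ‖gradField f x‖ₑ ^ 2 with hHdef
  have hgc := continuous_gradField hf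
  have hH : Measurable H := (by fun_prop : Measurable fun x => ‖gradField f x‖ₑ ^ 2).indicator
    measurableSet_ball
  have hHint : ∫⁻ x, H x = ∫⁻ x in b, ‖gradField f x‖ₑ ^ 2 :=
    lintegral_indicator measurableSet_ball _
  have hpt : ∀ x ∈ b, ∀ y ∈ b, ‖f x - f y‖ₑ ^ 2
      ≤ ENNReal.ofReal (2 * r) ^ 2 * ∫⁻ t in Icc (0 : ℝ) 1, H (y + t • (x - y)) := by
    intro x hx y hy
    have hline : ∀ t : ℝ, HasDerivAt (fun t : ℝ => y + t • (x - y)) (x - y) t := fun t => by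
      simpa using ((hasDerivAt_id t).smul_const (x - y)).const_add y
    have hder : ∀ t : ℝ, HasDerivAt (fun t : ℝ => f (y + t • (x - y)))
        (fderiv ℝ f (y + t • (x - y)) (x - y)) t := fun t =>
      ((hf.differentiable (by simp)) _).hasFDerivAt.comp_hasDerivAt t (hline t)
    have hg : ContDiff ℝ 1 (fun t : ℝ => f (y + t • (x - y))) :=
      (hf.of_le (by exact_mod_cast le_top)).comp
        (contDiff_const.add (contDiff_id.smul contDiff_const))
    have h1 := enorm_sub_sq_le hg (left_mem_Icc.2 zero_le_one) (right_mem_Icc.2 zero_le_one)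
    simp only [one_smul, zero_smul, add_zero, sub_zero, ENNReal.ofReal_one, one_mul,
      add_sub_cancel] at h1
    refine h1.trans ?_
    rw [← lintegral_const_mul _ (by fun_prop)]
    refine setLIntegral_mono' measurableSet_Icc fun t ht => ?_
    have hmem : y + t • (x - y) ∈ b := by
      have := (convex_ball c r) hy hx (sub_nonneg.2 ht.2) ht.1 (by ring)
      convert this using 1
      module
    rw [hHdef, indicator_of_mem hmem, (hder t).deriv, ← mul_pow]
    gcongr
    have hxy : ‖x - y‖ ≤ 2 * r := by
      rw [← dist_eq_norm]
      have := dist_triangle_right x y c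
      have h1 : dist x c < r := hx
      have h2 : dist y c < r := hy
      linarith
    rw [← ofReal_norm, ← ofReal_norm, ← ENNReal.ofReal_mul (by linarith [norm_nonneg (x - y)])]
    refine ENNReal.ofReal_le_ofReal ((norm_fderiv_apply_le f _ _).trans ?_)
    rw [mul_comm]
    gcongr
  have hm3 : Measurable fun p : (Plane × Plane) × ℝ => H (p.1.2 + p.2 • (p.1.1 - p.1.2)) := by
    fun_prop
  -- for fixed `t`, integrate first in the variable with the larger coefficient
  have hslice : ∀ t ∈ Icc (0 : ℝ) 1, ∫⁻ x in b, ∫⁻ y in b, H (y + t • (x - y))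
      ≤ 4 * volume b * ∫⁻ x, H x := by
    intro t ht
    have hhalf : ∀ s : ℝ, 1 / 2 ≤ s → ∫⁻ x in b, ∫⁻ y in b, H (s • y + (1 - s) • x)
        ≤ 4 * volume b * ∫⁻ x, H x := by
      intro s hs
      calc ∫⁻ x in b, ∫⁻ y in b, H (s • y + (1 - s) • x)
          ≤ ∫⁻ x in b, 4 * ∫⁻ y, H y := lintegral_mono fun x =>
            (setLIntegral_le_lintegral _ _).trans (lintegral_comp_smul_add_le H hH hs _)
        _ = _ := by rw [setLIntegral_const]; ring
    rcases le_total t (1 / 2) with h | h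
    · refine le_trans (le_of_eq ?_) (hhalf (1 - t) (by linarith))
      congr 1; ext x; congr 1; ext y; congr 1; module
    · rw [lintegral_lintegral_swap (Measurable.aemeasurable (by unfold Function.uncurry; fun_prop))]
      refine le_trans (le_of_eq ?_) (hhalf t h)
      congr 1; ext x; congr 1; ext y; congr 1; module
  calc ∫⁻ x in b, ∫⁻ y in b, ‖f x - f y‖ₑ ^ 2
      ≤ ∫⁻ x in b, ∫⁻ y in b, ENNReal.ofReal (2 * r) ^ 2
          * ∫⁻ t in Icc (0 : ℝ) 1, H (y + t • (x - y)) :=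
        setLIntegral_mono' measurableSet_ball fun x hx =>
          setLIntegral_mono' measurableSet_ball fun y hy => hpt x hx y hy
    _ = ENNReal.ofReal (2 * r) ^ 2 * ∫⁻ x in b, ∫⁻ y in b,
          ∫⁻ t in Icc (0 : ℝ) 1, H (y + t • (x - y)) := by
        have hm2 : Measurable fun p : Plane × Plane =>
            ∫⁻ t in Icc (0 : ℝ) 1, H (p.2 + t • (p.1 - p.2)) := hm3.lintegral_prod_right'
        have hr : ENNReal.ofReal (2 * r) ^ 2 ≠ ⊤ := ENNReal.pow_ne_top ENNReal.ofReal_ne_top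
        rw [← lintegral_const_mul' _ _ hr]
        congr 1; ext x
        rw [lintegral_const_mul' _ _ hr]
    _ = ENNReal.ofReal (2 * r) ^ 2 * ∫⁻ t in Icc (0 : ℝ) 1, ∫⁻ x in b, ∫⁻ y in b,
          H (y + t • (x - y)) := by
        congr 1
        rw [lintegral_lintegral_swap (f := fun t x => ∫⁻ y in b, H (y + t • (x - y)))]
        · congr 1; ext x
          rw [lintegral_lintegral_swap]
          exact Measurable.aemeasurable (by unfold Function.uncurry; fun_prop)
        · refine Measurable.aemeasurable ?_
          have : Measurable fun p : (ℝ × Plane) × Plane => H (p.2 + p.1.1 • (p.1.2 - p.2)) := by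
            fun_prop
          exact this.lintegral_prod_right'
    _ ≤ ENNReal.ofReal (2 * r) ^ 2 * ∫⁻ t in Icc (0 : ℝ) 1, 4 * volume b * ∫⁻ x, H x := by
        gcongr 1
        exact setLIntegral_mono' measurableSet_Icc hslice
    _ = _ := by rw [setLIntegral_const, hHint]; simp; ring

lemma eLpNorm_two_sq {E : Type*} [NormedAddCommGroup E] {μ : Measure Plane} (f : Plane → E) :
    eLpNorm f 2 μ ^ 2 = ∫⁻ x, ‖f x‖ₑ ^ 2 ∂μ := by
  have := eLpNorm_nnreal_pow_eq_lintegral (μ := μ) (f := f) (p := 2) (by norm_num)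
  simpa using this

/-- On a disc, a function is controlled by its gradient and its values on a smaller disc. -/
lemma exists_eLpNorm_ball_le (c c' : Plane) (r r' : ℝ) (hr' : 0 < r')
    (hsub : ball c' r' ⊆ ball c r) : ∃ K : ℝ≥0∞, K ≠ ⊤ ∧ ∀ f : Plane → ℝ, ContDiff ℝ ∞ f →
      eLpNorm f 2 (volume.restrict (ball c r)) ≤ K * (eLpNorm f 2 (volume.restrict (ball c' r'))
        + eLpNorm (gradField f) 2 (volume.restrict (ball c r))) := by
  set b := ball c r
  set b' := ball c' r'
  have hb0 : volume b' ≠ 0 := (measure_ball_pos volume c' hr').ne'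
  have hbt : volume b' ≠ ⊤ := measure_ball_lt_top.ne
  have hbt2 : volume b ≠ ⊤ := measure_ball_lt_top.ne
  set K₁ : ℝ≥0∞ := ENNReal.ofReal (2 * r) ^ 2 * (4 * volume b) with hK₁
  set K₂ : ℝ≥0∞ := (volume b')⁻¹ * (2 * (volume b + K₁)) with hK₂
  have hK₁t : K₁ ≠ ⊤ :=
    ENNReal.mul_ne_top (ENNReal.pow_ne_top ENNReal.ofReal_ne_top)
      (ENNReal.mul_ne_top (by simp) hbt2)
  have hK₂t : K₂ ≠ ⊤ := ENNReal.mul_ne_top (ENNReal.inv_ne_top.2 hb0)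
    (ENNReal.mul_ne_top (by simp) (ENNReal.add_ne_top.2 ⟨hbt2, hK₁t⟩))
  refine ⟨K₂ + 1, ENNReal.add_ne_top.2 ⟨hK₂t, by simp⟩, fun f hf => ?_⟩
  have hW := lintegral_lintegral_enorm_sub_sq_le hf c r
  have hfm : Measurable fun x => ‖f x‖ₑ := hf.continuous.measurable.enorm
  have hmain : volume b' * ∫⁻ x in b, ‖f x‖ₑ ^ 2
      ≤ 2 * (K₁ * ∫⁻ x in b, ‖gradField f x‖ₑ ^ 2)
        + 2 * (volume b * ∫⁻ y in b', ‖f y‖ₑ ^ 2) := by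
    have hpt : ∀ x y, ‖f x‖ₑ ^ 2 ≤ 2 * ‖f x - f y‖ₑ ^ 2 + 2 * ‖f y‖ₑ ^ 2 := by
      intro x y
      have h1 : ‖f x‖ₑ ≤ ‖f x - f y‖ₑ + ‖f y‖ₑ := by
        simpa using enorm_add_le (f x - f y) (f y)
      calc ‖f x‖ₑ ^ 2 ≤ (‖f x - f y‖ₑ + ‖f y‖ₑ) ^ 2 := by gcongr
        _ ≤ 2 * (‖f x - f y‖ₑ ^ 2 + ‖f y‖ₑ ^ 2) := by
          have := ENNReal.rpow_add_le_mul_rpow_add_rpow ‖f x - f y‖ₑ ‖f y‖ₑ one_le_two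
          norm_num at this
          simpa using this
        _ = _ := by ring
    calc volume b' * ∫⁻ x in b, ‖f x‖ₑ ^ 2 = ∫⁻ x in b, ∫⁻ _ in b', ‖f x‖ₑ ^ 2 := by
          simp_rw [setLIntegral_const]
          rw [lintegral_mul_const _ (by fun_prop), mul_comm]
      _ ≤ ∫⁻ x in b, ∫⁻ y in b', (2 * ‖f x - f y‖ₑ ^ 2 + 2 * ‖f y‖ₑ ^ 2) :=
          lintegral_mono fun x => lintegral_mono fun y => hpt x y
      _ = ∫⁻ x in b, ((∫⁻ y in b', 2 * ‖f x - f y‖ₑ ^ 2) + 2 * ∫⁻ y in b', ‖f y‖ₑ ^ 2) := by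
          congr 1; ext x
          rw [lintegral_add_right _ (by fun_prop), lintegral_const_mul' 2 (fun y => ‖f y‖ₑ ^ 2)
            (by simp)]
      _ = 2 * (∫⁻ x in b, ∫⁻ y in b', ‖f x - f y‖ₑ ^ 2)
          + 2 * (volume b * ∫⁻ y in b', ‖f y‖ₑ ^ 2) := by
          rw [lintegral_add_right _ measurable_const, setLIntegral_const]
          congr 1
          · rw [← lintegral_const_mul' _ _ (by simp)]
            exact lintegral_congr fun x => lintegral_const_mul' 2 _ (by simp)
          · ring
      _ ≤ _ := by
          gcongr
          refine le_trans (lintegral_mono fun x => ?_) hW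
          exact lintegral_mono_set hsub
  have hsq : eLpNorm f 2 (volume.restrict b) ^ 2 ≤ K₂ * (eLpNorm f 2 (volume.restrict b')
      + eLpNorm (gradField f) 2 (volume.restrict b)) ^ 2 := by
    set P := eLpNorm f 2 (volume.restrict b') with hP
    set Q := eLpNorm (gradField f) 2 (volume.restrict b) with hQ
    rw [← eLpNorm_two_sq, ← eLpNorm_two_sq, ← eLpNorm_two_sq, ← hP, ← hQ] at hmain
    calc eLpNorm f 2 (volume.restrict b) ^ 2
        = (volume b')⁻¹ * (volume b' * eLpNorm f 2 (volume.restrict b) ^ 2) := by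
          rw [← mul_assoc, ENNReal.inv_mul_cancel hb0 hbt, one_mul]
      _ ≤ (volume b')⁻¹ * (2 * (K₁ * (P + Q) ^ 2) + 2 * (volume b * (P + Q) ^ 2)) := by
          refine mul_le_mul_right (hmain.trans ?_) _
          gcongr
          · exact le_add_self
          · exact le_self_add
      _ = _ := by rw [hK₂]; ring
  refine (ENNReal.pow_le_pow_left_iff two_ne_zero).1 (hsq.trans ?_)
  rw [mul_pow]
  gcongr
  calc K₂ ≤ K₂ + (K₂ ^ 2 + K₂ + 1) := le_self_add
    _ = (K₂ + 1) ^ 2 := by ring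

/-! ### Limits of potentials on a connected open set -/

lemma exists_geometric_bound {a : ℕ → ℝ≥0∞} (ha : ∀ n, a n ≠ ⊤) {c : ℝ≥0∞} (hc : c ≠ ⊤) {N : ℕ}
    (hN : ∀ n ≥ N, a n ≤ c * 2⁻¹ ^ n) : ∃ K : ℝ≥0∞, K ≠ ⊤ ∧ ∀ n, a n ≤ K * 2⁻¹ ^ n := by
  refine ⟨c + ∑ i ∈ Finset.range N, a i * 2 ^ i, ENNReal.add_ne_top.2 ⟨hc, ?_⟩, fun n => ?_⟩
  · exact ENNReal.sum_ne_top.2 fun i _ => ENNReal.mul_ne_top (ha i) (by simp)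
  · rcases le_or_gt N n with h | h
    · exact (hN n h).trans (by gcongr; exact le_self_add)
    · have h1 : a n * 2 ^ n ≤ ∑ i ∈ Finset.range N, a i * 2 ^ i :=
        Finset.single_le_sum (f := fun i => a i * 2 ^ i) (fun _ _ => zero_le)
          (Finset.mem_range.2 h)
      calc a n = a n * 2 ^ n * 2⁻¹ ^ n := by
            rw [mul_assoc, ← mul_pow, ENNReal.mul_inv_cancel (by simp) (by simp), one_pow, mul_one]
        _ ≤ _ := by gcongr; exact h1.trans le_add_self

lemma tendsto_eLpNorm_of_geometric {E : Type*} [NormedAddCommGroup E] [CompleteSpace E]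
    {μ : Measure Plane} {φ : ℕ → Plane → E} (hφ : ∀ n, AEStronglyMeasurable (φ n) μ) {K : ℝ≥0∞}
    (hK : K ≠ ⊤) (h : ∀ n, eLpNorm (φ (n + 1) - φ n) 2 μ ≤ K * 2⁻¹ ^ n) :
    (∀ᵐ x ∂μ, ∃ l, Tendsto (fun n => φ n x) atTop (𝓝 l)) ∧
      ∀ ψ : Plane → E, (∀ᵐ x ∂μ, Tendsto (fun n => φ n x) atTop (𝓝 (ψ x))) →
        Tendsto (fun n => eLpNorm (φ n - ψ) 2 μ) atTop (𝓝 0) := by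
  have h1 : ∀ k N, eLpNorm (φ N - φ (N + k)) 2 μ ≤ 2 * K * 2⁻¹ ^ N := by
    intro k
    induction k with
    | zero => intro N; simp
    | succ k ih =>
      intro N
      have e1 : φ N - φ (N + (k + 1)) = (φ N - φ (N + 1)) + (φ (N + 1) - φ (N + 1 + k)) := by
        rw [show N + (k + 1) = N + 1 + k by ring]; abel
      rw [e1]
      calc _ ≤ _ := eLpNorm_add_le ((hφ _).sub (hφ _)) ((hφ _).sub (hφ _)) one_le_two
        _ ≤ K * 2⁻¹ ^ N + 2 * K * 2⁻¹ ^ (N + 1) := by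
          gcongr
          · rw [eLpNorm_sub_comm]; exact h N
          · exact ih (N + 1)
        _ = K * 2⁻¹ ^ N + K * 2⁻¹ ^ N * (2 * 2⁻¹) := by ring
        _ = _ := by rw [ENNReal.mul_inv_cancel (by simp) (by simp)]; ring
  set B : ℕ → ℝ≥0∞ := fun N => (4 * K + 1) * 2⁻¹ ^ N with hBdef
  have hB : ∑' i, B i ≠ ⊤ := by
    rw [hBdef, ENNReal.tsum_mul_left, ENNReal.tsum_geometric]
    refine ENNReal.mul_ne_top (by finiteness) ?_
    simp
  have hcau : ∀ N n m : ℕ, N ≤ n → N ≤ m → eLpNorm (φ n - φ m) 2 μ < B N := by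
    intro N n m hn hm
    obtain ⟨k, rfl⟩ := Nat.exists_eq_add_of_le hn
    obtain ⟨l, rfl⟩ := Nat.exists_eq_add_of_le hm
    have e1 : φ (N + k) - φ (N + l) = (φ (N + k) - φ N) + (φ N - φ (N + l)) := by abel
    calc eLpNorm (φ (N + k) - φ (N + l)) 2 μ
        ≤ 2 * K * 2⁻¹ ^ N + 2 * K * 2⁻¹ ^ N := by
          rw [e1]
          refine (eLpNorm_add_le ((hφ _).sub (hφ _)) ((hφ _).sub (hφ _)) one_le_two).trans ?_
          gcongr
          · rw [eLpNorm_sub_comm]; exact h1 k N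
          · exact h1 l N
      _ = 4 * K * 2⁻¹ ^ N := by ring
      _ < 4 * K * 2⁻¹ ^ N + 2⁻¹ ^ N :=
          ENNReal.lt_add_right (by finiteness) (by simp)
      _ = B N := by rw [hBdef]; ring
  exact ⟨Lp.ae_tendsto_of_cauchy_eLpNorm hφ one_le_two hB hcau,
    fun ψ hψ => Lp.cauchy_tendsto_of_tendsto hφ ψ hB hcau hψ⟩

lemma gradField_sub {f g : Plane → ℝ} (hf : Differentiable ℝ f) (hg : Differentiable ℝ g) :
    gradField (f - g) = gradField f - gradField g := by
  ext x i
  have : ∀ j, partialDeriv j (f - g) x = partialDeriv j f x - partialDeriv j g x :=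
    fun j => partialDeriv_sub (hf x) (hg x) j
  fin_cases i
  · simp [this]
  · simp [this]

/-- If the gradients of `φ n` converge fast in `L²` near each point of a connected open set, and
the `φ n` vanish near one of its points, then the `φ n` converge in `L²` near each point: by the
Poincaré–Wirtinger inequality the set of points where this holds is relatively closed. -/
lemma eventually_geometric_of_gradField {U : Set Plane} (hU : IsPreconnected U)
    {φ : ℕ → Plane → ℝ} {W : Set Plane} (hφ : ∀ n, IsTestFunction W (φ n)) {G : Plane → Plane}
    (hG : AEStronglyMeasurable G volume)
    (hconv : ∀ x ∈ U, ∃ r > 0, ∃ N : ℕ, ∀ n ≥ N,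
      eLpNorm (gradField (φ n) - G) 2 (volume.restrict (ball x r)) ≤ 2⁻¹ ^ n)
    {p : Plane} (hpU : p ∈ U) {ρ : ℝ} (hρ : 0 < ρ) (hp : ∀ n, ∀ x ∈ ball p ρ, φ n x = 0) :
    ∀ x ∈ U, ∃ r > 0, ∃ K : ℝ≥0∞, K ≠ ⊤ ∧ ∀ n,
      eLpNorm (φ (n + 1) - φ n) 2 (volume.restrict (ball x r)) ≤ K * 2⁻¹ ^ n := by
  set S : Set Plane := {x | ∃ r > 0, ∃ K : ℝ≥0∞, K ≠ ⊤ ∧ ∀ n,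
      eLpNorm (φ (n + 1) - φ n) 2 (volume.restrict (ball x r)) ≤ K * 2⁻¹ ^ n} with hS
  have hSo : IsOpen S := by
    rw [Metric.isOpen_iff]
    rintro x ⟨r, hr, K, hK, h⟩
    refine ⟨r / 2, by positivity, fun y hy => ⟨r / 2, by positivity, K, hK, fun n => ?_⟩⟩
    refine (eLpNorm_mono_measure _ (Measure.restrict_mono ?_ le_rfl)).trans (h n)
    refine ball_subset_ball' ?_
    have : dist y x < r / 2 := hy
    linarith
  have hpS : p ∈ S := by
    refine ⟨ρ, hρ, 0, by simp, fun n => ?_⟩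
    rw [zero_mul, nonpos_iff_eq_zero]
    rw [eLpNorm_congr_ae (g := 0), eLpNorm_zero]
    refine (ae_restrict_iff' measurableSet_ball).2 (Eventually.of_forall fun x hx => ?_)
    simp [hp _ x hx]
  refine hU.subset_of_closure_inter_subset hSo ⟨p, hpU, hpS⟩ ?_
  rintro x ⟨hxS, hxU⟩
  obtain ⟨r, hr, N, hN⟩ := hconv x hxU
  obtain ⟨y, ⟨s, hs, K, hK, hyK⟩, hxy⟩ := Metric.mem_closure_iff.1 hxS r hr
  rw [dist_comm] at hxy
  -- a disc around `y` where convergence is known, inside the disc around `x`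
  set t := min s (r - dist y x) with ht
  have ht0 : 0 < t := lt_min hs (by linarith)
  have hsub : ball y t ⊆ ball x r := ball_subset_ball' (by
    have := min_le_right s (r - dist y x); linarith)
  obtain ⟨L, hL, hWir⟩ := exists_eLpNorm_ball_le x y r t ht0 hsub
  have hcd : ∀ n, ContDiff ℝ ∞ (φ (n + 1) - φ n) := fun n =>
    (hφ (n + 1)).smooth.sub (hφ n).smooth
  have hgm : ∀ n, AEStronglyMeasurable (gradField (φ n)) (volume.restrict (ball x r)) := fun n =>
    (continuous_gradField (hφ n).smooth).aestronglyMeasurable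
  have hgrad : ∀ n ≥ N, eLpNorm (gradField (φ (n + 1) - φ n)) 2 (volume.restrict (ball x r))
      ≤ 2 * 2⁻¹ ^ n := by
    intro n hn
    have e1 : gradField (φ (n + 1) - φ n)
        = (gradField (φ (n + 1)) - G) + (G - gradField (φ n)) := by
      rw [gradField_sub (hφ _).differentiable (hφ _).differentiable]; abel
    rw [e1]
    refine (eLpNorm_add_le ((hgm _).sub hG.restrict) (hG.restrict.sub (hgm _)) one_le_two).trans ?_
    rw [two_mul]
    refine add_le_add ((hN (n + 1) (by omega)).trans ?_) ?_
    · exact pow_le_pow_of_le_one (by simp) (by simp) (Nat.le_succ n)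
    · rw [eLpNorm_sub_comm]; exact hN n hn
  have hfin : ∀ n, eLpNorm (gradField (φ (n + 1) - φ n)) 2 (volume.restrict (ball x r)) ≠ ⊤ := by
    intro n
    have hc : HasCompactSupport (gradField (φ (n + 1) - φ n)) := by
      have ht : IsTestFunction W (φ (n + 1) - φ n) := (hφ (n + 1)).sub (hφ n)
      refine HasCompactSupport.intro ht.compact_support fun z hz => ?_
      have h0 : ∀ j, partialDeriv j (φ (n + 1) - φ n) z = 0 := fun j =>
        image_eq_zero_of_notMem_tsupport fun h => hz (tsupport_partialDeriv_subset _ j h)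
      ext i; fin_cases i
      · simp [h0]
      · simp [h0]
    exact ((continuous_gradField (hcd n)).memLp_of_hasCompactSupport hc).2.ne
  obtain ⟨K', hK', hgrad'⟩ := exists_geometric_bound hfin (by simp) hgrad
  refine ⟨r, hr, L * (K + K'), ENNReal.mul_ne_top hL (ENNReal.add_ne_top.2 ⟨hK, hK'⟩),
    fun n => (hWir _ (hcd n)).trans ?_⟩
  rw [mul_assoc, add_mul]
  gcongr
  · refine (eLpNorm_mono_measure _ (Measure.restrict_mono (ball_subset_ball (min_le_left _ _))
      le_rfl)).trans (hyK n)
  · exact hgrad' n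

/-- A locally geometrically convergent sequence converges in `L²` on compact sets. -/
lemma exists_limit_of_geometric {U : Set Plane} {φ : ℕ → Plane → ℝ}
    (hφ : ∀ n, Continuous (φ n)) (h : ∀ x ∈ U, ∃ r > 0, ∃ K : ℝ≥0∞, K ≠ ⊤ ∧ ∀ n,
      eLpNorm (φ (n + 1) - φ n) 2 (volume.restrict (ball x r)) ≤ K * 2⁻¹ ^ n) :
    ∃ ψ : Plane → ℝ, (∀ x, (∀ n, φ n x = 0) → ψ x = 0) ∧ ∀ L, IsCompact L → L ⊆ U →
      MemLp ψ 2 (volume.restrict L) ∧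
      Tendsto (fun n => eLpNorm (φ n - ψ) 2 (volume.restrict L)) atTop (𝓝 0) := by
  set ψ : Plane → ℝ := fun x => limUnder atTop fun n => φ n x with hψ
  have hψm : StronglyMeasurable ψ := StronglyMeasurable.limUnder fun n => (hφ n).stronglyMeasurable
  refine ⟨ψ, fun x hx => ?_, fun L hL hLU => ?_⟩
  · have : Tendsto (fun n => φ n x) atTop (𝓝 0) := by simp [hx]
    exact this.limUnder_eq
  have hlim : Tendsto (fun n => ∫⁻ x in L, ‖(φ n - ψ) x‖ₑ ^ 2) atTop (𝓝 0) := by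
    refine hL.induction_on (p := fun s => Tendsto (fun n => ∫⁻ x in s, ‖(φ n - ψ) x‖ₑ ^ 2) atTop
      (𝓝 0)) (by simp) ?_ ?_ ?_
    · intro s t hst ht
      exact tendsto_of_tendsto_of_tendsto_of_le_of_le tendsto_const_nhds ht (fun _ => zero_le)
        fun n => lintegral_mono_set hst
    · intro s t hs ht
      refine tendsto_of_tendsto_of_tendsto_of_le_of_le tendsto_const_nhds (by simpa using hs.add ht)
        (fun _ => zero_le) fun n => lintegral_union_le _ s t
    · intro x hx
      obtain ⟨r, hr, K, hK, hb⟩ := h x (hLU hx)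
      obtain ⟨h1, h2⟩ := tendsto_eLpNorm_of_geometric
        (fun n => (hφ n).aestronglyMeasurable) hK hb
      refine ⟨ball x r, mem_nhdsWithin_of_mem_nhds (ball_mem_nhds x hr), ?_⟩
      have h3 := h2 ψ (h1.mono fun y hy => tendsto_nhds_limUnder hy)
      have h4 := ENNReal.Tendsto.pow (n := 2) h3
      simpa [eLpNorm_two_sq] using h4
  have hlim' : Tendsto (fun n => eLpNorm (φ n - ψ) 2 (volume.restrict L)) atTop (𝓝 0) := by
    have := (ENNReal.continuous_rpow_const (y := (1 / 2 : ℝ))).tendsto 0 |>.comp hlim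
    simp only [ENNReal.zero_rpow_of_pos (by norm_num : (0 : ℝ) < 1 / 2)] at this
    refine this.congr fun n => ?_
    simp only [Function.comp]
    rw [← eLpNorm_two_sq, ← ENNReal.rpow_natCast, ← ENNReal.rpow_mul]
    norm_num
  have : IsFiniteMeasure (volume.restrict L) := ⟨by simpa using hL.measure_lt_top⟩
  refine ⟨Lp.memLp_of_cauchy_tendsto one_le_two (fun n => ?_) ψ hψm.aestronglyMeasurable hlim', hlim'⟩
  obtain ⟨C, hC⟩ := hL.exists_bound_of_continuousOn (hφ n).continuousOn
  exact MemLp.of_bound (hφ n).aestronglyMeasurable C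
    ((ae_restrict_iff' hL.measurableSet).2 (Eventually.of_forall fun x hx => hC x hx))

/-- Strong convergence in `L²` against a fixed `L²` function. -/
lemma tendsto_integral_inner {E : Type*} [NormedAddCommGroup E] [InnerProductSpace ℝ E]
    {μ : Measure Plane} {F : ℕ → Plane → E} {F' g : Plane → E} (hF : ∀ n, MemLp (F n) 2 μ)
    (hF' : MemLp F' 2 μ) (hg : MemLp g 2 μ)
    (h : Tendsto (fun n => eLpNorm (F n - F') 2 μ) atTop (𝓝 0)) :
    Tendsto (fun n => ∫ x, inner ℝ (F n x) (g x) ∂μ) atTop (𝓝 (∫ x, inner ℝ (F' x) (g x) ∂μ)) := by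
  have key : ∀ {A : Plane → E} (hA : MemLp A 2 μ),
      ∫ x, inner ℝ (A x) (g x) ∂μ = inner ℝ (hA.toLp A) (hg.toLp g) := by
    intro A hA
    rw [L2.inner_def]
    refine integral_congr_ae ?_
    filter_upwards [hA.coeFn_toLp, hg.coeFn_toLp] with x h1 h2
    rw [h1, h2]
  rw [key hF']
  simp_rw [fun n => key (hF n)]
  have := (Lp.tendsto_Lp_iff_tendsto_eLpNorm'' F hF F' hF').2 h
  exact (continuous_id.inner continuous_const).continuousAt.tendsto.comp this

lemma tendsto_integral_mul {μ : Measure Plane} {F : ℕ → Plane → ℝ} {F' g : Plane → ℝ}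
    (hF : ∀ n, MemLp (F n) 2 μ) (hF' : MemLp F' 2 μ) (hg : MemLp g 2 μ)
    (h : Tendsto (fun n => eLpNorm (F n - F') 2 μ) atTop (𝓝 0)) :
    Tendsto (fun n => ∫ x, F n x * g x ∂μ) atTop (𝓝 (∫ x, F' x * g x ∂μ)) := by
  simpa [mul_comm] using tendsto_integral_inner hF hF' hg h

lemma eLpNorm_coord_le {μ : Measure Plane} (X : Plane → Plane) (i : Fin 2) :
    eLpNorm (fun x => X x i) 2 μ ≤ eLpNorm X 2 μ :=
  eLpNorm_mono fun x => PiLp.norm_apply_le (X x) i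

lemma MeasureTheory.MemLp.coord {μ : Measure Plane} {X : Plane → Plane} (hX : MemLp X 2 μ)
    (i : Fin 2) : MemLp (fun x => X x i) 2 μ :=
  ⟨(EuclideanSpace.proj i : Plane →L[ℝ] ℝ).continuous.comp_aestronglyMeasurable hX.1,
    (eLpNorm_coord_le X i).trans_lt hX.2⟩

/-- On a connected open set, a field that is locally the fast `L²` limit of gradients of functions
vanishing somewhere is the weak gradient of a function in `L²_loc`. -/
lemma exists_potential {U : Set Plane} (hUo : IsOpen U) (hU : IsPreconnected U)
    {φ : ℕ → Plane → ℝ} {W : Set Plane} (hφ : ∀ n, IsTestFunction W (φ n)) {G : Plane → Plane}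
    (hG : MemLp G 2 volume) (hconv : ∀ L, IsCompact L → L ⊆ U → ∃ N : ℕ, ∀ n ≥ N,
      eLpNorm (gradField (φ n) - G) 2 (volume.restrict L) ≤ 2⁻¹ ^ n)
    {p : Plane} (hpU : p ∈ U) {ρ : ℝ} (hρ : 0 < ρ) (hp : Disjoint (ball p ρ) W) :
    ∃ ψ : Plane → ℝ, (∀ x ∉ W, ψ x = 0) ∧
      (∀ L, IsCompact L → L ⊆ U → MemLp ψ 2 (volume.restrict L)) ∧
      ∀ j ζ, IsTestFunction U ζ → ∫ x, ψ x * partialDeriv j ζ x = -∫ x, G x j * ζ x := by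
  have h1 := eventually_geometric_of_gradField hU hφ hG.1 (fun x hx => by
    obtain ⟨r, hr, hrU⟩ := Metric.nhds_basis_closedBall.mem_iff.1 (hUo.mem_nhds hx)
    obtain ⟨N, hN⟩ := hconv _ (isCompact_closedBall x r) hrU
    exact ⟨r, hr, N, fun n hn => (eLpNorm_mono_measure _
      (Measure.restrict_mono ball_subset_closedBall le_rfl)).trans (hN n hn)⟩) hpU hρ
    fun n x hx => (hφ n).eq_zero (disjoint_left.1 hp hx)
  obtain ⟨ψ, hψ0, hψ⟩ := exists_limit_of_geometric (fun n => (hφ n).continuous) h1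
  refine ⟨ψ, fun x hx => hψ0 x fun n => (hφ n).eq_zero hx, fun L hL hLU => (hψ L hL hLU).1,
    fun j ζ hζ => ?_⟩
  set L := tsupport ζ with hL
  have hLc : IsCompact L := hζ.compact_support
  have hrestr : ∀ f g : Plane → ℝ, (∀ x ∉ L, g x = 0) → ∫ x in L, f x * g x = ∫ x, f x * g x :=
    fun f g hg => setIntegral_eq_integral_of_forall_compl_eq_zero fun x hx => by simp [hg x hx]
  have hζ0 : ∀ x ∉ L, ζ x = 0 := fun x hx => image_eq_zero_of_notMem_tsupport hx
  have hζ1 : ∀ x ∉ L, partialDeriv j ζ x = 0 := fun x hx =>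
    image_eq_zero_of_notMem_tsupport fun h => hx (tsupport_partialDeriv_subset ζ j h)
  obtain ⟨hm, ht⟩ := hψ L hLc hζ.support_subset
  have t1 := tendsto_integral_mul (fun n => (hφ n).memLp 2 (volume.restrict L)) hm
    ((hζ.partialDeriv j).memLp 2 _) ht
  have t2 := tendsto_integral_mul (μ := volume.restrict L)
    (F := fun n => partialDeriv j (φ n)) (F' := fun x => G x j) (g := ζ)
    (fun n => ((hφ n).partialDeriv j).memLp 2 _) (hG.restrict L |>.coord j) (hζ.memLp 2 _) (by
      obtain ⟨N, hN⟩ := hconv L hLc hζ.support_subset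
      refine tendsto_of_tendsto_of_tendsto_of_le_of_le' tendsto_const_nhds
        (ENNReal.tendsto_pow_atTop_nhds_zero_of_lt_one (r := 2⁻¹) (by simp))
        (Eventually.of_forall fun _ => zero_le) ?_
      filter_upwards [eventually_ge_atTop N] with n hn
      refine le_trans (le_trans (le_of_eq ?_) (eLpNorm_coord_le (gradField (φ n) - G) j)) (hN n hn)
      congr 1
      ext x
      fin_cases j <;> simp)
  have heq : ∀ n, ∫ x in L, φ n x * partialDeriv j ζ x
      = -∫ x in L, partialDeriv j (φ n) x * ζ x := fun n => by
    rw [hrestr _ _ hζ1, hrestr _ _ hζ0]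
    exact integral_mul_partialDeriv hUo (hφ n).smooth.contDiffOn hζ j
  rw [← hrestr _ _ hζ1, ← hrestr _ _ hζ0]
  exact tendsto_nhds_unique (t1.congr heq) t2.neg

/-! ### Fields without circulation around a connected set are gradients off the set -/

/-- The rotated gradient `∇^⊥ f = (∂_y f, -∂_x f)`. -/
noncomputable def curlField (f : Plane → ℝ) (x : Plane) : Plane :=
  !₂[partialDeriv 1 f x, -partialDeriv 0 f x]

@[simp] lemma curlField_zero (f : Plane → ℝ) (x : Plane) :
    curlField f x 0 = partialDeriv 1 f x := rfl

@[simp] lemma curlField_one (f : Plane → ℝ) (x : Plane) :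
    curlField f x 1 = -partialDeriv 0 f x := rfl

/-- Mollification converges weakly in `L²`, by continuity of translations in `L²`. -/
lemma tendsto_integral_mul_kernelConv {f g : Plane → ℝ} (hf : MemLp f 2 volume)
    (hg : MemLp g 2 volume) {φ : ℕ → ContDiffBump (0 : Plane)}
    (hφ : Tendsto (fun n => (φ n).rOut) atTop (𝓝 0)) :
    Tendsto (fun n => ∫ x, g x * kernelConv ((φ n).normed volume) f x) atTop
      (𝓝 (∫ x, g x * f x)) := by
  set h : Plane → ℝ := fun z => ∫ x, g x * f (-z + x) with hh
  have hmp : ∀ z : Plane, MeasurePreserving (fun x => z + x) (volume : Measure Plane) volume :=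
    fun z => measurePreserving_add_left volume z
  have htr : ∀ z : Plane, MemLp (fun x => f (z + x)) 2 volume := fun z =>
    hf.comp_measurePreserving (hmp z)
  have hcont : Continuous h := by
    have hF : Fact ((2 : ℝ≥0∞) ≠ ⊤) := ⟨by simp⟩
    have h1 : Continuous fun z : Plane => inner ℝ (hg.toLp g)
        (DomAddAct.mk (-z) +ᵥ hf.toLp f : Lp ℝ 2 (volume : Measure Plane)) := by
      refine continuous_const.inner ?_
      exact (DomAddAct.continuous_mk.comp continuous_neg).vadd continuous_const
    convert h1 using 2 with z
    rw [L2.inner_def]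
    refine integral_congr_ae ?_
    have e1 := DomAddAct.vadd_Lp_ae_eq (DomAddAct.mk (-z)) (hf.toLp f)
    have e2 := (hmp (-z)).quasiMeasurePreserving.ae_eq_comp hf.coeFn_toLp
    filter_upwards [e1, e2, hg.coeFn_toLp] with x h1 h2 h3
    simp only [Function.comp] at h2
    rw [h1, h3]
    simp only [Equiv.symm_apply_apply, vadd_eq_add]
    rw [h2]
    simp [mul_comm]
  have hswap : ∀ n, ∫ x, g x * kernelConv ((φ n).normed volume) f x
      = ∫ z, (φ n).normed volume z * h z := by
    intro n
    set k := (φ n).normed (volume : Measure Plane) with hk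
    have hkc : Continuous k := (φ n).continuous_normed
    have hki : Integrable k := (φ n).integrable_normed
    have hconv : ∀ x, kernelConv k f x = ∫ z, k z * f (-z + x) := by
      intro x
      rw [kernelConv_eq_convolution, convolution_mul]
      congr 1; ext z; rw [neg_add_eq_sub]
    have hmeas : AEStronglyMeasurable (fun p : Plane × Plane => k p.1 * (g p.2 * f (-p.1 + p.2)))
        (volume.prod volume) := by
      refine (hkc.comp continuous_fst).aestronglyMeasurable.mul (hg.1.comp_snd.mul ?_)
      exact hf.1.comp_quasiMeasurePreserving (quasiMeasurePreserving_neg_add volume volume)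
    have hint : Integrable (fun p : Plane × Plane => k p.1 * (g p.2 * f (-p.1 + p.2)))
        (volume.prod volume) := by
      rw [integrable_prod_iff hmeas]
      refine ⟨Eventually.of_forall fun z => (hg.integrable_mul (htr (-z))).const_mul (k z), ?_⟩
      refine Integrable.mono' (g := fun z => ‖k z‖ * ((eLpNorm g 2 volume).toReal
        * (eLpNorm f 2 volume).toReal)) (hki.norm.mul_const _)
        hmeas.norm.integral_prod_right' (Eventually.of_forall fun z => ?_)
      rw [Real.norm_of_nonneg (integral_nonneg fun _ => norm_nonneg _)]
      simp only [norm_mul (k z)]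
      rw [integral_const_mul]
      gcongr
      have hn : ∀ A : Plane → ℝ, MemLp A 2 volume → MemLp (fun x => ‖A x‖) 2 volume :=
        fun A hA => hA.norm
      have e1 : ∫ x, ‖g x * f (-z + x)‖ = inner ℝ ((hn _ (htr (-z))).toLp _) ((hn _ hg).toLp _) := by
        rw [L2.inner_def]
        refine integral_congr_ae ?_
        filter_upwards [(hn _ (htr (-z))).coeFn_toLp, (hn _ hg).coeFn_toLp] with x h1 h2
        rw [h1, h2]; simp
      rw [e1]
      refine (real_inner_le_norm _ _).trans_eq ?_
      rw [Lp.norm_toLp, Lp.norm_toLp, mul_comm]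
      simp only [eLpNorm_norm]
      congr 2
      exact eLpNorm_comp_measurePreserving hf.1 (hmp (-z))
    calc ∫ x, g x * kernelConv k f x = ∫ x, ∫ z, k z * (g x * f (-z + x)) := by
          congr 1; ext x
          rw [hconv, ← integral_const_mul]
          congr 1; ext z; ring
      _ = ∫ z, ∫ x, k z * (g x * f (-z + x)) := (integral_integral_swap hint).symm
      _ = _ := by
          congr 1; ext z; rw [integral_const_mul]
  have hlim := ContDiffBump.convolution_tendsto_right_of_continuous (μ := (volume : Measure Plane))
    (g := fun z => h (-z)) hφ (hcont.comp continuous_neg) 0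
  simp only [convolution_lsmul, zero_sub, neg_neg, smul_eq_mul, neg_zero] at hlim
  have h0 : h 0 = ∫ x, g x * f x := by simp [hh]
  rw [← h0]
  exact hlim.congr fun n => (hswap n).symm

lemma isTestFunction_normed {δ : ℝ} (φ : ContDiffBump (0 : Plane)) (h : φ.rOut < δ) :
    IsTestFunction (ball 0 δ) (φ.normed volume) := by
  refine ⟨φ.contDiff_normed, φ.hasCompactSupport_normed, ?_⟩
  rw [φ.tsupport_normed_eq]
  exact closedBall_subset_ball h

/-- A divergence free smooth field on a disc is a rotated gradient. -/
lemma exists_curlField_eq {F : Fin 2 → Plane → ℝ} (hF : ∀ i, ContDiff ℝ ∞ (F i)) {R : ℝ}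
    (hdiv : ∀ x ∈ ball (0 : Plane) R, partialDeriv 0 (F 0) x + partialDeriv 1 (F 1) x = 0) :
    ∃ f : Plane → ℝ, ContDiffOn ℝ ∞ f (ball 0 R) ∧ ∀ x ∈ ball (0 : Plane) R,
      partialDeriv 1 f x = F 0 x ∧ partialDeriv 0 f x = -F 1 x := by
  let π : Fin 2 → Plane →L[ℝ] ℝ := fun i => EuclideanSpace.proj i
  set α : Plane → Plane →L[ℝ] ℝ := fun x => F 0 x • π 1 - F 1 x • π 0 with hα
  have hαs : ContDiff ℝ ∞ α :=
    ((hF 0).smul contDiff_const).sub ((hF 1).smul contDiff_const)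
  have hαd : ∀ a u v, fderiv ℝ α a u v
      = fderiv ℝ (F 0) a u * v 1 - fderiv ℝ (F 1) a u * v 0 := by
    intro a u v
    have h0 := ((hF 0).differentiable (by simp) a).hasFDerivAt
    have h1 := ((hF 1).differentiable (by simp) a).hasFDerivAt
    have h : HasFDerivAt α _ a := (h0.smul_const (π 1)).sub (h1.smul_const (π 0))
    rw [h.fderiv]
    simp [π]
  obtain ⟨f, hf⟩ := (convex_ball (0 : Plane) R).exists_forall_hasFDerivAt_of_fderiv_symmetric
    isOpen_ball (hαs.differentiable (by simp)).differentiableOn fun a ha u v => by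
      have := hdiv a ha
      rw [hαd, hαd]
      simp only [fderiv_apply_eq_sum_partialDeriv]
      linear_combination (u 0 * v 1 - u 1 * v 0) * this
  refine ⟨f, ?_, fun x hx => ?_⟩
  · rw [contDiffOn_infty_iff_fderiv_of_isOpen isOpen_ball]
    refine ⟨fun x hx => (hf x hx).differentiableAt.differentiableWithinAt, ?_⟩
    exact hαs.contDiffOn.congr fun x hx => (hf x hx).fderiv
  · simp [partialDeriv, (hf x hx).fderiv, hα, π]

/-- A function with vanishing gradient near a connected set is constant near it. -/
lemma exists_eqOn_const_thickening {C : Set Plane} (hC : IsPreconnected C) (hne : C.Nonempty)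
    {κ : ℝ} (hκ : 0 < κ) {f : Plane → ℝ} {B : Set Plane}
    (hf : ContDiffOn ℝ ∞ f B) (hsub : thickening κ C ⊆ B)
    (h : ∀ x ∈ thickening κ C, ∀ j, partialDeriv j f x = 0) :
    ∃ c, ∀ x ∈ thickening κ C, f x = c := by
  obtain ⟨x₀, hx₀⟩ := hne
  have hconn : IsPreconnected (thickening κ C) := by
    refine isPreconnected_of_forall x₀ fun y hy => ?_
    obtain ⟨z, hz, hyz⟩ := mem_thickening_iff.1 hy
    refine ⟨C ∪ ball z κ, union_subset (self_subset_thickening hκ C) fun w hw =>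
      mem_thickening_iff.2 ⟨z, hz, hw⟩, Or.inl hx₀, Or.inr hyz, ?_⟩
    exact hC.union z hz (mem_ball_self hκ) (convex_ball z κ).isPreconnected
  refine ⟨f x₀, fun x hx => ?_⟩
  refine isOpen_thickening.is_const_of_fderiv_eq_zero (𝕜 := ℝ) hconn
    ((hf.differentiableOn (by simp)).mono hsub) (fun y hy => ?_) hx
    (self_subset_thickening hκ C hx₀)
  ext v
  rw [fderiv_apply_eq_sum_partialDeriv, h y hy 0, h y hy 1]
  simp

/-- If `G` annihilates all rotated gradients of functions vanishing near `C`, and if `Y` is weakly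
divergence free and vanishes near `C`, then `G` is orthogonal to mollifications of `Y`: they are
rotated gradients of functions that are constant near `C`. -/
lemma integral_mul_kernelConv_eq_zero {C : Set Plane} (hC : IsPreconnected C) (hne : C.Nonempty)
    {R₁ R R₂ δ κ : ℝ} (hκ : 0 < κ) (hR₁ : R₁ + δ < R₂) (hCR : C ⊆ closedBall 0 R)
    (hR : R + κ + δ ≤ R₂) {G : Plane → Plane} (hG0 : ∀ x ∉ ball (0 : Plane) R₁, G x = 0)
    (hG : ∀ f, IsTestFunction Cᶜ f → ∫ x, inner ℝ (curlField f x) (G x) = 0)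
    {Y : Plane → Plane} (hY : MemLp Y 2 volume) (hY0 : ∀ x ∈ thickening (κ + δ) C, Y x = 0)
    (hYdiv : ∀ φ, IsTestFunction (ball 0 R₂) φ → ∫ x, inner ℝ (gradField φ x) (Y x) = 0)
    {k : Plane → ℝ} (hk : IsTestFunction (ball 0 δ) k) :
    ∫ x, (G x 0 * kernelConv k (fun t => Y t 0) x
      + G x 1 * kernelConv k (fun t => Y t 1) x) = 0 := by
  have hYl : ∀ i, LocallyIntegrable (fun t => Y t i) := fun i =>
    (hY.coord i).locallyIntegrable one_le_two
  set F : Fin 2 → Plane → ℝ := fun i => kernelConv k (fun t => Y t i) with hFdef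
  have hF : ∀ i, ContDiff ℝ ∞ (F i) := fun i => contDiff_kernelConv hk (hYl i)
  have hdiv : ∀ x ∈ ball (0 : Plane) (R₂ - δ),
      partialDeriv 0 (F 0) x + partialDeriv 1 (F 1) x = 0 := by
    intro x hx
    obtain ⟨h1, h2⟩ := hk.comp_sub_left x
    have hsub : ball x δ ⊆ ball 0 R₂ := ball_subset_ball' (by
      have : dist x 0 < R₂ - δ := hx
      linarith)
    have h3 := hYdiv _ (h1.mono hsub)
    simp only [hFdef]
    rw [partialDeriv_kernelConv hk (hYl 0), partialDeriv_kernelConv hk (hYl 1)]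
    have hi : ∀ i j, Integrable fun t => partialDeriv j k (x - t) * Y t i := fun i j => by
      have := ((hk.partialDeriv j).comp_sub_left x).1.integrable_mul
        ((hY.coord i).mono_measure Measure.restrict_le_self)
      simpa [mul_comm] using this
    rw [kernelConv, kernelConv, ← integral_add (hi 0 0) (hi 1 1), ← neg_eq_zero, ← integral_neg,
      ← h3]
    congr 1; ext t
    rw [inner_plane]
    simp only [gradField_zero, gradField_one, h2]
    ring
  obtain ⟨f, hfs, hf⟩ := exists_curlField_eq hF hdiv
  have hFz : ∀ x ∈ thickening κ C, ∀ i, F i x = 0 := by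
    intro x hx i
    simp only [hFdef, kernelConv]
    refine integral_eq_zero_of_ae (Eventually.of_forall fun t => ?_)
    by_cases ht : x - t ∈ ball (0 : Plane) δ
    · have : t ∈ thickening (κ + δ) C := by
        obtain ⟨z, hz, hxz⟩ := mem_thickening_iff.1 hx
        refine mem_thickening_iff.2 ⟨z, hz, ?_⟩
        have h1 : dist x t < δ := by simpa [dist_eq_norm] using ht
        rw [dist_comm] at h1
        linarith [dist_triangle t x z]
      simp [hY0 t this]
    · simp [hk.eq_zero ht]
  have hsub : thickening κ C ⊆ ball (0 : Plane) (R₂ - δ) := by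
    intro x hx
    obtain ⟨z, hz, hxz⟩ := mem_thickening_iff.1 hx
    have h1 : dist z 0 ≤ R := hCR hz
    have h2 := dist_triangle x z 0
    show dist x 0 < _
    linarith
  obtain ⟨c, hc⟩ := exists_eqOn_const_thickening hC hne hκ hfs hsub fun x hx j => by
    obtain ⟨h1, h0⟩ := hf x (hsub hx)
    fin_cases j
    · simpa [hFz x hx] using h0
    · simpa [hFz x hx] using h1
  obtain ⟨χ, hχ, W, hWo, hRW, hχ1⟩ := exists_cutoff (isCompact_closedBall (0 : Plane) R₁)
    (isOpen_ball (x := (0 : Plane)) (ε := R₂ - δ)) (closedBall_subset_ball (by linarith))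
  have hft : IsTestFunction (ball 0 (R₂ - δ)) (fun x => (f x - c) * χ x) :=
    hχ.mul_left isOpen_ball (hfs.sub contDiffOn_const)
  have hft' : IsTestFunction Cᶜ (fun x => (f x - c) * χ x) := by
    refine ⟨hft.smooth, hft.compact_support, fun x hx hxC => ?_⟩
    have hxn : x ∈ thickening κ C := self_subset_thickening hκ C hxC
    refine notMem_tsupport_iff_eventuallyEq.2 ?_ hx
    filter_upwards [isOpen_thickening.mem_nhds hxn] with y hy
    simp [hc y hy]
  rw [← hG _ hft']
  congr 1; ext x
  by_cases hx : x ∈ ball (0 : Plane) R₁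
  · have hxW : x ∈ W := hRW (ball_subset_closedBall hx)
    have hxB : x ∈ ball (0 : Plane) (R₂ - δ) := ball_subset_ball (by linarith) hx
    have hloc : (fun x => (f x - c) * χ x) =ᶠ[𝓝 x] fun x => f x - c := by
      filter_upwards [hWo.mem_nhds hxW] with y hy
      simp [hχ1 y hy]
    have hder : ∀ j, partialDeriv j (fun x => (f x - c) * χ x) x = partialDeriv j f x := by
      intro j
      rw [partialDeriv_congr hloc, partialDeriv, fderiv_sub_const]
      rfl
    rw [inner_plane, curlField_zero, curlField_one, hder, hder, (hf x hxB).1, (hf x hxB).2]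
    ring
  · simp [hG0 x hx]

/-- If `G` annihilates the rotated gradients of all functions vanishing near the connected set `C`,
then away from `C` it is a limit of gradients. -/
lemma exists_gradField_approx {C : Set Plane} (hC : IsPreconnected C) (hne : C.Nonempty)
    {R₁ R R₂ : ℝ} (hR₁ : R₁ < R₂) (hCR : C ⊆ closedBall 0 R) (hR : R < R₂)
    {G : Plane → Plane} (hGm : MemLp G 2 volume) (hG0 : ∀ x ∉ ball (0 : Plane) R₁, G x = 0)
    (hG : ∀ f, IsTestFunction Cᶜ f → ∫ x, inner ℝ (curlField f x) (G x) = 0)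
    {ε : ℝ} (hε : 0 < ε) {η : ℝ≥0∞} (hη : 0 < η) :
    ∃ φ, IsTestFunction (ball 0 R₂) φ ∧
      eLpNorm (gradField φ - G) 2 (volume.restrict (thickening ε C)ᶜ) < η := by
  set Z := (thickening ε C)ᶜ with hZ
  have hZm : MeasurableSet Z := isOpen_thickening.measurableSet.compl
  have hgl : ∀ {φ ψ : Plane → ℝ} (c : ℝ), IsTestFunction (ball 0 R₂) φ →
      IsTestFunction (ball 0 R₂) ψ →
      gradField (fun x => φ x + c * ψ x) = gradField φ + c • gradField ψ := by
    intro φ ψ c hφ hψ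
    have : ∀ j x, partialDeriv j (fun x => φ x + c * ψ x) x
        = partialDeriv j φ x + c * partialDeriv j ψ x := fun j x => by
      rw [partialDeriv_add (hφ.differentiable x) ((hψ.const_mul c).differentiable x),
        partialDeriv_const_mul (hψ.differentiable x)]
    ext x i
    fin_cases i
    · simp [this]
    · simp [this]
  have hz : gradField (fun _ => 0) = 0 := by
    ext x i; fin_cases i <;> simp [partialDeriv]
  let 𝒱 : Submodule ℝ (Plane → Plane) :=
    { carrier := {X | ∃ φ, IsTestFunction (ball 0 R₂) φ ∧ X = gradField φ}
      zero_mem' := ⟨fun _ => 0, IsTestFunction.zero, hz.symm⟩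
      add_mem' := by
        rintro _ _ ⟨φ, hφ, rfl⟩ ⟨ψ, hψ, rfl⟩
        refine ⟨_, hφ.add (hψ.const_mul 1), ?_⟩
        rw [hgl 1 hφ hψ, one_smul]
      smul_mem' := by
        rintro c _ ⟨φ, hφ, rfl⟩
        refine ⟨_, IsTestFunction.zero.add (hφ.const_mul c), ?_⟩
        rw [hgl c IsTestFunction.zero hφ, hz, zero_add] }
  have h𝒱 : ∀ X ∈ 𝒱, MemLp X 2 (volume.restrict Z) := by
    rintro _ ⟨φ, hφ, rfl⟩
    refine (continuous_gradField hφ.smooth).memLp_of_hasCompactSupport ?_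
    refine HasCompactSupport.intro hφ.compact_support fun x hx => ?_
    have : ∀ j, partialDeriv j φ x = 0 := fun j =>
      image_eq_zero_of_notMem_tsupport fun h => hx (tsupport_partialDeriv_subset φ j h)
    ext i; fin_cases i <;> simp [this]
  suffices h : ∀ X : Plane → Plane, MemLp X 2 (volume.restrict Z) →
      (∀ W ∈ 𝒱, ∫ x in Z, inner ℝ (W x) (X x) = 0) → ∫ x in Z, inner ℝ (G x) (X x) = 0 by
    obtain ⟨_, ⟨φ, hφ, rfl⟩, hX⟩ := exists_mem_eLpNorm_sub_lt 𝒱 h𝒱 (s := G)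
      (hGm.mono_measure Measure.restrict_le_self) h hη
    exact ⟨φ, hφ, by rwa [eLpNorm_sub_comm]⟩
  intro X hX hXo
  set Y : Plane → Plane := Z.indicator X with hYdef
  have hY : MemLp Y 2 volume := (memLp_indicator_iff_restrict hZm).2 hX
  have hYdiv : ∀ φ, IsTestFunction (ball 0 R₂) φ → ∫ x, inner ℝ (gradField φ x) (Y x) = 0 := by
    intro φ hφ
    rw [← hXo _ ⟨φ, hφ, rfl⟩, ← integral_indicator hZm]
    congr 1; ext x
    by_cases hx : x ∈ Z <;> simp [hYdef, hx]
  -- a sequence of mollifiers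
  let b : ℕ → ContDiffBump (0 : Plane) := fun n =>
    ⟨1 / (n + 2 : ℝ), 1 / (n + 1 : ℝ), by positivity, by
      apply one_div_lt_one_div_of_lt <;> [positivity; linarith]⟩
  have hb : Tendsto (fun n => (b n).rOut) atTop (𝓝 0) := tendsto_one_div_add_atTop_nhds_zero_nat
  have hlim := (tendsto_integral_mul_kernelConv (hY.coord 0) (hGm.coord 0) hb).add
    (tendsto_integral_mul_kernelConv (hY.coord 1) (hGm.coord 1) hb)
  set δ := min (ε / 2) (min ((R₂ - R₁) / 2) ((R₂ - R) / 2)) with hδ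
  have hδ0 : 0 < δ := lt_min (by positivity) (lt_min (by linarith) (by linarith))
  have hδ1 : δ ≤ ε / 2 := min_le_left _ _
  have hδ2 : δ ≤ (R₂ - R₁) / 2 := (min_le_right _ _).trans (min_le_left _ _)
  have hδ3 : δ ≤ (R₂ - R) / 2 := (min_le_right _ _).trans (min_le_right _ _)
  have hzero : ∀ᶠ n in atTop, (∫ x, G x 0 * kernelConv ((b n).normed volume) (fun t => Y t 0) x)
      + (∫ x, G x 1 * kernelConv ((b n).normed volume) (fun t => Y t 1) x) = 0 := by
    filter_upwards [(tendsto_order.1 hb).2 δ hδ0] with n hn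
    have hk := isTestFunction_normed (b n) hn
    have hi : ∀ i, Integrable fun x => G x i *
        kernelConv ((b n).normed volume) (fun t => Y t i) x := by
      intro i
      have hs := contDiff_kernelConv hk ((hY.coord i).locallyIntegrable one_le_two)
      obtain ⟨M, hM⟩ := (isCompact_closedBall (0 : Plane) R₁).exists_bound_of_continuousOn
        hs.continuous.continuousOn
      have h1 : MemLp (kernelConv ((b n).normed volume) (fun t => Y t i)) 2
          (volume.restrict (closedBall 0 R₁)) := by
        have : IsFiniteMeasure (volume.restrict (closedBall (0 : Plane) R₁)) :=
          ⟨by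
            simpa using (measure_closedBall_lt_top : volume (closedBall (0 : Plane) R₁) < ⊤)⟩
        exact MemLp.of_bound hs.continuous.aestronglyMeasurable M
          ((ae_restrict_iff' measurableSet_closedBall).2 (Eventually.of_forall hM))
      have h2 := (hGm.restrict (closedBall (0 : Plane) R₁)).coord i |>.integrable_mul h1
      refine (integrableOn_iff_integrable_of_support_subset fun x hx => ?_).1 h2
      by_contra hx'
      exact hx (by simp [hG0 x fun h => hx' (ball_subset_closedBall h)])
    rw [← integral_add (hi 0) (hi 1)]
    refine integral_mul_kernelConv_eq_zero hC hne hδ0 (by linarith) hCR (by linarith) hG0 hG hY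
      (fun x hx => ?_) hYdiv hk
    exact indicator_of_notMem (fun hxZ : x ∈ (thickening ε C)ᶜ =>
      hxZ (thickening_mono (by linarith) C hx)) _
  have h0 := tendsto_nhds_unique (tendsto_const_nhds.congr' (hzero.mono fun n hn => hn.symm)) hlim
  have hi : ∀ i, Integrable fun x => G x i * Y x i := fun i =>
    (hGm.coord i).integrable_mul (hY.coord i)
  rw [← integral_add (hi 0) (hi 1)] at h0
  rw [h0, ← integral_indicator hZm]
  congr 1; ext x
  by_cases hx : x ∈ Z <;> simp [hYdef, hx, inner_plane]

/-! ### A Poincaré inequality for functions with a zero on each circle -/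

/-- The point with polar coordinates `(r, θ)`. -/
noncomputable def polarPoint (r θ : ℝ) : Plane := !₂[r * Real.cos θ, r * Real.sin θ]

lemma norm_polarPoint {r : ℝ} (hr : 0 ≤ r) (θ : ℝ) : ‖polarPoint r θ‖ = r := by
  rw [EuclideanSpace.norm_eq, Fin.sum_univ_two]
  have : ‖polarPoint r θ 0‖ ^ 2 + ‖polarPoint r θ 1‖ ^ 2 = r ^ 2 := by
    simp only [polarPoint, Real.norm_eq_abs, sq_abs]
    simp only [Matrix.cons_val_zero, Matrix.cons_val_one]
    linear_combination r ^ 2 * Real.sin_sq_add_cos_sq θ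
  rw [this, Real.sqrt_sq hr]

lemma polarPoint_eq_repr (r θ : ℝ) : polarPoint r θ
    = Complex.orthonormalBasisOneI.repr (Complex.polarCoord.symm (r, θ)) := by
  ext i
  fin_cases i
  · simpa [polarPoint] using Or.inl (Complex.cos_ofReal_re θ).symm
  · simpa [polarPoint] using Or.inl (Complex.sin_ofReal_re θ).symm

lemma exists_polarPoint_eq (y : Plane) :
    ∃ θ ∈ Icc (-Real.pi) Real.pi, polarPoint ‖y‖ θ = y := by
  set z : ℂ := Complex.orthonormalBasisOneI.repr.symm y with hz
  have hn : ‖z‖ = ‖y‖ := LinearIsometryEquiv.norm_map _ y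
  refine ⟨z.arg, ⟨(Complex.neg_pi_lt_arg z).le, Complex.arg_le_pi z⟩, ?_⟩
  rw [polarPoint_eq_repr, ← hn]
  have : Complex.polarCoord.symm (‖z‖, z.arg) = z := by
    rw [Complex.polarCoord_symm_apply]
    simp
  rw [this, hz, LinearIsometryEquiv.apply_symm_apply]

lemma lintegral_polarPoint {H : Plane → ℝ≥0∞} (hH : Measurable H) :
    ∫⁻ x, H x = ∫⁻ r in Ioi (0 : ℝ), ENNReal.ofReal r *
      ∫⁻ θ in Ioo (-Real.pi) Real.pi, H (polarPoint r θ) := by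
  have hc : Continuous fun p : ℝ × ℝ => polarPoint p.1 p.2 := by
    refine (PiLp.continuous_toLp 2 _).comp (continuous_pi fun i => ?_)
    fin_cases i
    · show Continuous fun p : ℝ × ℝ => p.1 * Real.cos p.2
      fun_prop
    · show Continuous fun p : ℝ × ℝ => p.1 * Real.sin p.2
      fun_prop
  have h1 : ∫⁻ x, H x = ∫⁻ z : ℂ, H (Complex.orthonormalBasisOneI.repr z) :=
    (Complex.orthonormalBasisOneI.repr.measurePreserving.lintegral_comp hH).symm
  rw [h1, ← Complex.lintegral_comp_polarCoord_symm]
  have h2 : polarCoord.target = Ioi (0 : ℝ) ×ˢ Ioo (-Real.pi) Real.pi := rfl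
  have hm : Measurable fun p : ℝ × ℝ => ENNReal.ofReal p.1 * H (polarPoint p.1 p.2) :=
    (by fun_prop : Measurable fun p : ℝ × ℝ => ENNReal.ofReal p.1).mul (hH.comp hc.measurable)
  calc _ = ∫⁻ p : ℝ × ℝ in Ioi (0 : ℝ) ×ˢ Ioo (-Real.pi) Real.pi,
        ENNReal.ofReal p.1 * H (polarPoint p.1 p.2) := by
        rw [h2]
        refine lintegral_congr fun p => ?_
        rw [polarPoint_eq_repr]; rfl
    _ = ∫⁻ r in Ioi (0 : ℝ), ∫⁻ θ in Ioo (-Real.pi) Real.pi,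
        ENNReal.ofReal r * H (polarPoint r θ) := by
        rw [Measure.volume_eq_prod, ← Measure.prod_restrict, lintegral_prod _ hm.aemeasurable]
    _ = _ := by
        refine lintegral_congr fun r => ?_
        rw [lintegral_const_mul' _ _ ENNReal.ofReal_ne_top]

/-- On a circle where `f` has a zero, `f` is controlled by its gradient. -/
lemma lintegral_circle_sq_le {f : Plane → ℝ} (hf : ContDiff ℝ ∞ f) {r : ℝ} (hr : 0 ≤ r)
    (hz : ∃ y, ‖y‖ = r ∧ f y = 0) :
    ∫⁻ θ in Ioo (-Real.pi) Real.pi, ‖f (polarPoint r θ)‖ₑ ^ 2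
      ≤ ENNReal.ofReal (2 * Real.pi * r) ^ 2 *
        ∫⁻ θ in Ioo (-Real.pi) Real.pi, ‖gradField f (polarPoint r θ)‖ₑ ^ 2 := by
  obtain ⟨y, hy, hfy⟩ := hz
  obtain ⟨θ₀, hθ₀, hyθ⟩ := exists_polarPoint_eq y
  rw [hy] at hyθ
  have hpi := Real.pi_pos
  set v : ℝ → Plane := fun θ => !₂[r * -Real.sin θ, r * Real.cos θ] with hv
  have hvn : ∀ θ, ‖v θ‖ = r := by
    intro θ
    rw [EuclideanSpace.norm_eq, Fin.sum_univ_two]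
    have : ‖v θ 0‖ ^ 2 + ‖v θ 1‖ ^ 2 = r ^ 2 := by
      simp only [hv, Real.norm_eq_abs, sq_abs]
      simp only [Matrix.cons_val_zero, Matrix.cons_val_one]
      linear_combination r ^ 2 * Real.sin_sq_add_cos_sq θ
    rw [this, Real.sqrt_sq hr]
  have hP : ∀ θ, HasDerivAt (polarPoint r) (v θ) θ := by
    intro θ
    have h : HasDerivAt (fun θ : ℝ => ![r * Real.cos θ, r * Real.sin θ])
        ![r * -Real.sin θ, r * Real.cos θ] θ := by
      refine hasDerivAt_pi.2 fun i => ?_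
      fin_cases i
      · exact (Real.hasDerivAt_cos θ).const_mul r
      · exact (Real.hasDerivAt_sin θ).const_mul r
    exact (PiLp.continuousLinearEquiv 2 ℝ fun _ : Fin 2 => ℝ).symm.toContinuousLinearMap.hasFDerivAt
      |>.comp_hasDerivAt θ h
  have hPs : ContDiff ℝ 1 (polarPoint r) := by
    refine contDiff_euclidean.2 fun i => ?_
    fin_cases i
    · exact contDiff_const.mul Real.contDiff_cos
    · exact contDiff_const.mul Real.contDiff_sin
  have hg : ContDiff ℝ 1 fun θ => f (polarPoint r θ) :=
    (hf.of_le (by exact_mod_cast le_top)).comp hPs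
  have hder : ∀ θ, deriv (fun θ => f (polarPoint r θ)) θ = fderiv ℝ f (polarPoint r θ) (v θ) :=
    fun θ => (((hf.differentiable (by simp)) _).hasFDerivAt.comp_hasDerivAt θ (hP θ)).deriv
  have hbound : ∀ θ, ‖deriv (fun θ => f (polarPoint r θ)) θ‖ₑ ^ 2
      ≤ ENNReal.ofReal r ^ 2 * ‖gradField f (polarPoint r θ)‖ₑ ^ 2 := by
    intro θ
    rw [hder, ← mul_pow, ← ofReal_norm, ← ofReal_norm, ← ENNReal.ofReal_mul hr]
    gcongr
    rw [mul_comm, ← hvn θ]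
    exact norm_fderiv_apply_le f _ _
  have hae : (Icc (-Real.pi) Real.pi : Set ℝ) =ᵐ[volume] Ioo (-Real.pi) Real.pi :=
    Ioo_ae_eq_Icc.symm
  have hpt : ∀ θ ∈ Ioo (-Real.pi) Real.pi, ‖f (polarPoint r θ)‖ₑ ^ 2
      ≤ ENNReal.ofReal (2 * Real.pi) * (ENNReal.ofReal r ^ 2 *
        ∫⁻ θ in Ioo (-Real.pi) Real.pi, ‖gradField f (polarPoint r θ)‖ₑ ^ 2) := by
    intro θ hθ
    have h1 := enorm_sub_sq_le hg hθ₀ (Ioo_subset_Icc_self hθ)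
    rw [hyθ, hfy, sub_zero] at h1
    refine h1.trans ?_
    rw [show Real.pi - -Real.pi = 2 * Real.pi by ring, setLIntegral_congr hae,
      ← lintegral_const_mul' _ _ (ENNReal.pow_ne_top ENNReal.ofReal_ne_top)]
    gcongr
    exact hbound _
  calc _ ≤ ∫⁻ _ in Ioo (-Real.pi) Real.pi, ENNReal.ofReal (2 * Real.pi) *
        (ENNReal.ofReal r ^ 2 *
          ∫⁻ θ in Ioo (-Real.pi) Real.pi, ‖gradField f (polarPoint r θ)‖ₑ ^ 2) :=
        setLIntegral_mono' measurableSet_Ioo hpt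
    _ = _ := by
        rw [setLIntegral_const, Real.volume_Ioo, ENNReal.ofReal_mul (p := 2 * Real.pi)
          (by positivity), show Real.pi - -Real.pi = 2 * Real.pi by ring]
        ring

/-- The Poincaré inequality in a disc for functions that have a zero on each circle around the
centre. -/
lemma eLpNorm_ball_le_of_zero_on_circles {f : Plane → ℝ} (hf : ContDiff ℝ ∞ f) {R : ℝ}
    (hz : ∀ r, 0 < r → r < R → ∃ y, ‖y‖ = r ∧ f y = 0) :
    eLpNorm f 2 (volume.restrict (ball 0 R))
      ≤ ENNReal.ofReal (2 * Real.pi * R) * eLpNorm (gradField f) 2 (volume.restrict (ball 0 R)) := by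
  refine (ENNReal.pow_le_pow_left_iff two_ne_zero).1 ?_
  rw [mul_pow, eLpNorm_two_sq, eLpNorm_two_sq]
  have hgc := continuous_gradField hf
  have hfc := hf.continuous
  have hm1 : Measurable ((ball (0 : Plane) R).indicator fun x => ‖f x‖ₑ ^ 2) :=
    (by fun_prop : Measurable fun x => ‖f x‖ₑ ^ 2).indicator measurableSet_ball
  have hm2 : Measurable ((ball (0 : Plane) R).indicator fun x => ‖gradField f x‖ₑ ^ 2) :=
    (by fun_prop : Measurable fun x => ‖gradField f x‖ₑ ^ 2).indicator measurableSet_ball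
  rw [← lintegral_indicator measurableSet_ball, ← lintegral_indicator measurableSet_ball,
    lintegral_polarPoint hm1, lintegral_polarPoint hm2,
    ← lintegral_const_mul' _ _ (ENNReal.pow_ne_top ENNReal.ofReal_ne_top)]
  refine setLIntegral_mono' measurableSet_Ioi fun r hr => ?_
  have hr0 : 0 < r := hr
  rw [mul_left_comm]
  gcongr
  by_cases hrR : r < R
  · have hmem : ∀ θ, polarPoint r θ ∈ ball (0 : Plane) R := fun θ => by
      simpa [norm_polarPoint hr0.le θ] using hrR
    simp only [indicator_of_mem (hmem _)]
    refine (lintegral_circle_sq_le hf hr0.le (hz r hr0 hrR)).trans ?_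
    gcongr
  · have hmem : ∀ θ, polarPoint r θ ∉ ball (0 : Plane) R := fun θ => by
      simpa [norm_polarPoint hr0.le θ] using hrR
    simp only [indicator_of_notMem (hmem _)]
    simp

/-! ### Weyl's lemma -/

/-- A smooth increasing step: `0` on `(-∞, 1/2]` and `1` on `[1, ∞)`. -/
noncomputable def smoothStep (t : ℝ) : ℝ := Real.smoothTransition (2 * t - 1)

lemma contDiff_smoothStep : ContDiff ℝ ∞ smoothStep :=
  Real.smoothTransition.contDiff.comp (by fun_prop)

lemma smoothStep_of_le {t : ℝ} (ht : t ≤ 1 / 2) : smoothStep t = 0 :=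
  Real.smoothTransition.zero_of_nonpos (by linarith)

lemma smoothStep_of_ge {t : ℝ} (ht : 1 ≤ t) : smoothStep t = 1 :=
  Real.smoothTransition.one_of_one_le (by linarith)

lemma continuous_deriv_smoothStep : Continuous (deriv smoothStep) :=
  contDiff_smoothStep.continuous_deriv (by simp)

lemma deriv_smoothStep_nonneg (t : ℝ) : 0 ≤ deriv smoothStep t := by
  refine Monotone.deriv_nonneg fun a b hab => ?_
  exact Real.smoothTransition.monotone (by linarith)

lemma deriv_smoothStep_of_ge {t : ℝ} (ht : 1 ≤ t) : deriv smoothStep t = 0 := by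
  refine IsLocalMax.deriv_eq_zero (Eventually.of_forall fun s => ?_)
  rw [smoothStep_of_ge ht]
  exact Real.smoothTransition.le_one _

lemma contDiff_norm_sq_plane : ContDiff ℝ ∞ fun x : Plane => ‖x‖ ^ 2 := contDiff_norm_sq ℝ

lemma hasCompactSupport_comp_norm_sq {h : ℝ → ℝ} {η : ℝ} (hη : 0 ≤ η)
    (hh : ∀ s, η ^ 2 ≤ s → h s = 0) :
    HasCompactSupport (fun x : Plane => h (‖x‖ ^ 2)) ∧
      tsupport (fun x : Plane => h (‖x‖ ^ 2)) ⊆ closedBall 0 η := by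
  have hs : Function.support (fun x : Plane => h (‖x‖ ^ 2)) ⊆ closedBall 0 η := by
    intro x hx
    by_contra hx'
    rw [mem_closedBall_zero_iff, not_le] at hx'
    exact hx (hh _ (by gcongr))
  exact ⟨HasCompactSupport.of_support_subset_isCompact (isCompact_closedBall 0 η) hs,
    closure_minimal hs isClosed_closedBall⟩

/-- The mass of the unscaled radial mollifier. -/
noncomputable def radialMass : ℝ := ∫ x : Plane, deriv smoothStep (‖x‖ ^ 2)

lemma radialMass_pos : 0 < radialMass := by
  obtain ⟨t, ht, hd⟩ := exists_deriv_eq_slope smoothStep (a := 1 / 2) (b := 1) (by norm_num)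
    contDiff_smoothStep.continuous.continuousOn
    (contDiff_smoothStep.differentiable (by simp)).differentiableOn
  rw [smoothStep_of_le le_rfl, smoothStep_of_ge le_rfl] at hd
  have ht0 : 0 ≤ t := by linarith [ht.1]
  have hc : Continuous fun x : Plane => deriv smoothStep (‖x‖ ^ 2) :=
    continuous_deriv_smoothStep.comp contDiff_norm_sq_plane.continuous
  have hs := hasCompactSupport_comp_norm_sq zero_le_one fun s hs =>
      deriv_smoothStep_of_ge ((one_pow 2).symm.trans_le hs)
  have hne : (fun x : Plane => deriv smoothStep (‖x‖ ^ 2))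
      (EuclideanSpace.single 0 (Real.sqrt t)) ≠ 0 := by
    simp only
    rw [PiLp.norm_single, Real.norm_eq_abs, sq_abs, Real.sq_sqrt ht0, hd]
    norm_num
  exact hc.integral_pos_of_hasCompactSupport_nonneg_nonzero hs.1
    (fun x => deriv_smoothStep_nonneg _) hne

/-- The radial mollifier of scale `δ`. -/
noncomputable def radialKernel (δ : ℝ) (x : Plane) : ℝ :=
  (radialMass * δ ^ 2)⁻¹ * deriv smoothStep (‖x‖ ^ 2 / δ ^ 2)

lemma radialKernel_nonneg (δ : ℝ) (x : Plane) : 0 ≤ radialKernel δ x :=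
  mul_nonneg (inv_nonneg.2 (mul_nonneg radialMass_pos.le (sq_nonneg _)))
    (deriv_smoothStep_nonneg _)

lemma radialKernel_of_ge {δ : ℝ} (hδ : 0 < δ) {x : Plane} (hx : δ ≤ ‖x‖) :
    radialKernel δ x = 0 := by
  rw [radialKernel, deriv_smoothStep_of_ge, mul_zero]
  rw [le_div_iff₀ (by positivity), one_mul]
  gcongr

lemma integral_radialKernel {δ : ℝ} (hδ : 0 < δ) : ∫ x, radialKernel δ x = 1 := by
  have h := Measure.integral_comp_inv_smul_of_nonneg (volume : Measure Plane)
    (fun x => deriv smoothStep (‖x‖ ^ 2)) hδ.le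
  have h2 : ∀ x : Plane, ‖δ⁻¹ • x‖ ^ 2 = ‖x‖ ^ 2 / δ ^ 2 := fun x => by
    rw [norm_smul, norm_inv, Real.norm_of_nonneg hδ.le, mul_pow, inv_pow]; ring
  simp only [h2] at h
  simp only [radialKernel]
  rw [integral_const_mul, h, finrank_euclideanSpace_fin, smul_eq_mul]
  have := radialMass_pos
  change (radialMass * δ ^ 2)⁻¹ * (δ ^ 2 * radialMass) = 1
  field_simp

lemma isTestFunction_radialKernel {δ η : ℝ} (hδ : 0 < δ) (hη : δ < η) :
    IsTestFunction (ball 0 η) (radialKernel δ) := by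
  have hp : ContDiff ℝ ∞ (deriv smoothStep) := (contDiff_infty_iff_deriv.1 contDiff_smoothStep).2
  have h := hasCompactSupport_comp_norm_sq (h := fun s => (radialMass * δ ^ 2)⁻¹ *
    deriv smoothStep (s / δ ^ 2)) hδ.le fun s hs => by
      rw [deriv_smoothStep_of_ge, mul_zero]
      rwa [le_div_iff₀ (by positivity), one_mul]
  refine ⟨contDiff_const.mul (hp.comp (contDiff_norm_sq_plane.div_const _)), h.1,
    h.2.trans (closedBall_subset_ball hη)⟩

/-- The radial mollifiers form an approximate identity, by Lebesgue's differentiation theorem. -/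
lemma ae_tendsto_kernelConv_radialKernel {w : Plane → ℝ} (hw : LocallyIntegrable w) :
    ∀ᵐ x, Tendsto (fun n : ℕ => kernelConv (radialKernel (1 / (n + 1))) w x) atTop (𝓝 (w x)) := by
  obtain ⟨M, hM⟩ := HasCompactSupport.exists_bound_of_continuous (f := deriv smoothStep)
    (HasCompactSupport.intro (K := Icc 0 1) isCompact_Icc fun t ht => by
      rcases lt_or_ge t 1 with h | h
      · have ht0 : t < 0 := by
          by_contra h0
          exact ht ⟨not_lt.1 h0, h.le⟩
        have : smoothStep =ᶠ[𝓝 t] fun _ => 0 := by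
          filter_upwards [Iio_mem_nhds ht0] with s hs
          exact smoothStep_of_le (by linarith [mem_Iio.1 hs])
        rw [this.deriv_eq, deriv_const]
      · exact deriv_smoothStep_of_ge h) continuous_deriv_smoothStep
  have hδ : ∀ n : ℕ, (0 : ℝ) < 1 / (n + 1) := fun n => Nat.one_div_pos_of_nat
  filter_upwards [(Besicovitch.vitaliFamily (volume : Measure Plane)).ae_tendsto_average_norm_sub
    hw] with x h₀
  have hφ' : Tendsto (fun n : ℕ => (1 : ℝ) / (n + 1)) atTop (𝓝[>] 0) :=
    tendsto_nhdsWithin_iff.2 ⟨tendsto_one_div_add_atTop_nhds_zero_nat,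
      Eventually.of_forall hδ⟩
  have := (h₀.comp (Besicovitch.tendsto_filterAt volume x)).comp hφ'
  refine tendsto_integral_smul_of_tendsto_average_norm_sub
    (M / radialMass * volume.real (ball (0 : Plane) 1)) this ?_ ?_ ?_ ?_
  · filter_upwards with n using hw.integrableOn_isCompact (isCompact_closedBall _ _)
  · refine tendsto_const_nhds.congr fun n => ?_
    rw [integral_sub_left_eq_self, integral_radialKernel (hδ n)]
  · filter_upwards with n
    intro t ht
    by_contra h
    rw [mem_closedBall, dist_eq_norm, not_le, norm_sub_rev] at h
    exact ht (radialKernel_of_ge (hδ n) h.le)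
  · filter_upwards with n t
    rw [abs_of_nonneg (radialKernel_nonneg _ _), Measure.addHaar_real_closedBall _ _ (hδ n).le,
      finrank_euclideanSpace_fin, radialKernel]
    have hb : 0 < volume.real (ball (0 : Plane) 1) :=
      ENNReal.toReal_pos (measure_ball_pos _ _ one_pos).ne' measure_ball_lt_top.ne
    have hc := radialMass_pos
    have hδn := hδ n
    rw [mul_div_mul_right _ _ hb.ne', div_div, inv_mul_eq_div]
    gcongr
    exact (le_abs_self _).trans (hM _)

/-- The difference of two radial mollifiers is the Laplacian of a test function. -/
lemma exists_laplacian_eq_radialKernel_sub {δ δ' η : ℝ} (hδ : 0 < δ) (hδ' : 0 < δ') (h : δ < η)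
    (h' : δ' < η) : ∃ K, IsTestFunction (ball 0 η) K ∧ ∀ x,
      partialDeriv 0 (partialDeriv 0 K) x + partialDeriv 1 (partialDeriv 1 K) x
        = radialKernel δ x - radialKernel δ' x := by
  set m := max δ δ' with hm
  have hm0 : 0 < m := hδ.trans_le (le_max_left _ _)
  set q : ℝ → ℝ := fun s => (smoothStep (s / δ ^ 2) - smoothStep (s / δ' ^ 2)) / (4 * radialMass)
    with hq
  have hqs : ContDiff ℝ ∞ q := ((contDiff_smoothStep.comp (contDiff_id.div_const _)).sub
    (contDiff_smoothStep.comp (contDiff_id.div_const _))).div_const _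
  have hq0 : ∀ s, m ^ 2 ≤ s → q s = 0 := fun s hs => by
    have h1 : 1 ≤ s / δ ^ 2 := by
      rw [le_div_iff₀ (by positivity), one_mul]
      exact le_trans (by gcongr; exact le_max_left _ _) hs
    have h2 : 1 ≤ s / δ' ^ 2 := by
      rw [le_div_iff₀ (by positivity), one_mul]
      exact le_trans (by gcongr; exact le_max_right _ _) hs
    simp [hq, smoothStep_of_ge h1, smoothStep_of_ge h2]
  have hq0' : ∀ s, s ≤ min (δ ^ 2) (δ' ^ 2) / 2 → q s = 0 := fun s hs => by
    have h1 : s / δ ^ 2 ≤ 1 / 2 := by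
      rw [div_le_iff₀ (by positivity)]
      linarith [min_le_left (δ ^ 2) (δ' ^ 2)]
    have h2 : s / δ' ^ 2 ≤ 1 / 2 := by
      rw [div_le_iff₀ (by positivity)]
      linarith [min_le_right (δ ^ 2) (δ' ^ 2)]
    simp [hq, smoothStep_of_le h1, smoothStep_of_le h2]
  have hmin : 0 < min (δ ^ 2) (δ' ^ 2) / 2 := by positivity
  -- the profile `κ` of the derivative of `K`, as a function of the squared norm.
  set κ : ℝ → ℝ := fun s => q s / s with hκ
  have hκs : ContDiff ℝ ∞ κ := by
    refine contDiff_iff_contDiffAt.2 fun s => ?_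
    rcases lt_or_ge s (min (δ ^ 2) (δ' ^ 2) / 2) with hs | hs
    · refine (contDiffAt_const (c := (0 : ℝ))).congr_of_eventuallyEq ?_
      filter_upwards [Iio_mem_nhds hs] with t ht
      simp [hκ, hq0' t (le_of_lt ht)]
    · exact hqs.contDiffAt.div contDiffAt_id (hmin.trans_le hs).ne'
  have hsκ : ∀ s, s * κ s = q s := fun s => by
    rcases eq_or_ne s 0 with rfl | hs
    · rw [hq0' 0 hmin.le, zero_mul]
    · simp only [hκ]; field_simp
  set k : ℝ → ℝ := fun s => ∫ t in (m ^ 2)..s, κ t with hk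
  have hkd : ∀ s, HasDerivAt k (κ s) s := fun s =>
    intervalIntegral.integral_hasDerivAt_right (hκs.continuous.intervalIntegrable _ _)
      (hκs.continuous.stronglyMeasurableAtFilter _ _) hκs.continuous.continuousAt
  have hks : ContDiff ℝ ∞ k := by
    refine contDiff_infty_iff_deriv.2 ⟨fun s => (hkd s).differentiableAt, ?_⟩
    rwa [show deriv k = κ from funext fun s => (hkd s).deriv]
  have hk0 : ∀ s, m ^ 2 ≤ s → k s = 0 := fun s hs => by
    simp only [hk]
    refine intervalIntegral.integral_zero_ae (Eventually.of_forall fun t ht => ?_)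
    rw [uIoc_of_le hs] at ht
    simp [hκ, hq0 t ht.1.le]
  have hpd : ∀ {f : ℝ → ℝ} {f' : ℝ} {x : Plane} (j : Fin 2), HasDerivAt f f' (‖x‖ ^ 2) →
      partialDeriv j (fun y : Plane => f (‖y‖ ^ 2)) x = 2 * x j * f' := by
    intro f f' x j hf
    have h1 := hf.comp_hasFDerivAt x (hasStrictFDerivAt_norm_sq x).hasFDerivAt
    have h2 : fderiv ℝ (fun y : Plane => f (‖y‖ ^ 2)) x = _ := h1.fderiv
    rw [partialDeriv, h2]
    simp [EuclideanSpace.inner_single_right]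
    ring
  have hsupp := hasCompactSupport_comp_norm_sq hm0.le hk0
  refine ⟨fun x => k (‖x‖ ^ 2), ⟨hks.comp contDiff_norm_sq_plane, hsupp.1,
    hsupp.2.trans (closedBall_subset_ball (max_lt h h'))⟩, fun x => ?_⟩
  have hκd : ∀ s, HasDerivAt κ (deriv κ s) s :=
    fun s => (hκs.differentiable (by simp) s).hasDerivAt
  have h2 : ∀ j, partialDeriv j (partialDeriv j fun x : Plane => k (‖x‖ ^ 2)) x
      = 2 * κ (‖x‖ ^ 2) + 4 * x j ^ 2 * deriv κ (‖x‖ ^ 2) := by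
    intro j
    rw [show partialDeriv j (fun x : Plane => k (‖x‖ ^ 2)) = fun x => 2 * x j * κ (‖x‖ ^ 2) from
      funext fun x => hpd j (hkd _)]
    have hc : DifferentiableAt ℝ (fun y : Plane => y j) x :=
      (contDiff_coord j).differentiable (by simp) x
    have hκx : DifferentiableAt ℝ (fun y : Plane => κ (‖y‖ ^ 2)) x :=
      (hκs.comp contDiff_norm_sq_plane).differentiable (by simp) x
    rw [partialDeriv_mul (hc.const_mul 2) hκx, hpd j (hκd _),
      partialDeriv_const_mul hc, partialDeriv_coord, if_pos rfl]
    ring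
  rw [h2, h2]
  have hn : ‖x‖ ^ 2 = x 0 ^ 2 + x 1 ^ 2 := by
    rw [EuclideanSpace.norm_sq_eq, Fin.sum_univ_two]; simp
  have hder : HasDerivAt q (κ (‖x‖ ^ 2) + ‖x‖ ^ 2 * deriv κ (‖x‖ ^ 2)) (‖x‖ ^ 2) := by
    have := (hasDerivAt_id (‖x‖ ^ 2)).mul (hκd (‖x‖ ^ 2))
    rw [show q = id * κ from funext fun s => (hsκ s).symm]
    simpa using this
  have hPd : ∀ s, HasDerivAt smoothStep (deriv smoothStep s) s :=
    fun s => (contDiff_smoothStep.differentiable (by simp) s).hasDerivAt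
  have hder2 : HasDerivAt q ((deriv smoothStep (‖x‖ ^ 2 / δ ^ 2) * (1 / δ ^ 2)
      - deriv smoothStep (‖x‖ ^ 2 / δ' ^ 2) * (1 / δ' ^ 2)) / (4 * radialMass)) (‖x‖ ^ 2) :=
    (((hPd _).comp (‖x‖ ^ 2) ((hasDerivAt_id _).div_const _)).sub
      ((hPd _).comp (‖x‖ ^ 2) ((hasDerivAt_id _).div_const _))).div_const _
  have heq := hder.unique hder2
  have hc := radialMass_pos
  have : 2 * κ (‖x‖ ^ 2) + 4 * x 0 ^ 2 * deriv κ (‖x‖ ^ 2)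
      + (2 * κ (‖x‖ ^ 2) + 4 * x 1 ^ 2 * deriv κ (‖x‖ ^ 2))
      = 4 * (κ (‖x‖ ^ 2) + ‖x‖ ^ 2 * deriv κ (‖x‖ ^ 2)) := by
    generalize κ (‖x‖ ^ 2) = a
    generalize deriv κ (‖x‖ ^ 2) = b
    rw [hn]; ring
  rw [this, heq, radialKernel, radialKernel]
  field_simp

/-- Weyl's lemma: a weakly harmonic function has a smooth representative. The representative is
the limit of the radial mollifications, which near each point do not depend on the scale once it
is small. -/
lemma exists_contDiffOn_of_weakly_harmonic {O : Set Plane} (hO : IsOpen O) {w : Plane → ℝ}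
    (hw : Integrable w) (hharm : ∀ ζ, IsTestFunction O ζ →
      ∫ x, w x * (partialDeriv 0 (partialDeriv 0 ζ) x + partialDeriv 1 (partialDeriv 1 ζ) x) = 0) :
    ∃ w', ContDiffOn ℝ ∞ w' O ∧ w' =ᵐ[volume] w := by
  have hδ : ∀ n : ℕ, (0 : ℝ) < 1 / (n + 1) := fun n => Nat.one_div_pos_of_nat
  have key : ∀ {δ δ' η : ℝ} {x : Plane}, 0 < δ → 0 < δ' → δ < η → δ' < η → ball x η ⊆ O →
      kernelConv (radialKernel δ) w x = kernelConv (radialKernel δ') w x := by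
    intro δ δ' η x h0 h0' h h' hx
    obtain ⟨K, hK, hKeq⟩ := exists_laplacian_eq_radialKernel_sub h0 h0' h h'
    have h1 := hK.comp_sub_left x
    have h2 : ∀ j y, partialDeriv j (partialDeriv j fun y => K (x - y)) y
        = partialDeriv j (partialDeriv j K) (x - y) := by
      intro j y
      have h3 := ((hK.partialDeriv j).const_mul (-1)).comp_sub_left x
      rw [show (partialDeriv j fun y => K (x - y)) = fun y => -1 * partialDeriv j K (x - y) from
        funext fun y => by rw [h1.2, neg_one_mul], h3.2,
        partialDeriv_const_mul ((hK.partialDeriv j).differentiable _)]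
      ring
    have h3 := hharm _ (h1.1.mono hx)
    simp only [h2, hKeq, mul_sub] at h3
    have hi : ∀ {δ : ℝ}, 0 < δ → Integrable fun y => w y * radialKernel δ (x - y) := by
      intro δ hδ
      have ht := (isTestFunction_radialKernel hδ (lt_add_one δ)).comp_sub_left x
      obtain ⟨B, hB⟩ := ht.1.compact_support.exists_bound_of_continuous ht.1.continuous
      exact hw.mul_bdd (c := B) ht.1.continuous.aestronglyMeasurable (Eventually.of_forall hB)
    rw [integral_sub (hi h0) (hi h0'), sub_eq_zero] at h3
    simp only [kernelConv, mul_comm _ (w _)]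
    exact h3
  refine ⟨fun x => limUnder atTop fun n : ℕ => kernelConv (radialKernel (1 / (n + 1))) w x,
    fun x hx => ?_, ?_⟩
  · obtain ⟨η, hη, hηO⟩ := Metric.isOpen_iff.1 hO x hx
    obtain ⟨N, hN⟩ := exists_nat_one_div_lt (half_pos hη)
    refine ContDiffAt.contDiffWithinAt ?_
    have hs := contDiff_kernelConv (isTestFunction_radialKernel (hδ N) (lt_add_one _))
      hw.locallyIntegrable
    refine hs.contDiffAt.congr_of_eventuallyEq ?_
    filter_upwards [ball_mem_nhds x (half_pos hη)] with y hy
    refine Tendsto.limUnder_eq (tendsto_const_nhds.congr' ?_)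
    filter_upwards [eventually_ge_atTop N] with n hn
    refine key (hδ N) (hδ n) hN (lt_of_le_of_lt ?_ hN) ((ball_subset_ball' ?_).trans hηO)
    · exact Nat.one_div_le_one_div hn
    · linarith [mem_ball.1 hy]
  · filter_upwards [ae_tendsto_kernelConv_radialKernel hw.locallyIntegrable] with x hx
    exact hx.limUnder_eq

/-! ### Interior regularity -/

/-- The strain satisfies Saint-Venant's compatibility condition, in the weak sense. -/
lemma HasLDStrain.compatibility {U : Set Plane} {u : Plane → Plane} {e : Plane → Mat2}
    (h : HasLDStrain U u e) {ζ : Plane → ℝ} (hζ : IsTestFunction U ζ) :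
    (∫ x, e x 0 0 * partialDeriv 1 (partialDeriv 1 ζ) x)
      + ∫ x, e x 1 1 * partialDeriv 0 (partialDeriv 0 ζ) x
      = 2 * ∫ x, e x 0 1 * partialDeriv 0 (partialDeriv 1 ζ) x := by
  have hU : ∀ (i j : Fin 2) {ξ : Plane → ℝ}, IsTestFunction U ξ →
      (∫ x, u x i * partialDeriv j ξ x) + ∫ x, u x j * partialDeriv i ξ x
        = -(2 * ∫ x, e x i j * ξ x) := by
    intro i j ξ hξ
    have h1 := h.weak_strain i j ξ hξ
    rw [hξ.setIntegral_mul_eq, setIntegral_eq_integral_of_forall_compl_eq_zero fun x hx => by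
      simp [(hξ.partialDeriv i).eq_zero hx, (hξ.partialDeriv j).eq_zero hx], integral_div,
      integral_add (h.memL2Loc.integrable_mul (hξ.partialDeriv j) i)
        (h.memL2Loc.integrable_mul (hξ.partialDeriv i) j)] at h1
    linarith
  have h0 := hU 0 0 ((hζ.partialDeriv 1).partialDeriv 1)
  have h1 := hU 1 1 ((hζ.partialDeriv 0).partialDeriv 0)
  have h2 := hU 0 1 ((hζ.partialDeriv 1).partialDeriv 0)
  have c1 : partialDeriv 1 (partialDeriv 0 (partialDeriv 1 ζ))
      = partialDeriv 0 (partialDeriv 1 (partialDeriv 1 ζ)) :=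
    partialDeriv_comm (hζ.smooth.partialDeriv 1) 1 0
  have c2 : partialDeriv 0 (partialDeriv 0 (partialDeriv 1 ζ))
      = partialDeriv 1 (partialDeriv 0 (partialDeriv 0 ζ)) := by
    rw [partialDeriv_comm hζ.smooth 0 1]
    exact partialDeriv_comm (hζ.smooth.partialDeriv 0) 0 1
  rw [c1, c2] at h2
  linarith

lemma HasLDStrain.mono {U V : Set Plane} {u : Plane → Plane} {e : Plane → Mat2}
    (h : HasLDStrain V u e) (hUV : U ⊆ V) : HasLDStrain U u e := by
  refine ⟨fun K hK hKU => h.memL2Loc K hK (hKU.trans hUV), fun i j =>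
    MemLp.mono_measure (Measure.restrict_mono hUV le_rfl) (h.strain_memL2 i j),
    fun i j ζ hζ => ?_⟩
  have := h.weak_strain i j ζ (hζ.mono hUV)
  rw [(hζ.mono hUV).setIntegral_mul_eq] at this
  rw [hζ.setIntegral_mul_eq, ← this]
  have h0 : ∀ x ∉ U,
      (u x i * partialDeriv j ζ x + u x j * partialDeriv i ζ x) / 2 = 0 := fun x hx => by
    simp [(hζ.partialDeriv i).eq_zero hx, (hζ.partialDeriv j).eq_zero hx]
  rw [setIntegral_eq_integral_of_forall_compl_eq_zero h0,
    setIntegral_eq_integral_of_forall_compl_eq_zero fun x hx => h0 x fun hx' => hx (hUV hx')]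

/-- A square integrable, weakly harmonic function on an open set of finite area has a smooth
representative. -/
lemma exists_contDiffOn_of_memL2 {U : Set Plane} (hU : IsOpen U) (hfin : volume U ≠ ⊤)
    {w : Plane → ℝ} (hw : MemL2 U w) (hharm : ∀ ζ, IsTestFunction U ζ →
      ∫ x, w x * (partialDeriv 0 (partialDeriv 0 ζ) x + partialDeriv 1 (partialDeriv 1 ζ) x) = 0) :
    ∃ w', ContDiffOn ℝ ∞ w' U ∧ w' =ᵐ[volume.restrict U] w := by
  have hf : IsFiniteMeasure (volume.restrict U) := ⟨by simpa using hfin.lt_top⟩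
  have hi : Integrable (U.indicator w) :=
    (integrable_indicator_iff hU.measurableSet).2 (MemLp.integrable one_le_two hw)
  obtain ⟨w', h1, h2⟩ := exists_contDiffOn_of_weakly_harmonic hU hi fun ζ hζ => by
    rw [← hharm ζ hζ]
    refine integral_congr_ae (Eventually.of_forall fun x => ?_)
    by_cases hx : x ∈ U
    · simp [hx]
    · simp [hx, ((hζ.partialDeriv 0).partialDeriv 0).eq_zero hx,
        ((hζ.partialDeriv 1).partialDeriv 1).eq_zero hx]
  refine ⟨w', h1, ?_⟩
  filter_upwards [ae_restrict_of_ae h2, ae_restrict_mem hU.measurableSet] with x hx hxU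
  rw [hx, indicator_of_mem hxU]

/-- For a smooth representative, the classical and the weak partial derivatives agree. -/
lemma partialDeriv_ae_eq_of_weak {U : Set Plane} (hU : IsOpen U) {f v g : Plane → ℝ}
    (hf : ContDiffOn ℝ ∞ f U) (hfv : f =ᵐ[volume.restrict U] v) (hg : MemL2 U g) {j : Fin 2}
    (h : ∀ ζ, IsTestFunction U ζ → ∫ x, v x * partialDeriv j ζ x = -∫ x, g x * ζ x) :
    ∀ᵐ x ∂(volume.restrict U), partialDeriv j f x = g x := by
  have hc := (hf.partialDeriv hU j).continuousOn
  have hl : LocallyIntegrableOn (fun x => partialDeriv j f x - g x) U := by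
    refine (hc.locallyIntegrableOn hU.measurableSet).sub ?_
    rw [locallyIntegrableOn_iff hU.isLocallyClosed]
    intro K hKU hK
    have : IsFiniteMeasure (volume.restrict K) := ⟨by simpa using hK.measure_lt_top⟩
    exact (MemLp.mono_measure (Measure.restrict_mono hKU le_rfl) hg).integrable one_le_two
  have := hU.ae_eq_zero_of_integral_contDiff_smul_eq_zero hl fun ζ hs hc hζU => by
    have hζ : IsTestFunction U ζ := ⟨hs, hc, hζU⟩
    have h1 := integral_mul_partialDeriv hU hf hζ j
    have h2 : ∫ x, f x * partialDeriv j ζ x = ∫ x, v x * partialDeriv j ζ x := by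
      rw [← (hζ.partialDeriv j).setIntegral_mul_eq f, ← (hζ.partialDeriv j).setIntegral_mul_eq v]
      refine integral_congr_ae ?_
      filter_upwards [hfv] with x hx
      rw [hx]
    have h3 := h ζ hζ
    simp only [smul_eq_mul, mul_comm (ζ _), sub_mul]
    rw [integral_sub (hζ.mul_left hU (hf.partialDeriv hU j)).integrable
      (hg.integrable_mul hζ)]
    linarith
  rw [ae_restrict_iff' hU.measurableSet]
  filter_upwards [this] with x hx hxU
  linarith [hx hxU]

lemma partialDeriv_partialDeriv_coord_mul {ζ : Plane → ℝ} (hζ : ContDiff ℝ ∞ ζ) (i j : Fin 2)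
    (x : Plane) : partialDeriv j (partialDeriv j fun y => y i * ζ y) x
      = x i * partialDeriv j (partialDeriv j ζ) x
        + 2 * (if i = j then 1 else 0) * partialDeriv j ζ x := by
  have hc : ∀ x, DifferentiableAt ℝ (fun y : Plane => y i) x :=
    (contDiff_coord i).differentiable (by simp)
  have hd : ∀ {f : Plane → ℝ}, ContDiff ℝ ∞ f → ∀ x, DifferentiableAt ℝ f x :=
    fun hf => hf.differentiable (by simp)
  have h1 : partialDeriv j (fun y => y i * ζ y)
      = fun y => y i * partialDeriv j ζ y + (if i = j then 1 else 0) * ζ y :=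
    funext fun y => by rw [partialDeriv_mul (hc y) (hd hζ y), partialDeriv_coord]
  have h2 : DifferentiableAt ℝ (fun y : Plane => y i * partialDeriv j ζ y) x :=
    (hc x).mul (hd (hζ.partialDeriv j) x)
  rw [h1, partialDeriv_add h2 ((hd hζ x).const_mul _),
    partialDeriv_mul (hc x) (hd (hζ.partialDeriv j) x), partialDeriv_coord,
    partialDeriv_const_mul (hd hζ x)]
  ring

/-- Two functions whose rotated gradients are the rows of the stress have smooth representatives:
by compatibility of the strain, the trace `τ` of the stress is weakly harmonic, and so are
`v₀ - x₁ τ / 2` and `v₁ + x₀ τ / 2`. -/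
lemma exists_smooth_representative {lam mu : ℝ} (hlam : 0 < lam) (hmu : 0 < mu) {U : Set Plane}
    (hU : IsOpen U) (hb : Bornology.IsBounded U) {u : Plane → Plane} {e : Plane → Mat2}
    (he : HasLDStrain U u e) {v : Fin 2 → Plane → ℝ} (hv : ∀ k, MemL2 U (v k))
    (hv0 : ∀ k ζ, IsTestFunction U ζ →
      ∫ x, v k x * partialDeriv 0 ζ x = ∫ x, hooke lam mu (e x) k 1 * ζ x)
    (hv1 : ∀ k ζ, IsTestFunction U ζ →
      ∫ x, v k x * partialDeriv 1 ζ x = -∫ x, hooke lam mu (e x) k 0 * ζ x) :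
    ∃ v' : Fin 2 → Plane → ℝ, ∀ k, ContDiffOn ℝ ∞ (v' k) U ∧ v' k =ᵐ[volume.restrict U] v k := by
  have hfin : volume U ≠ ⊤ := hb.measure_lt_top.ne
  set S : Fin 2 → Fin 2 → Plane → ℝ := fun i j x => hooke lam mu (e x) i j with hS
  have hSm : ∀ i j, MemL2 U (S i j) := memL2_hooke lam mu he.strain_memL2
  set τ : Plane → ℝ := fun x => S 0 0 x + S 1 1 x with hτ
  have hτm : MemL2 U τ := (hSm 0 0).add (hSm 1 1)
  have hadd : ∀ {f : Plane → ℝ} {ζ ξ : Plane → ℝ}, MemL2 U f → IsTestFunction U ζ →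
      IsTestFunction U ξ → ∫ x, f x * (ζ x + ξ x) = (∫ x, f x * ζ x) + ∫ x, f x * ξ x := by
    intro f ζ ξ hf hζ hξ
    simp only [mul_add]
    exact integral_add (hf.integrable_mul hζ) (hf.integrable_mul hξ)
  have hτI : ∀ {ζ : Plane → ℝ}, IsTestFunction U ζ →
      ∫ x, τ x * ζ x = (∫ x, S 0 0 x * ζ x) + ∫ x, S 1 1 x * ζ x := by
    intro ζ hζ
    simp only [hτ, add_mul]
    exact integral_add ((hSm 0 0).integrable_mul hζ) ((hSm 1 1).integrable_mul hζ)
  have hsym : ∀ {ζ : Plane → ℝ}, IsTestFunction U ζ →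
      ∫ x, S 1 0 x * ζ x = ∫ x, S 0 1 x * ζ x := by
    intro ζ hζ
    rw [← hζ.setIntegral_mul_eq, ← hζ.setIntegral_mul_eq]
    refine integral_congr_ae ?_
    filter_upwards [he.ae_symm hU 0 1] with x hx
    simp [hS, hooke_apply, hx]
  have hdiv : ∀ k {ζ : Plane → ℝ}, IsTestFunction U ζ →
      (∫ x, S k 0 x * partialDeriv 0 ζ x) + ∫ x, S k 1 x * partialDeriv 1 ζ x = 0 := by
    intro k ζ hζ
    have h0 := hv0 k _ (hζ.partialDeriv 1)
    have h1 := hv1 k _ (hζ.partialDeriv 0)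
    rw [partialDeriv_comm hζ.smooth 0 1] at h0
    linarith
  have hτharm : ∀ ζ, IsTestFunction U ζ → ∫ x, τ x *
      (partialDeriv 0 (partialDeriv 0 ζ) x + partialDeriv 1 (partialDeriv 1 ζ) x) = 0 := by
    intro ζ hζ
    have t00 := (hζ.partialDeriv 0).partialDeriv 0
    have t11 := (hζ.partialDeriv 1).partialDeriv 1
    have t01 := (hζ.partialDeriv 1).partialDeriv 0
    have hcomp := he.compatibility hζ
    have d0 := hdiv 0 (hζ.partialDeriv 0)
    have d1 := hdiv 1 (hζ.partialDeriv 1)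
    rw [hsym t01] at d1
    rw [partialDeriv_comm hζ.smooth 1 0] at d0
    -- Hooke's law, solved for the strain
    set ν : ℝ := lam / (2 * (lam + mu)) with hν
    have hdiag : ∀ i {ξ : Plane → ℝ}, IsTestFunction U ξ →
        2 * mu * ∫ x, e x i i * ξ x = (∫ x, S i i x * ξ x) - ν * ∫ x, τ x * ξ x := by
      intro i ξ hξ
      have hi1 : Integrable fun x => ν * (τ x * ξ x) := (hτm.integrable_mul hξ).const_mul ν
      rw [← integral_const_mul, ← integral_const_mul,
        ← integral_sub ((hSm i i).integrable_mul hξ) hi1]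
      congr 1
      ext x
      have : ν * τ x = lam * (e x 0 0 + e x 1 1) := by
        simp only [hτ, hS, hooke_apply, hν]
        simp
        field_simp
        ring
      rw [← mul_assoc ν, this]
      simp only [hS, hooke_apply]
      simp
      ring
    have hoff : ∀ {ξ : Plane → ℝ},
        2 * mu * ∫ x, e x 0 1 * ξ x = ∫ x, S 0 1 x * ξ x := by
      intro ξ
      rw [← integral_const_mul]
      congr 1
      ext x
      simp only [hS, hooke_apply]
      simp
      ring
    have e0 := hdiag 0 t11
    have e1 := hdiag 1 t00
    have e2 := hoff (ξ := partialDeriv 0 (partialDeriv 1 ζ))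
    have s00 := hτI t00
    have s11 := hτI t11
    rw [hadd hτm t00 t11]
    have hν1 : 1 - ν ≠ 0 := by
      have : ν < 1 := by
        rw [hν, div_lt_one (by positivity)]
        linarith
      linarith
    refine (mul_eq_zero.1 (?_ : (1 - ν) * _ = 0)).resolve_left hν1
    linear_combination 2 * mu * hcomp - e0 - e1 + 2 * e2 + d0 + d1 + s00 + s11
  have hcoord : ∀ i ζ, IsTestFunction U ζ → ∫ x, x i * τ x *
      (partialDeriv 0 (partialDeriv 0 ζ) x + partialDeriv 1 (partialDeriv 1 ζ) x)
        = -(2 * ∫ x, τ x * partialDeriv i ζ x) := by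
    intro i ζ hζ
    have t : IsTestFunction U fun y => y i * ζ y :=
      hζ.mul_left hU (contDiff_coord i).contDiffOn
    have tL : IsTestFunction U fun x => x i * (partialDeriv 0 (partialDeriv 0 ζ) x
        + partialDeriv 1 (partialDeriv 1 ζ) x) :=
      (((hζ.partialDeriv 0).partialDeriv 0).add ((hζ.partialDeriv 1).partialDeriv 1)).mul_left hU
        (contDiff_coord i).contDiffOn
    have h1 := hτharm _ t
    simp only [partialDeriv_partialDeriv_coord_mul hζ.smooth] at h1
    have h2 : ∀ x : Plane, τ x * (x i * partialDeriv 0 (partialDeriv 0 ζ) x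
          + 2 * (if i = 0 then 1 else 0) * partialDeriv 0 ζ x
        + (x i * partialDeriv 1 (partialDeriv 1 ζ) x
          + 2 * (if i = 1 then 1 else 0) * partialDeriv 1 ζ x))
        = τ x * (x i * (partialDeriv 0 (partialDeriv 0 ζ) x
            + partialDeriv 1 (partialDeriv 1 ζ) x) + 2 * partialDeriv i ζ x) := by
      intro x
      congr 1
      fin_cases i
      · simp; ring
      · simp; ring
    simp only [h2] at h1
    rw [hadd hτm tL ((hζ.partialDeriv i).const_mul 2)] at h1
    simp only [mul_left_comm (τ _) 2] at h1
    rw [integral_const_mul] at h1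
    have h3 : ∫ x, x i * τ x *
        (partialDeriv 0 (partialDeriv 0 ζ) x + partialDeriv 1 (partialDeriv 1 ζ) x)
        = ∫ x, τ x * (x i * (partialDeriv 0 (partialDeriv 0 ζ) x
            + partialDeriv 1 (partialDeriv 1 ζ) x)) := by
      congr 1; ext x; ring
    linarith
  have hvL : ∀ k ζ, IsTestFunction U ζ → ∫ x, v k x *
      (partialDeriv 0 (partialDeriv 0 ζ) x + partialDeriv 1 (partialDeriv 1 ζ) x)
        = (∫ x, S k 1 x * partialDeriv 0 ζ x) - ∫ x, S k 0 x * partialDeriv 1 ζ x := by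
    intro k ζ hζ
    rw [hadd (hv k) ((hζ.partialDeriv 0).partialDeriv 0) ((hζ.partialDeriv 1).partialDeriv 1),
      hv0 k _ (hζ.partialDeriv 0), hv1 k _ (hζ.partialDeriv 1), sub_eq_add_neg]
  have hxτ : ∀ i : Fin 2, MemL2 U fun x => x i * τ x := by
    intro i
    obtain ⟨B, hB⟩ := hb.exists_norm_le
    refine MemLp.of_le_mul (c := B) hτm
      ((contDiff_coord i).continuous.aestronglyMeasurable.mul hτm.1) ?_
    filter_upwards [ae_restrict_mem hU.measurableSet] with x hx
    rw [norm_mul]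
    gcongr
    exact (PiLp.norm_apply_le x i).trans (hB x hx)
  -- `c = -1/2` for the first component and `c = 1/2` for the second one
  have hw : ∀ k i (c : ℝ), (∀ ζ, IsTestFunction U ζ →
      (∫ x, S k 1 x * partialDeriv 0 ζ x) - (∫ x, S k 0 x * partialDeriv 1 ζ x)
        = 2 * c * ∫ x, τ x * partialDeriv i ζ x) →
      ∃ v', ContDiffOn ℝ ∞ v' U ∧ v' =ᵐ[volume.restrict U] v k := by
    intro k i c hk
    obtain ⟨τ', hτ's, hτ'⟩ := exists_contDiffOn_of_memL2 hU hfin hτm hτharm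
    have hwm : MemL2 U fun x => v k x + c * (x i * τ x) := (hv k).add ((hxτ i).const_mul c)
    obtain ⟨w, hws, hw⟩ := exists_contDiffOn_of_memL2 hU hfin hwm fun ζ hζ => by
      have tL := ((hζ.partialDeriv 0).partialDeriv 0).add ((hζ.partialDeriv 1).partialDeriv 1)
      have hi : Integrable fun x => c * (x i * τ x * (partialDeriv 0 (partialDeriv 0 ζ) x
          + partialDeriv 1 (partialDeriv 1 ζ) x)) := ((hxτ i).integrable_mul tL).const_mul c
      simp only [add_mul, mul_assoc c]
      rw [integral_add ((hv k).integrable_mul tL) hi, integral_const_mul, hvL k ζ hζ,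
        hcoord i ζ hζ, hk ζ hζ]
      ring
    refine ⟨fun x => w x - c * (x i * τ' x),
      hws.sub (contDiffOn_const.mul ((contDiff_coord i).contDiffOn.mul hτ's)), ?_⟩
    filter_upwards [hw, hτ'] with x h1 h2
    rw [h1, h2]; ring
  have h0 := hw 0 1 (-1 / 2) fun ζ hζ => by
    have := hdiv 1 hζ
    rw [hsym (hζ.partialDeriv 0)] at this
    rw [hτI (hζ.partialDeriv 1)]
    linarith
  have h1 := hw 1 0 (1 / 2) fun ζ hζ => by
    have := hdiv 0 hζ
    rw [hsym (hζ.partialDeriv 1), hτI (hζ.partialDeriv 0)]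
    linarith
  obtain ⟨v0, hv0⟩ := h0
  obtain ⟨v1, hv1⟩ := h1
  exact ⟨![v0, v1], fun k => by fin_cases k; exacts [hv0, hv1]⟩

/-! ### The rows of the stress as limits of rotated gradients -/

/-- A bounded closed set separates its complement into the unbounded component `O` and the bounded
rest `V`. -/
lemma exists_unbounded_component {C : Set Plane} (hC : IsClosed C) {R : ℝ} (hR : 0 ≤ R)
    (hCR : C ⊆ closedBall 0 R) : ∃ O V : Set Plane, IsOpen O ∧ IsOpen V ∧ IsPreconnected O ∧
      Disjoint O V ∧ O ∪ V = Cᶜ ∧ {x | R < ‖x‖} ⊆ O ∧ V ⊆ closedBall 0 R := by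
  set p : Plane := EuclideanSpace.single 0 (R + 1) with hp
  have hpn : R < ‖p‖ := by
    rw [hp, PiLp.norm_single, Real.norm_of_nonneg (by linarith)]; linarith
  have hext : {x : Plane | R < ‖x‖} ⊆ Cᶜ := fun x hx hxC =>
    (not_le.2 hx) (by simpa using hCR hxC)
  set O := connectedComponentIn Cᶜ p with hO
  have hsub : {x : Plane | R < ‖x‖} ⊆ O :=
    (isPreconnected_norm_gt R hR).subset_connectedComponentIn hpn hext
  have hOo : IsOpen O := hC.isOpen_compl.connectedComponentIn
  have hV : IsOpen (Cᶜ \ O) := by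
    refine isOpen_iff_mem_nhds.2 fun x hx => ?_
    refine mem_of_superset
      (hC.isOpen_compl.connectedComponentIn.mem_nhds (mem_connectedComponentIn hx.1))
      fun y hy => ⟨connectedComponentIn_subset _ _ hy, fun hyO => hx.2 ?_⟩
    rw [hO, connectedComponentIn_eq hyO, ← connectedComponentIn_eq hy]
    exact mem_connectedComponentIn hx.1
  refine ⟨O, Cᶜ \ O, hOo, hV, isPreconnected_connectedComponentIn, disjoint_sdiff_self_right,
    union_sdiff_cancel (connectedComponentIn_subset _ _), hsub, fun x hx => ?_⟩
  by_contra h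
  exact hx.2 (hsub (by simpa using h))

lemma curlField_add_const_mul {f g : Plane → ℝ} (hf : Differentiable ℝ f)
    (hg : Differentiable ℝ g) (c : ℝ) :
    curlField (fun x => f x + c * g x) = curlField f + c • curlField g := by
  have : ∀ j x, partialDeriv j (fun x => f x + c * g x) x
      = partialDeriv j f x + c * partialDeriv j g x := fun j x => by
    rw [partialDeriv_add (hf x) ((hg x).const_mul c), partialDeriv_const_mul (hg x)]
  ext x i
  fin_cases i
  · simp [this]
  · simp [this]; ring

lemma enorm_curlField (f : Plane → ℝ) (x : Plane) : ‖curlField f x‖ₑ = ‖gradField f x‖ₑ := by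
  rw [← ofReal_norm, ← ofReal_norm, EuclideanSpace.norm_eq, EuclideanSpace.norm_eq,
    Fin.sum_univ_two, Fin.sum_univ_two]
  simp [add_comm]

lemma continuous_curlField {f : Plane → ℝ} (hf : ContDiff ℝ ∞ f) : Continuous (curlField f) := by
  refine (PiLp.continuous_toLp 2 _).comp (continuous_pi fun i => ?_)
  fin_cases i
  · exact (hf.partialDeriv 1).continuous
  · exact (hf.partialDeriv 0).continuous.neg

lemma IsTestFunction.memLp_curlField {U : Set Plane} {f : Plane → ℝ} (hf : IsTestFunction U f)
    (μ : Measure Plane) [IsFiniteMeasureOnCompacts μ] : MemLp (curlField f) 2 μ := by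
  refine (continuous_curlField hf.smooth).memLp_of_hasCompactSupport
    (HasCompactSupport.intro hf.compact_support fun z hz => ?_)
  have h0 : ∀ j, _root_.partialDeriv j f z = 0 := fun j =>
    image_eq_zero_of_notMem_tsupport fun h => hz (tsupport_partialDeriv_subset _ j h)
  ext i; fin_cases i
  · simp [h0]
  · simp [h0]

/-- The `k`-th row of the stress. -/
noncomputable def stressRow (lam mu : ℝ) (e : Plane → Mat2) (k : Fin 2) (x : Plane) : Plane :=
  !₂[hooke lam mu (e x) k 0, hooke lam mu (e x) k 1]

@[simp] lemma stressRow_zero (lam mu : ℝ) (e : Plane → Mat2) (k : Fin 2) (x : Plane) :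
    stressRow lam mu e k x 0 = hooke lam mu (e x) k 0 := rfl

@[simp] lemma stressRow_one (lam mu : ℝ) (e : Plane → Mat2) (k : Fin 2) (x : Plane) :
    stressRow lam mu e k x 1 = hooke lam mu (e x) k 1 := rfl

lemma memLp_stressRow {U : Set Plane} (lam mu : ℝ) {e : Plane → Mat2}
    (he : ∀ i j, MemL2 U (fun x => e x i j)) (k : Fin 2) :
    MemLp (stressRow lam mu e k) 2 (volume.restrict U) := by
  refine MemLp.of_eval_piLp fun i => ?_
  fin_cases i
  · exact memL2_hooke lam mu he k 0
  · exact memL2_hooke lam mu he k 1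

lemma restrict_le_restrict_diff {A Ω Γ : Set Plane} (hΓ : volume Γ = 0) (hA : A ⊆ Ω) :
    volume.restrict A ≤ volume.restrict (Ω \ Γ) := by
  rw [← Measure.restrict_congr_set (sdiff_null_ae_eq_self (s := A) hΓ)]
  exact Measure.restrict_mono (sdiff_subset_sdiff_left hA) le_rfl

/-- The key approximation. By duality it suffices that a field `G` orthogonal to all rotated
gradients of test functions off `C` is orthogonal to the row. Such a `G` is the gradient of some `θ`
in the unbounded component of the complement of `C`, and `θ`, cut off to this component, is
admissible in the Euler–Lagrange equation; in the other components the stress vanishes. -/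
lemma IsElasticMinimizer.exists_curlField_approx {lam mu : ℝ} (hlam : 0 < lam) (hmu : 0 < mu)
    {Ω Γ : Set Plane} {ψ u : Plane → Plane} {e : Plane → Mat2}
    (h : IsElasticMinimizer lam mu Ω Γ ψ u e) (hΩ : IsOpen Ω) (hΓ : IsClosed Γ)
    (hΓ0 : volume Γ = 0) {C : Set Plane} (hC : IsPreconnected C) (hne : C.Nonempty)
    (hCc : IsClosed C) (hCΓ : C ⊆ Γ) {R R₁ R₂ : ℝ} (hCR : C ⊆ closedBall 0 R) (hR : R < R₂)
    (hR₁ : R₁ < R₂) (hR₂ : closedBall 0 R₂ ⊆ Ω) (k : Fin 2) {ε : ℝ≥0∞} (hε : 0 < ε) :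
    ∃ f, IsTestFunction Cᶜ f ∧
      eLpNorm (fun x => stressRow lam mu e k x - curlField f x) 2
        (volume.restrict (ball 0 R₁)) < ε := by
  obtain ⟨c, hc⟩ := hne
  have hR0 : 0 ≤ R := nonempty_closedBall.1 ⟨c, hCR hc⟩
  have hB₂ : ball (0 : Plane) R₂ ⊆ Ω := ball_subset_closedBall.trans hR₂
  have hB : ball (0 : Plane) R₁ ⊆ Ω := (ball_subset_ball hR₁.le).trans hB₂
  let 𝒱 : Submodule ℝ (Plane → Plane) :=
    { carrier := {X | ∃ f, IsTestFunction Cᶜ f ∧ X = curlField f}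
      zero_mem' := ⟨fun _ => 0, IsTestFunction.zero, by
        ext x i
        fin_cases i
        · simp [partialDeriv]
        · simp [partialDeriv]⟩
      add_mem' := by
        rintro _ _ ⟨f, hf, rfl⟩ ⟨g, hg, rfl⟩
        refine ⟨fun x => f x + 1 * g x, hf.add (hg.const_mul 1), ?_⟩
        rw [curlField_add_const_mul hf.differentiable hg.differentiable, one_smul]
      smul_mem' := by
        rintro a _ ⟨f, hf, rfl⟩
        refine ⟨fun x => (fun _ => 0) x + a * f x, IsTestFunction.zero.add (hf.const_mul a), ?_⟩
        rw [curlField_add_const_mul (differentiable_const _) hf.differentiable]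
        ext x i
        fin_cases i
        · simp [partialDeriv]
        · simp [partialDeriv] }
  have hs : MemLp (stressRow lam mu e k) 2 (volume.restrict (ball 0 R₁)) :=
    (memLp_stressRow lam mu h.memLD.strain_memL2 k).mono_measure
      (restrict_le_restrict_diff hΓ0 hB)
  suffices horth : ∀ G : Plane → Plane, MemLp G 2 (volume.restrict (ball 0 R₁)) →
      (∀ X ∈ 𝒱, ∫ x in ball 0 R₁, inner ℝ (X x) (G x) = 0) →
      ∫ x in ball 0 R₁, inner ℝ (stressRow lam mu e k x) (G x) = 0 by
    obtain ⟨_, ⟨f, hf, rfl⟩, hlt⟩ := exists_mem_eLpNorm_sub_lt 𝒱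
      (by rintro _ ⟨f, hf, rfl⟩; exact hf.memLp_curlField _) hs horth hε
    exact ⟨f, hf, hlt⟩
  intro G hG hG𝒱
  set G' : Plane → Plane := (ball 0 R₁).indicator G with hG'
  have hG'm : MemLp G' 2 volume := (memLp_indicator_iff_restrict measurableSet_ball).2 hG
  have hG'0 : ∀ x ∉ ball (0 : Plane) R₁, G' x = 0 := fun x hx => indicator_of_notMem hx _
  have hinner : ∀ X : Plane → Plane,
      ∫ x in ball 0 R₁, inner ℝ (X x) (G x) = ∫ x, inner ℝ (X x) (G' x) := by
    intro X
    rw [← integral_indicator measurableSet_ball]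
    refine integral_congr_ae (Eventually.of_forall fun x => ?_)
    by_cases hx : x ∈ ball (0 : Plane) R₁
    · simp only [hG', indicator_of_mem hx]
    · simp only [hG', indicator_of_notMem hx, inner_zero_right]
  have hGorth : ∀ f, IsTestFunction Cᶜ f → ∫ x, inner ℝ (curlField f x) (G' x) = 0 :=
    fun f hf => by rw [← hinner]; exact hG𝒱 _ ⟨f, hf, rfl⟩
  have happ : ∀ n : ℕ, ∃ φ, IsTestFunction (ball 0 R₂) φ ∧ eLpNorm (gradField φ - G') 2
      (volume.restrict (thickening (1 / ((n : ℝ) + 1)) C)ᶜ) < 2⁻¹ ^ n := fun n =>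
    exists_gradField_approx hC ⟨c, hc⟩ hR₁ hCR hR hG'm hG'0 hGorth Nat.one_div_pos_of_nat
      (ENNReal.pow_pos (by simp) n)
  choose φ hφ hφG using happ
  obtain ⟨O, V, hO, hV, hOc, hd, hOV, hext, hVR⟩ := exists_unbounded_component hCc hR0 hCR
  have hpn : ‖(EuclideanSpace.single 0 (R₂ + 1) : Plane)‖ = R₂ + 1 := by
    rw [PiLp.norm_single, Real.norm_of_nonneg (by linarith)]
  obtain ⟨θ, hθ0, hθL, hθ⟩ := exists_potential hO hOc hφ hG'm (fun L hL hLO => by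
      obtain ⟨δ, hδ, hδL⟩ := hL.exists_thickening_subset_open hCc.isOpen_compl
        fun x hx => hOV.subset (Or.inl (hLO hx))
      obtain ⟨N, hN⟩ := exists_nat_one_div_lt hδ
      refine ⟨N, fun n hn => (eLpNorm_mono_measure _ (Measure.restrict_mono ?_ le_rfl)).trans
        (hφG n).le⟩
      intro x hx hxC
      obtain ⟨z, hz, hxz⟩ := mem_thickening_iff.1 hxC
      refine hδL (mem_thickening_iff.2 ⟨x, hx, ?_⟩) hz
      rw [dist_comm]
      exact (hxz.trans_le (Nat.one_div_le_one_div hn)).trans hN)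
    (p := EuclideanSpace.single 0 (R₂ + 1)) (hext (by rw [mem_ofPred_eq, hpn]; linarith)) one_pos
    (disjoint_left.2 fun x hx hx' => by
      rw [mem_ball, dist_eq_norm] at hx
      rw [mem_ball_zero_iff] at hx'
      have := norm_sub_norm_le (EuclideanSpace.single 0 (R₂ + 1) : Plane) x
      rw [hpn, norm_sub_rev] at this
      linarith)
  have hU : Ω \ Γ ⊆ O ∪ V := by
    rw [hOV]
    exact fun x hx hxC => hx.2 (hCΓ hxC)
  have hrow := h.row_orthogonal hΩ hΓ isClosed_closedBall hR₂ (φ := O.indicator θ)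
    (g := fun j => O.indicator fun x => G' x j) (fun L hL hLU => ?_) (fun j => ?_)
    (fun j ζ hζ => ?_) (fun x hx => ?_) k
  · have he0 := h.strain_eq_zero hlam hmu hΩ hΓ isClosed_closedBall
      ((closedBall_subset_closedBall hR.le).trans hR₂) hO hV hd hU hVR
    rw [hinner, ← setIntegral_eq_integral_of_forall_compl_eq_zero (s := Ω) fun x hx => by
      rw [hG'0 x fun hx' => hx (hB hx'), inner_zero_right],
      ← setIntegral_congr_set (sdiff_null_ae_eq_self (s := Ω) hΓ0), ← hrow]
    refine integral_congr_ae ?_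
    filter_upwards [he0, ae_restrict_mem (hΩ.sdiff hΓ).measurableSet] with x hx hxU
    rw [inner_plane]
    by_cases hxO : x ∈ O
    · simp [hxO]
    · have hx0 := hx ((hU hxU).resolve_left hxO)
      simp [hxO, hooke_apply, hx0]
  · rw [memLp_indicator_iff_restrict hO.measurableSet, Measure.restrict_restrict hO.measurableSet]
    have hsub : O ∩ L ⊆ L \ V := fun x hx => ⟨hx.2, disjoint_left.1 hd hx.1⟩
    exact (hθL (L \ V) (hL.diff hV) fun x hx => (hU (hLU hx.1)).resolve_right hx.2).mono_measure
      (Measure.restrict_mono hsub le_rfl)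
  · exact (MemLp.indicator hO.measurableSet (hG'm.coord j)).restrict _
  · obtain ⟨h1, h2⟩ := hζ.indicator hO hV hd hU
    have := hθ j _ (h1.mono inter_subset_right)
    rw [h2] at this
    convert this using 2
    · ext x
      by_cases hx : x ∈ O <;> simp [hx]
    · congr 1
      ext x
      by_cases hx : x ∈ O <;> simp [hx]
  · have : θ x = 0 := hθ0 x fun hx' => hx (ball_subset_closedBall hx')
    by_cases hxO : x ∈ O <;> simp [hxO, this]

/-! ### Construction of the conjugate -/

lemma eLpNorm_curlField (f : Plane → ℝ) (μ : Measure Plane) :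
    eLpNorm (curlField f) 2 μ = eLpNorm (gradField f) 2 μ :=
  eLpNorm_congr_enorm_ae (Eventually.of_forall (enorm_curlField f))

/-- Each row of the stress is a rotated gradient. The approximating potentials vanish on `C`, which
meets every small circle, so that they converge together with their gradients. -/
lemma IsElasticMinimizer.exists_conjugate_row {lam mu : ℝ} (hlam : 0 < lam) (hmu : 0 < mu)
    {Ω Γ : Set Plane} {ψ u : Plane → Plane} {e : Plane → Mat2}
    (h : IsElasticMinimizer lam mu Ω Γ ψ u e) (hΩ : IsOpen Ω) (hΓ : IsClosed Γ)
    (hΓ0 : volume Γ = 0) {C : Set Plane} (hC : IsPreconnected C) (hne : C.Nonempty)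
    (hCc : IsClosed C) (hCΓ : C ⊆ Γ) {R R₀ R₁ R₂ : ℝ} (hCR : C ⊆ closedBall 0 R) (hR : R < R₂)
    (hR₁ : R₁ < R₂) (hR₂ : closedBall 0 R₂ ⊆ Ω) (hR₀ : 0 < R₀) (hR₀₁ : R₀ < R₁)
    (hcirc : ∀ r, 0 < r → r < R₀ → ∃ y ∈ C, ‖y‖ = r) (k : Fin 2) :
    ∃ (v : Plane → ℝ) (f : ℕ → Plane → ℝ), (∀ n, IsTestFunction Cᶜ (f n)) ∧
      MemL2 (ball 0 R₁) v ∧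
      Tendsto (fun n => eLpNorm (fun x => v x - f n x) 2 (volume.restrict (ball 0 R₁))) atTop
        (𝓝 0) ∧
      Tendsto (fun n => eLpNorm (fun x => stressRow lam mu e k x - curlField (f n) x) 2
        (volume.restrict (ball 0 R₁))) atTop (𝓝 0) := by
  set μ := volume.restrict (ball (0 : Plane) R₁) with hμ
  have happ : ∀ n : ℕ, ∃ f, IsTestFunction Cᶜ f ∧
      eLpNorm (fun x => stressRow lam mu e k x - curlField f x) 2 μ < 2⁻¹ ^ n := fun n =>
    h.exists_curlField_approx hlam hmu hΩ hΓ hΓ0 hC hne hCc hCΓ hCR hR hR₁ hR₂ k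
      (ENNReal.pow_pos (by simp) n)
  choose f hf hfs using happ
  have hB : ball (0 : Plane) R₁ ⊆ Ω :=
    (ball_subset_ball hR₁.le).trans (ball_subset_closedBall.trans hR₂)
  have hs : MemLp (stressRow lam mu e k) 2 μ :=
    (memLp_stressRow lam mu h.memLD.strain_memL2 k).mono_measure
      (restrict_le_restrict_diff hΓ0 hB)
  have hgrad : ∀ n, eLpNorm (gradField (f (n + 1) - f n)) 2 μ ≤ 2 * 2⁻¹ ^ n := by
    intro n
    have e1 : curlField (f (n + 1) - f n)
        = (fun x => stressRow lam mu e k x - curlField (f n) x)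
          - fun x => stressRow lam mu e k x - curlField (f (n + 1)) x := by
      have : (f (n + 1) - f n) = fun x => f (n + 1) x + (-1) * f n x := by
        ext x; simp [sub_eq_add_neg]
      rw [this, curlField_add_const_mul (hf _).differentiable (hf _).differentiable]
      ext x i
      simp
      ring
    have hm : ∀ n, AEStronglyMeasurable (fun x => stressRow lam mu e k x - curlField (f n) x) μ :=
      fun n => hs.1.sub (continuous_curlField (hf n).smooth).aestronglyMeasurable
    rw [← eLpNorm_curlField, e1]
    refine (eLpNorm_sub_le (hm _) (hm _) one_le_two).trans ?_
    rw [two_mul]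
    refine add_le_add (hfs n).le ((hfs (n + 1)).le.trans ?_)
    exact pow_le_pow_of_le_one (by simp) (by simp) (Nat.le_succ n)
  obtain ⟨K, hK, hWir⟩ := exists_eLpNorm_ball_le 0 0 R₁ R₀ hR₀ (ball_subset_ball hR₀₁.le)
  have hgeo : ∀ n, eLpNorm (f (n + 1) - f n) 2 μ
      ≤ K * (ENNReal.ofReal (2 * Real.pi * R₀) * 2 + 2) * 2⁻¹ ^ n := by
    intro n
    have hsm : ContDiff ℝ ∞ (f (n + 1) - f n) := (hf (n + 1)).smooth.sub (hf n).smooth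
    have h1 := eLpNorm_ball_le_of_zero_on_circles hsm (R := R₀) fun r hr0 hr => by
      obtain ⟨y, hy, hyr⟩ := hcirc r hr0 hr
      refine ⟨y, hyr, ?_⟩
      simp [(hf (n + 1)).eq_zero (not_not.2 hy), (hf n).eq_zero (not_not.2 hy)]
    calc eLpNorm (f (n + 1) - f n) 2 μ
        ≤ K * (eLpNorm (f (n + 1) - f n) 2 (volume.restrict (ball 0 R₀))
          + eLpNorm (gradField (f (n + 1) - f n)) 2 μ) := hWir _ hsm
      _ ≤ K * (ENNReal.ofReal (2 * Real.pi * R₀) * (2 * 2⁻¹ ^ n) + 2 * 2⁻¹ ^ n) := by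
          gcongr
          · refine h1.trans ?_
            gcongr
            exact (eLpNorm_mono_measure _ (Measure.restrict_mono
              (ball_subset_ball hR₀₁.le) le_rfl)).trans (hgrad n)
          · exact hgrad n
      _ = _ := by ring
  obtain ⟨hlim, hlim'⟩ := tendsto_eLpNorm_of_geometric
    (fun n => (hf n).continuous.aestronglyMeasurable) (by finiteness) hgeo
  set v : Plane → ℝ := fun x => limUnder atTop fun n => f n x with hv
  have hvm : StronglyMeasurable v :=
    StronglyMeasurable.limUnder fun n => (hf n).continuous.stronglyMeasurable
  have hfv := hlim' v (hlim.mono fun y hy => tendsto_nhds_limUnder hy)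
  refine ⟨v, f, hf, Lp.memLp_of_cauchy_tendsto one_le_two (fun n => (hf n).memLp 2 μ) v
    hvm.aestronglyMeasurable hfv, ?_, ?_⟩
  · refine hfv.congr fun n => ?_
    rw [eLpNorm_sub_comm]; rfl
  · exact tendsto_of_tendsto_of_tendsto_of_le_of_le tendsto_const_nhds
      (ENNReal.tendsto_pow_atTop_nhds_zero_of_lt_one (r := 2⁻¹) (by simp)) (fun _ => zero_le)
      fun n => (hfs n).le

/-- Integration by parts passes to limits in `H¹`. -/
lemma integral_mul_partialDeriv_of_tendsto {D W : Set Plane} {v g : Plane → ℝ}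
    {f : ℕ → Plane → ℝ} {j : Fin 2} (hf : ∀ n, IsTestFunction W (f n)) (hv : MemL2 D v)
    (hg : MemL2 D g)
    (h1 : Tendsto (fun n => eLpNorm (fun x => v x - f n x) 2 (volume.restrict D)) atTop (𝓝 0))
    (h2 : Tendsto (fun n => eLpNorm (fun x => g x - partialDeriv j (f n) x) 2
      (volume.restrict D)) atTop (𝓝 0)) {ζ : Plane → ℝ} (hζ : IsTestFunction D ζ) :
    ∫ x, v x * partialDeriv j ζ x = -∫ x, g x * ζ x := by
  have t1 := tendsto_integral_mul (fun n => (hf n).memLp 2 (volume.restrict D)) hv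
    ((hζ.partialDeriv j).memLp 2 (volume.restrict D))
    (h1.congr fun n => by rw [eLpNorm_sub_comm]; rfl)
  have t2 := tendsto_integral_mul (fun n => ((hf n).partialDeriv j).memLp 2 (volume.restrict D))
    hg (hζ.memLp 2 (volume.restrict D))
    (h2.congr fun n => by rw [eLpNorm_sub_comm]; rfl)
  rw [hζ.setIntegral_mul_eq, funext fun n => hζ.setIntegral_mul_eq (partialDeriv j (f n))] at t2
  rw [(hζ.partialDeriv j).setIntegral_mul_eq,
    funext fun n => (hζ.partialDeriv j).setIntegral_mul_eq (f n)] at t1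
  refine tendsto_nhds_unique (t1.congr fun n => ?_) t2.neg
  exact integral_mul_partialDeriv isOpen_univ (hf n).smooth.contDiffOn (hζ.mono (subset_univ _)) j

/-- The existence of `v₀`, given a connected part `C` of `Γ` that contains `Γ ∩ closedBall 0 R₀` and
stays inside a disc on which the Euler–Lagrange equation may be tested. -/
lemma IsElasticMinimizer.exists_isHarmonicConjugate {lam mu : ℝ} (hlam : 0 < lam) (hmu : 0 < mu)
    {Ω Γ : Set Plane} {ψ u : Plane → Plane} {e : Plane → Mat2}
    (h : IsElasticMinimizer lam mu Ω Γ ψ u e) (hΩ : IsOpen Ω) (hΓ : IsClosed Γ)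
    (hΓ0 : volume Γ = 0) (hΓconn : IsPreconnected Γ) (h0 : (0 : Plane) ∈ Γ) {C : Set Plane}
    (hC : IsPreconnected C) {R R₀ R₁ R₂ : ℝ} (hR₀ : 0 < R₀) (hR₀₁ : R₀ < R₁)
    (hΓC : Γ ∩ closedBall 0 R₀ ⊆ C) (hCΓ : C ⊆ Γ ∩ closedBall 0 R) (hR : R < R₂)
    (hR₁ : R₁ < R₂) (hR₂ : closedBall 0 R₂ ⊆ Ω) (hne : (sphere 0 R₁ ∩ Γ).Nonempty) :
    ∃ v₀, IsHarmonicConjugate R₀ Γ (fun x => hooke lam mu (e x)) v₀ := by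
  have hCcl : closure C ⊆ Γ ∩ closedBall 0 R :=
    closure_minimal hCΓ (hΓ.inter isClosed_closedBall)
  have hΓC' : Γ ∩ closedBall 0 R₀ ⊆ closure C := hΓC.trans subset_closure
  obtain ⟨p, hp, hpΓ⟩ := hne
  have hpR : ‖p‖ = R₁ := by simpa using hp
  have hcirc : ∀ r, 0 < r → r < R₀ → ∃ y ∈ closure C, ‖y‖ = r := fun r hr0 hr => by
    obtain ⟨y, hy, hyr⟩ := exists_mem_norm_eq hΓconn h0 hpΓ hr0.le (by linarith)
    exact ⟨y, hΓC' ⟨hy, by simpa [hyr] using hr.le⟩, hyr⟩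
  choose v f hf hv hfv hfs using h.exists_conjugate_row hlam hmu hΩ hΓ hΓ0 hC.closure
    ⟨0, hΓC' ⟨h0, by simpa using hR₀.le⟩⟩ isClosed_closure (hCcl.trans inter_subset_left)
    (hCcl.trans inter_subset_right) hR hR₁ hR₂ hR₀ hR₀₁ hcirc
  set D := ball (0 : Plane) R₁ with hD
  have hDΩ : D ⊆ Ω := (ball_subset_ball hR₁.le).trans (ball_subset_closedBall.trans hR₂)
  have hle := restrict_le_restrict_diff hΓ0 hDΩ
  have hS : ∀ i j, MemL2 D fun x => hooke lam mu (e x) i j := fun i j =>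
    MemLp.mono_measure hle (memL2_hooke lam mu h.memLD.strain_memL2 i j)
  -- the gradient of the `k`-th component
  set g : Fin 2 → Fin 2 → Plane → ℝ := fun k j x => rotatedStress (hooke lam mu (e x)) k j with hg
  have hsymm : ∀ᵐ x ∂(volume.restrict D), e x 0 1 = e x 1 0 :=
    ae_mono hle (h.memLD.ae_symm (hΩ.sdiff hΓ) 0 1)
  have hg0 : ∀ k x, g k 0 x = -hooke lam mu (e x) k 1 := fun k x => by
    fin_cases k <;> simp [hg, rotatedStress]
  have hg1 : ∀ k, g k 1 =ᵐ[volume.restrict D] fun x => hooke lam mu (e x) k 0 := fun k => by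
    filter_upwards [hsymm] with x hx
    fin_cases k <;> simp [hg, rotatedStress, hooke_apply, hx]
  have hgm : ∀ k j, MemL2 D (g k j) := fun k j => by
    fin_cases j
    · exact (memLp_congr_ae (Eventually.of_forall (hg0 k))).2 (hS k 1).neg
    · exact (memLp_congr_ae (hg1 k)).2 (hS k 0)
  have hgf : ∀ k j, Tendsto (fun n => eLpNorm (fun x => g k j x - partialDeriv j (f k n) x) 2
      (volume.restrict D)) atTop (𝓝 0) := fun k j => by
    refine tendsto_of_tendsto_of_tendsto_of_le_of_le tendsto_const_nhds (hfs k)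
      (fun _ => zero_le) fun n => ?_
    fin_cases j
    · refine le_trans (le_of_eq ?_) (eLpNorm_coord_le _ 1)
      refine eLpNorm_congr_norm_ae (Eventually.of_forall fun x => ?_)
      change ‖g k 0 x - partialDeriv 0 (f k n) x‖
        = ‖hooke lam mu (e x) k 1 - -partialDeriv 0 (f k n) x‖
      rw [hg0, ← norm_neg]
      congr 1
      ring
    · refine le_trans (le_of_eq ?_) (eLpNorm_coord_le _ 0)
      refine eLpNorm_congr_ae ?_
      filter_upwards [hg1 k] with x hx
      simp [hx]
  have hweak : ∀ k j ζ, IsTestFunction D ζ →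
      ∫ x, v k x * partialDeriv j ζ x = -∫ x, g k j x * ζ x := fun k j ζ hζ =>
    integral_mul_partialDeriv_of_tendsto (hf k) (hv k) (hgm k j) (hfv k) (hgf k j) hζ
  set U := D \ Γ with hU
  have hUo : IsOpen U := isOpen_ball.sdiff hΓ
  have hUD : volume.restrict U = volume.restrict D :=
    Measure.restrict_congr_set (sdiff_null_ae_eq_self hΓ0)
  have hUe : HasLDStrain U u e := h.memLD.mono (sdiff_subset_sdiff_left hDΩ)
  obtain ⟨v', hv'⟩ := exists_smooth_representative hlam hmu hUo
    (isBounded_ball.subset sdiff_subset) hUe (v := v) (fun k => by rw [MemL2, hUD]; exact hv k)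
    (fun k ζ hζ => by
      rw [hweak k 0 ζ (hζ.mono sdiff_subset), ← integral_neg]
      simp [hg0])
    (fun k ζ hζ => by
      have hζD := hζ.mono (sdiff_subset : U ⊆ D)
      rw [hweak k 1 ζ hζD, ← hζD.setIntegral_mul_eq, ← hζD.setIntegral_mul_eq]
      congr 1
      refine integral_congr_ae ?_
      filter_upwards [hg1 k] with x hx
      rw [hx])
  rw [hUD] at hv'
  have hB : ball (0 : Plane) R₀ ⊆ D := ball_subset_ball hR₀₁.le
  have hBle : volume.restrict (ball (0 : Plane) R₀) ≤ volume.restrict D :=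
    Measure.restrict_mono hB le_rfl
  have hv'B : ∀ k, v' k =ᵐ[volume.restrict (ball 0 R₀)] v k := fun k => ae_mono hBle (hv' k).2
  refine ⟨fun x => !₂[v' 0 x, v' 1 x], fun k => ?_, ?_, ?_⟩
  · have hk : (fun x => (!₂[v' 0 x, v' 1 x] : Plane) k) = v' k := by
      ext x; fin_cases k <;> rfl
    rw [hk]
    refine ⟨g k, ⟨(memLp_congr_ae (hv'B k)).2 (MemLp.mono_measure hBle (hv k)),
      fun j => MemLp.mono_measure hBle (hgm k j), fun j ζ hζ => ?_⟩, f k, fun n => ?_, ?_,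
      fun j => ?_⟩
    · rw [hζ.setIntegral_mul_eq, ← hweak k j ζ (hζ.mono hB),
        ← (hζ.partialDeriv j).setIntegral_mul_eq (v k)]
      refine integral_congr_ae ?_
      filter_upwards [hv'B k] with x hx
      rw [hx]
    · refine (hf k n).mono (compl_subset_compl.2 ?_)
      refine (inter_subset_inter_right Γ ?_).trans hΓC'
      exact closure_ball_subset_closedBall
    · refine tendsto_of_tendsto_of_tendsto_of_le_of_le tendsto_const_nhds (hfv k)
        (fun _ => zero_le) fun n => ?_
      refine (le_of_eq (eLpNorm_congr_ae ?_)).trans (eLpNorm_mono_measure _ hBle)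
      filter_upwards [hv'B k] with x hx
      rw [hx]
    · exact tendsto_of_tendsto_of_tendsto_of_le_of_le tendsto_const_nhds (hgf k j)
        (fun _ => zero_le) fun n => eLpNorm_mono_measure _ hBle
  · have hsub : closedBall (0 : Plane) R₀ \ Γ ⊆ U :=
      sdiff_subset_sdiff_left (closedBall_subset_ball hR₀₁)
    refine contDiffOn_euclidean.2 fun k => ?_
    fin_cases k
    · exact (hv' 0).1.mono hsub
    · exact (hv' 1).1.mono hsub
  · have hder : ∀ k j, ∀ᵐ x ∂(volume.restrict U), partialDeriv j (v' k) x = g k j x := fun k j =>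
      partialDeriv_ae_eq_of_weak hUo (hv' k).1 (by rw [hUD]; exact (hv' k).2)
        (by rw [MemL2, hUD]; exact hgm k j) fun ζ hζ => hweak k j ζ (hζ.mono sdiff_subset)
    refine ae_mono (Measure.restrict_mono (sdiff_subset_sdiff_left hB) le_rfl)
      (ae_all_iff.2 fun k => ae_all_iff.2 fun j => ?_)
    filter_upwards [hder k j] with x hx
    refine Eq.trans ?_ hx
    fin_cases k <;> rfl

theorem mainTheorem8 (Ω Γ₀ : Set Plane) (hΩ : IsReferenceConfiguration Ω)
    (hΓ₀ : IsAdmissibleCrack Ω Γ₀) (hdens : HasDensityHalf Γ₀) :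
    ∃ r₀ : ℝ, 0 < r₀ ∧
      ∀ (lam mu : ℝ) (ψ u₀ : Plane → Plane) (e₀ : Plane → Mat2),
        0 < lam → 0 < mu → MemHHalfBoundary Ω ψ →
        IsElasticMinimizer lam mu Ω Γ₀ ψ u₀ e₀ →
        ∀ R₀ R₀' : ℝ, 0 < R₀ → R₀ < R₀' → closedBall 0 R₀' ⊆ Ω →
          (sphere 0 R₀' ∩ Γ₀).Nonempty →
          (R₀' ≤ r₀ ∨ ∃ C : Set Plane, IsPreconnected C ∧
            Γ₀ ∩ closedBall 0 R₀ ⊆ C ∧ C ⊆ Γ₀ ∩ closedBall 0 R₀') →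
          ∃ v₀ : Plane → Plane,
            IsHarmonicConjugate R₀ Γ₀ (fun x => hooke lam mu (e₀ x)) v₀ := by
  have hc := hΓ₀.isCompact
  have hconn := hΓ₀.isConnected.isPreconnected
  have hvol := volume_eq_zero_of_hausdorffMeasure_lt_top hΓ₀.finite_length
  obtain ⟨r, hr, hrC⟩ := exists_preconnected_of_density hc hconn hΓ₀.zero_mem
    hΓ₀.finite_length hdens
  -- if `0 ∉ Ω` no disc around the origin is contained in `Ω`, and any `r₀` will do
  obtain ⟨ε, hε, hεΩ⟩ : ∃ ε : ℝ, 0 < ε ∧ ((0 : Plane) ∈ Ω → closedBall 0 ε ⊆ Ω) := by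
    by_cases h0 : (0 : Plane) ∈ Ω
    · obtain ⟨ε, hε, h⟩ := Metric.nhds_basis_closedBall.mem_iff.1 (hΩ.isOpen.mem_nhds h0)
      exact ⟨ε, hε, fun _ => h⟩
    · exact ⟨1, one_pos, fun h => absurd h h0⟩
  refine ⟨min r (ε / 3), by positivity, fun lam mu ψ u₀ e₀ hlam hmu _ hmin R₀ R₀' hR₀ hRR hball
    hne hcase => ?_⟩
  rcases hcase with hle | ⟨C, hC, hΓC, hCΓ⟩
  · have h1 : R₀' ≤ r := hle.trans (min_le_left _ _)
    have h2 : R₀' ≤ ε / 3 := hle.trans (min_le_right _ _)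
    obtain ⟨C, hC, hΓC, hCΓ⟩ := hrC R₀ hR₀ (by linarith)
    exact hmin.exists_isHarmonicConjugate hlam hmu hΩ.isOpen hc.isClosed hvol hconn
      hΓ₀.zero_mem hC hR₀ hRR hΓC hCΓ (R₂ := ε) (by linarith) (by linarith)
      (hεΩ (hball (mem_closedBall_self (by linarith)))) hne
  · obtain ⟨δ, hδ, hδΩ⟩ :=
      (isCompact_closedBall (0 : Plane) R₀').exists_cthickening_subset_open hΩ.isOpen hball
    rw [cthickening_closedBall hδ.le (by linarith)] at hδΩ
    exact hmin.exists_isHarmonicConjugate hlam hmu hΩ.isOpen hc.isClosed hvol hconn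
      hΓ₀.zero_mem hC hR₀ hRR hΓC hCΓ (R₂ := δ + R₀') (by linarith) (by linarith) hδΩ hne
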